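/- All curves are smooth, irreducible, projective curves over $\mathbb{C}$. For a point $P$ of a curve $C$ choose a basis $\psi_1,\dots,\psi_d$ of the space of holomorphic $2$-differentials on $C$ with $\operatorname{ord}_P\psi_1<\dots<\operatorname{ord}_P\psi_d$ and put $n_i=\operatorname{ord}_P(\psi_i)+1$; the $2$-weight of $P$ is $\sum_{i=1}^{d}(n_i-i)$. Let $N_r$ be the number of points of $C$ of $2$-weight $r$. $D_8$ denotes the dihedral group of order $8$. For $t\in\mathbb{C}\setminus\{0,4\}$ let $C_t$ be the smooth projective model of $y^2=tx^8+tx^4+1$. **Proposition.** (i) Let $C$ be a hyperelliptic curve of genus $3$ with full automorphism group $\operatorname{Aut}(C)\cong\mathbb{Z}_2\times D_8$. Then $C$ is isomorphic to $C_t$ for some $t\in\mathbb{C}\setminus\{0,4\}$. (ii) For every $t\in\mathbb{C}\setminus\{0,4\}$, the points $(0,1)$ and $(0,-1)$ of $C_t$ and its two points at infinity have $2$-weight $3$. (iii) Let $t\in\mathbb{C}\setminus\{0,4\}$ and let $C$ be a curve isomorphic to $C_t$. Then $$(N_1,N_2,N_3)=\begin{cases}(24,0,12)&\text{if }t=196,\\(16,16,4)&\text{if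 }t=-\tfrac{196}{15},\\(48,0,4)&\text{otherwise.}\end{cases}$$ -/

import Mathlib

/-! Smooth projective curves over `ℂ` are treated through their function fields `K`: points are the
places of `K / ℂ`, isomorphisms of curves are `ℂ`-algebra isomorphisms, and differentials are
Kähler differentials of `K / ℂ`. -/

open scoped TensorProduct KaehlerDifferential

noncomputable section

namespace CurveFF

universe u

section General

variable (K : Type u) [Field K] [Algebra ℂ K]

/-- A point of the curve with function field `K`: a valuation ring of `K` that contains `ℂ` and is
different from `K`. -/
@[ext]
structure Place where
  ring : ValuationSubring K
  algebraMap_mem : ∀ c : ℂ, algebraMap ℂ K c ∈ ring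
  ne_top : ring ≠ ⊤

variable {K}

namespace Place

variable (P : Place K)

/-- `f` is regular at `P`, i.e. it has no pole there. -/
def IsRegular (f : K) : Prop := f ∈ P.ring

/-- `f` vanishes at `P`. -/
def IsZero (f : K) : Prop := P.ring.valuation f < 1

/-- `f` is regular and does not vanish at `P`. -/
def IsUnitAt (f : K) : Prop := P.ring.valuation f = 1

/-- `π` generates the maximal ideal of the local ring at `P`. -/
def IsUniformizer (π : K) : Prop :=
  P.IsZero π ∧ ∀ f : K, P.IsZero f → ∃ g : K, P.IsRegular g ∧ f = g * π

end Place

variable (K) in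
/-- The meromorphic `q`-differentials: the `q`-th tensor power over `K` of the (one-dimensional)
`K`-vector space of Kähler differentials. -/
abbrev QDiff (q : ℕ) : Type u := PiTensorProduct K (fun _ : Fin q => Ω[K⁄ℂ])

/-- The `q`-differential `(dπ)^q`. -/
def dpow (q : ℕ) (π : K) : QDiff K q :=
  PiTensorProduct.tprod K (fun _ : Fin q => KaehlerDifferential.D ℂ K π)

/-- `ord_P ψ = n`: with respect to a uniformizer `π` at `P`, `ψ = u π ^ n (dπ)^q` for a function
`u` that is regular and nonzero at `P`. -/
def Place.HasOrd (P : Place K) {q : ℕ} (ψ : QDiff K q) (n : ℤ) : Prop :=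
  ∃ π u : K, P.IsUniformizer π ∧ P.IsUnitAt u ∧ ψ = (u * π ^ n) • dpow q π

variable (K) in
/-- The space of holomorphic `q`-differentials: those that at every point `P` are of the form
`f (dπ)^q` with `f` regular at `P`, for the uniformizers `π` at `P`. -/
def holoDiff (q : ℕ) : Submodule ℂ (QDiff K q) where
  carrier := {ψ | ∀ (P : Place K) (π : K), P.IsUniformizer π →
    ∃ f : K, P.IsRegular f ∧ ψ = f • dpow q π}
  add_mem' := by
    intro a b ha hb P π hπ
    obtain ⟨f, hf, rfl⟩ := ha P π hπ
    obtain ⟨g, hg, rfl⟩ := hb P π hπ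
    exact ⟨f + g, P.ring.add_mem _ _ hf hg, (add_smul f g _).symm⟩
  zero_mem' := by
    intro P π _
    exact ⟨0, P.ring.zero_mem, (zero_smul K _).symm⟩
  smul_mem' := by
    intro c a ha P π hπ
    obtain ⟨f, hf, rfl⟩ := ha P π hπ
    refine ⟨algebraMap ℂ K c * f, P.ring.mul_mem _ _ (P.algebraMap_mem c) hf, ?_⟩
    rw [mul_smul, algebraMap_smul]

variable (K) in
/-- The genus: the dimension of the space of holomorphic differentials. -/
def genus : ℕ := Module.finrank ℂ (holoDiff K 1)

variable (K) in
/-- `K` is the function field of a hyperelliptic curve of genus 3: it has genus 3 and is of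
degree 2 over a rational function field `ℂ(x)`. -/
def IsHyperellipticGenusThree : Prop :=
  (∃ x : K, Transcendental ℂ x ∧ Module.finrank (IntermediateField.adjoin ℂ ({x} : Set K)) K = 2) ∧
    genus K = 3

/-- `P` has `q`-weight `w`: for a basis `ψ₁, …, ψ_d` of the holomorphic `q`-differentials with
strictly increasing orders at `P` and `nᵢ = ord_P ψᵢ + 1`, one has `w = ∑ (nᵢ - i)`.
(Here `i : Fin d` counts from `0`, whence `i + 1`.) -/
def Place.HasWeight (P : Place K) (q : ℕ) (w : ℕ) : Prop :=
  ∃ (d : ℕ) (ψ : Module.Basis (Fin d) ℂ (holoDiff K q)) (o : Fin d → ℤ),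
    StrictMono o ∧ (∀ i, P.HasOrd (ψ i : QDiff K q) (o i)) ∧
      (w : ℤ) = ∑ i : Fin d, ((o i + 1) - ((i : ℕ) + 1 : ℤ))

variable (K) in
/-- `N_r`, the number of points of 2-weight `r`. -/
def numWeight (r : ℕ) : ℕ∞ := Set.encard {P : Place K | P.HasWeight 2 r}

end General

section Family

open Polynomial

/-- The admissible parameters. -/
abbrev Param : Type := {t : ℂ // t ≠ 0 ∧ t ≠ 4}

/-- `t x⁸ + t x⁴ + 1`. -/
def octic (t : ℂ) : ℂ[X] := C t * X ^ 8 + C t * X ^ 4 + 1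

/-- `Y² - (t x⁸ + t x⁴ + 1)` as a polynomial in `Y` over `ℂ(x)`. -/
def curvePoly (t : ℂ) : (RatFunc ℂ)[X] :=
  X ^ 2 - C (algebraMap ℂ[X] (RatFunc ℂ) (octic t))

theorem octic_squarefree (t : Param) : Squarefree (octic t.1) := by
  obtain ⟨t, h0, h4⟩ := t
  have h4' : (4 - t) ≠ 0 := sub_ne_zero.mpr (Ne.symm h4)
  apply Polynomial.Separable.squarefree
  refine ⟨1 - C (2 * t / (4 - t)) * X ^ 4,
    C (1 / 4) * X * (C ((t - 2) / (4 - t)) + C (t / (4 - t)) * X ^ 4), ?_⟩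
  have hd : derivative (octic t) = C (8 * t) * X ^ 7 + C (4 * t) * X ^ 3 := by
    simp [octic, derivative_pow]
    ring
  rw [hd]
  apply Polynomial.funext
  intro x
  simp only [octic, eval_add, eval_mul, eval_sub, eval_C, eval_pow, eval_X, eval_one]
  field_simp
  ring

theorem octic_natDegree (t : Param) : (octic t.1).natDegree = 8 := by
  have h := t.2.1
  unfold octic
  compute_degree!

instance curvePoly_irreducible (t : Param) : Fact (Irreducible (curvePoly t.1)) := by
  constructor
  refine X_pow_sub_C_irreducible_of_prime Nat.prime_two ?_
  intro b hb
  have hint : IsIntegral ℂ[X] b := by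
    refine IsIntegral.of_pow (n := 2) (by norm_num) ?_
    rw [hb]
    exact isIntegral_algebraMap
  obtain ⟨p, rfl⟩ := IsIntegrallyClosed.isIntegral_iff.mp hint
  have hp : p ^ 2 = octic t.1 := by
    apply IsFractionRing.injective ℂ[X] (RatFunc ℂ)
    rw [map_pow, hb]
  have hu : IsUnit p := octic_squarefree t p ⟨1, by rw [← hp]; ring⟩
  have h1 := natDegree_eq_zero_of_isUnit hu
  have h2 := octic_natDegree t
  rw [← hp, natDegree_pow, h1] at h2
  omega

/-- The function field `ℂ(x, y)`, `y² = t x⁸ + t x⁴ + 1`, of the curve `C_t`. -/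
abbrev CurveField (t : Param) : Type := AdjoinRoot (curvePoly t.1)

/-- The coordinate function `x` on `C_t`. -/
def xCoord (t : Param) : CurveField t := AdjoinRoot.of (curvePoly t.1) RatFunc.X

/-- The coordinate function `y` on `C_t`. -/
def yCoord (t : Param) : CurveField t := AdjoinRoot.root (curvePoly t.1)

theorem yCoord_sq (t : Param) :
    yCoord t ^ 2 = algebraMap ℂ (CurveField t) t.1 * xCoord t ^ 8
      + algebraMap ℂ (CurveField t) t.1 * xCoord t ^ 4 + 1 := by
  have h := AdjoinRoot.eval₂_root (curvePoly t.1)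
  rw [curvePoly, eval₂_sub, eval₂_pow, eval₂_X, eval₂_C, sub_eq_zero] at h
  have hc : algebraMap ℂ (CurveField t) t.1
      = AdjoinRoot.of (curvePoly t.1) (algebraMap ℂ[X] (RatFunc ℂ) (C t.1)) := by
    rw [IsScalarTower.algebraMap_apply ℂ (RatFunc ℂ) (CurveField t),
      IsScalarTower.algebraMap_apply ℂ ℂ[X] (RatFunc ℂ)]
    rfl
  rw [hc, xCoord, yCoord]
  refine h.trans ?_
  change AdjoinRoot.of (curvePoly t.1) (algebraMap ℂ[X] (RatFunc ℂ) (octic t.1)) = _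
  simp only [octic, map_add, map_mul, map_pow, map_one, RatFunc.algebraMap_X]

/-- The point `P` of `C_t` lies over the affine point `(a, b)`. -/
def IsAffinePoint (t : Param) (P : Place (CurveField t)) (a b : ℂ) : Prop :=
  P.IsZero (xCoord t - algebraMap ℂ _ a) ∧ P.IsZero (yCoord t - algebraMap ℂ _ b)

/-- The point `P` of `C_t` is a point at infinity, i.e. a pole of `x`. -/
def IsAtInfinity (t : Param) (P : Place (CurveField t)) : Prop := ¬ P.IsRegular (xCoord t)

end Family

end CurveFF

end

/-! Everything is read off from an equation y² = f(x) with f squarefree (`Model`). The differential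
dx/y has neither zeros nor poles in the affine part, and the chart (1/x, y/x^m) does the same
service at infinity. Hence (A(x) + B(x)y)(dx/y)^q is holomorphic exactly when A and B satisfy degree
bounds (`ev_mem_holoDiff_iff`). In genus 3 the quadratic differentials are spanned by 1, x, …, x⁴, y
times (dx/y)², so their dimension is 6.

At a branch point these functions have orders 0, 2, 4, 6, 8 and 1 (after a shift of x), so the
weight is 6. At any other affine point (a, b) the powers of x - a realize the orders 0, …, 4, and
the sixth order is that of y minus its Taylor polynomial of degree 4. The weight is therefore the
order of d⁵y/dx⁵ at the point (`hasWeight_of_ne`). Clearing denominators turns this derivative into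
a polynomial N₅(x), which for C_t is a nonzero constant times x³ G(x⁴) with G = (1 - tX²) · `quartic
t` (`derivNum_octic`). The factor x³ gives weight 3 over x = 0, and a symmetry x ↦ 1/(κx) with κ⁴ =
t carries this to infinity. The six roots of G are simple except for t = 196, where three of them
coincide, and t = -196/15, where two pairs coincide. A root of multiplicity r accounts for 4 · 2 = 8
points of weight r, which gives the table (`numWeight_eq`).

For the classification, automorphisms act on x by Möbius transformations (`exists_moebius`), and at
most one nontrivial automorphism fixes x. Let σ be a rotation of order 4 in the dihedral factor. If
σ² fixed x, then σx = -x in a suitable coordinate, and each of the involutions τ, α, τα (a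
reflection, the central factor, their product) would have the form x ↦ const/x; but the composite of
two such maps is x ↦ const·x. So σx = ζx with ζ² = -1, which forces f = ax⁸ + bx⁴ + c. Here b ≠ 0,
since otherwise some automorphism would have nontrivial fourth power, and rescaling leads to C_t
with t = b²/(ac). -/

open scoped TensorProduct KaehlerDifferential

noncomputable section

namespace CurveFF

universe u v

open Polynomial

/-! ### Places and valuations -/

section

variable {K : Type u} [Field K] [Algebra ℂ K]

namespace Place

variable (P : Place K)

theorem isRegular_iff {f : K} : P.IsRegular f ↔ P.ring.valuation f ≤ 1 :=
  (P.ring.valuation_le_one_iff f).symm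

theorem isRegular_const (c : ℂ) : P.IsRegular (algebraMap ℂ K c) := P.algebraMap_mem c

theorem isUnitAt_const {c : ℂ} (hc : c ≠ 0) : P.IsUnitAt (algebraMap ℂ K c) := by
  have h1 := P.isRegular_iff.1 (P.isRegular_const c)
  have h2 := P.isRegular_iff.1 (P.isRegular_const c⁻¹)
  refine le_antisymm h1 ?_
  rw [map_inv₀, map_inv₀] at h2
  have h3 : P.ring.valuation (algebraMap ℂ K c) ≠ 0 := by simpa using hc
  exact (inv_le_one₀ (zero_lt_iff.2 h3)).1 h2

theorem isZero_const_iff {c : ℂ} : P.IsZero (algebraMap ℂ K c) ↔ c = 0 := by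
  constructor
  · intro h
    by_contra hc
    exact absurd (P.isUnitAt_const hc) h.ne
  · rintro rfl
    simp [IsZero]

variable {P}

theorem IsZero.isRegular {f : K} (h : P.IsZero f) : P.IsRegular f := P.isRegular_iff.2 h.le

theorem IsUnitAt.isRegular {f : K} (h : P.IsUnitAt f) : P.IsRegular f := P.isRegular_iff.2 h.le

theorem IsUnitAt.val {f : K} (h : P.IsUnitAt f) : P.ring.valuation f = 1 := h

theorem IsUnitAt.ne_zero {f : K} (h : P.IsUnitAt f) : f ≠ 0 := by
  rintro rfl
  simp [IsUnitAt] at h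

theorem IsUnitAt.inv {f : K} (h : P.IsUnitAt f) : P.IsUnitAt f⁻¹ := by
  simp only [IsUnitAt, map_inv₀] at *
  simp [h]

theorem IsUnitAt.mul {f g : K} (hf : P.IsUnitAt f) (hg : P.IsUnitAt g) : P.IsUnitAt (f * g) := by
  simp only [IsUnitAt, map_mul] at *
  simp [hf, hg]

theorem IsUnitAt.div {f g : K} (hf : P.IsUnitAt f) (hg : P.IsUnitAt g) : P.IsUnitAt (f / g) := by
  rw [div_eq_mul_inv]
  exact hf.mul hg.inv

theorem IsUnitAt.pow {f : K} (hf : P.IsUnitAt f) (n : ℕ) : P.IsUnitAt (f ^ n) := by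
  simp only [IsUnitAt, map_pow] at *
  simp [hf]

theorem IsRegular.add {f g : K} (hf : P.IsRegular f) (hg : P.IsRegular g) : P.IsRegular (f + g) :=
  P.ring.add_mem _ _ hf hg

theorem IsRegular.neg {f : K} (hf : P.IsRegular f) : P.IsRegular (-f) :=
  P.ring.neg_mem _ hf

theorem IsRegular.sub {f g : K} (hf : P.IsRegular f) (hg : P.IsRegular g) : P.IsRegular (f - g) :=
  sub_eq_add_neg f g ▸ hf.add hg.neg

theorem IsRegular.mul {f g : K} (hf : P.IsRegular f) (hg : P.IsRegular g) : P.IsRegular (f * g) :=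
  P.ring.mul_mem _ _ hf hg

theorem IsRegular.pow {f : K} (hf : P.IsRegular f) (n : ℕ) : P.IsRegular (f ^ n) :=
  pow_mem (S := P.ring) hf n

theorem IsRegular.aeval {f : K} (hf : P.IsRegular f) (A : ℂ[X]) : P.IsRegular (aeval f A) := by
  rw [aeval_eq_sum_range]
  refine sum_mem (S := P.ring) fun i _ => ?_
  rw [Algebra.smul_def]
  exact (P.isRegular_const _).mul (hf.pow i)

theorem IsRegular.isUnitAt_or {f : K} (hf : P.IsRegular f) : P.IsUnitAt f ∨ P.IsZero f := by
  rcases (P.isRegular_iff.1 hf).eq_or_lt with h | h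
  · exact Or.inl h
  · exact Or.inr h

theorem IsZero.mul_regular {f g : K} (hf : P.IsZero f) (hg : P.IsRegular g) :
    P.IsZero (g * f) := by
  have h1 := P.isRegular_iff.1 hg
  simp only [IsZero, map_mul] at *
  exact (mul_le_of_le_one_left' h1).trans_lt hf

theorem IsZero.add {f g : K} (hf : P.IsZero f) (hg : P.IsZero g) : P.IsZero (f + g) :=
  P.ring.valuation.map_add_lt hf hg

theorem IsZero.neg {f : K} (hf : P.IsZero f) : P.IsZero (-f) := by
  simpa [IsZero] using hf

theorem IsZero.sub {f g : K} (hf : P.IsZero f) (hg : P.IsZero g) : P.IsZero (f - g) :=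
  sub_eq_add_neg f g ▸ hf.add hg.neg

theorem IsUnitAt.add_isZero {f g : K} (hf : P.IsUnitAt f) (hg : P.IsZero g) :
    P.IsUnitAt (f + g) := by
  have := P.ring.valuation.map_add_eq_of_lt_right (x := g) (y := f)
    (lt_of_lt_of_eq hg (Eq.symm hf))
  rw [add_comm]
  exact this.trans hf

theorem isZero_aeval_sub {f : K} {a : ℂ} (hf : P.IsZero (f - algebraMap ℂ K a)) (A : ℂ[X]) :
    P.IsZero (aeval f A - algebraMap ℂ K (A.eval a)) := by
  obtain ⟨B, hB⟩ := X_sub_C_dvd_sub_C_eval (a := a) (p := A)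
  have hf' : P.IsRegular f := by
    have := hf.isRegular.add (P.isRegular_const a)
    rwa [sub_add_cancel] at this
  have h := congrArg (Polynomial.aeval f) hB
  simp only [map_sub, map_mul, aeval_X, aeval_C] at h
  rw [h, mul_comm]
  exact hf.mul_regular (hf'.aeval B)

theorem isRegular_inv_of_not {f : K} (h : ¬ P.IsRegular f) : P.IsRegular f⁻¹ :=
  (P.ring.mem_or_inv_mem f).resolve_left h

theorem isZero_inv_of_not {f : K} (h : ¬ P.IsRegular f) : P.IsZero f⁻¹ := by
  rcases (isRegular_inv_of_not h).isUnitAt_or with h1 | h1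
  · exact absurd (by simpa using h1.inv.isRegular) h
  · exact h1

end Place

/-- The function `A(x) + B(x) y`. -/
def ev (x y : K) (A B : ℂ[X]) : K := aeval x A + aeval x B * y

/-- `K = ℂ(x, y)` with `y² = f(x)` for a squarefree nonconstant polynomial `f`. -/
structure Model (f : ℂ[X]) (x y : K) : Prop where
  sqf : Squarefree f
  deg : f.natDegree ≠ 0
  trans : Transcendental ℂ x
  eq : y ^ 2 = aeval x f
  gen : ∀ h : K, ∃ A B D : ℂ[X], D ≠ 0 ∧ h * aeval x D = ev x y A B

/-- `P` lies over the affine point `(a, b)` with respect to the functions `x`, `y`. -/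
def Place.LiesOver (P : Place K) (x y : K) (a b : ℂ) : Prop :=
  P.IsZero (x - algebraMap ℂ K a) ∧ P.IsZero (y - algebraMap ℂ K b)

/-- The uniformizer at the affine point `(a, b)`. -/
def unif (x y : K) (a b : ℂ) : K := if b = 0 then y else x - algebraMap ℂ K a

/-- `h` is a polynomial in `x`, `y` which does not vanish at the affine point `(a, b)`. -/
def NonVan (x y : K) (a b : ℂ) (h : K) : Prop :=
  ∃ A B : ℂ[X], h = ev x y A B ∧ A.eval a + B.eval a * b ≠ 0

/-! ### Local structure of y² = f(x) at affine points -/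

namespace Model

variable {f : ℂ[X]} {x y : K} (M : Model f x y)

theorem aeval_ne_zero {x : K} (hx : Transcendental ℂ x) {A : ℂ[X]} (hA : A ≠ 0) : aeval x A ≠ 0 :=
  fun h => hA ((transcendental_iff.1 hx) A h)

theorem aeval_inj {x : K} (hx : Transcendental ℂ x) {A B : ℂ[X]} (h : aeval x A = aeval x B) :
    A = B :=
  (transcendental_iff_injective.1 hx) h

theorem f_ne_zero (M : Model f x y) : f ≠ 0 := M.sqf.ne_zero

theorem y_ne_zero (M : Model f x y) : y ≠ 0 := by
  rintro rfl
  exact aeval_ne_zero M.trans M.f_ne_zero (by rw [← M.eq]; simp)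

theorem derivative_eval_ne (M : Model f x y) {a : ℂ} (h : f.eval a = 0) :
    f.derivative.eval a ≠ 0 := by
  intro h'
  have hsep : f.Separable := PerfectField.separable_iff_squarefree.2 M.sqf
  obtain ⟨p, q, hpq⟩ := hsep
  have := congrArg (eval a) hpq
  simp [h, h'] at this

/-- If B ≠ 0, then A² = B² f makes f the square of A/B, which contradicts that f is squarefree and
nonconstant. -/
theorem indep (M : Model f x y) {A B : ℂ[X]} (h : ev x y A B = 0) : A = 0 ∧ B = 0 := by
  have h2 : A ^ 2 = B ^ 2 * f := by
    apply aeval_inj M.trans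
    rw [map_mul, map_pow, map_pow, ← M.eq]
    have : aeval x A = - (aeval x B * y) := eq_neg_of_add_eq_zero_left h
    rw [this]; ring
  by_cases hB : B = 0
  · subst hB
    simpa using h2
  · exfalso
    have hdvd : B ∣ A := (IsIntegrallyClosed.pow_dvd_pow_iff two_ne_zero).1 ⟨f, h2⟩
    obtain ⟨C, rfl⟩ := hdvd
    have h3 : C * C = f := by
      have hB2 : B ^ 2 ≠ 0 := pow_ne_zero _ hB
      apply mul_left_cancel₀ hB2
      rw [← h2]; ring
    have hu := M.sqf C ⟨1, by rw [mul_one]; exact h3.symm⟩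
    have := natDegree_eq_zero_of_isUnit hu
    apply M.deg
    rw [← h3, natDegree_mul', this]
    · have := M.f_ne_zero
      rw [← h3] at this
      simpa using this

theorem ev_inj (M : Model f x y) {A B A' B' : ℂ[X]} (h : ev x y A B = ev x y A' B') :
    A = A' ∧ B = B' := by
  have : ev x y (A - A') (B - B') = 0 := by
    simp only [ev, map_sub] at *
    linear_combination h
  have h2 := M.indep this
  exact ⟨sub_eq_zero.1 h2.1, sub_eq_zero.1 h2.2⟩

theorem ev_mul (M : Model f x y) (A B A' B' : ℂ[X]) :
    ev x y A B * ev x y A' B' = ev x y (A * A' + B * B' * f) (A * B' + A' * B) := by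
  simp only [ev, map_add, map_mul, ← M.eq]
  ring

theorem nonVan_mul (M : Model f x y) {a b : ℂ} (hb : b ^ 2 = f.eval a) {g h : K}
    (hg : NonVan x y a b g) (hh : NonVan x y a b h) : NonVan x y a b (g * h) := by
  obtain ⟨A, B, rfl, h1⟩ := hg
  obtain ⟨A', B', rfl, h2⟩ := hh
  refine ⟨_, _, M.ev_mul A B A' B', ?_⟩
  convert! mul_ne_zero h1 h2 using 1
  simp only [eval_add, eval_mul, ← hb]
  ring

theorem nonVan_aeval {a : ℂ} (b : ℂ) {A : ℂ[X]} (hA : A.eval a ≠ 0) :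
    NonVan x y a b (aeval x A) := ⟨A, 0, by simp [ev], by simpa using hA⟩

theorem exists_factor {A : ℂ[X]} (hA : A ≠ 0) (a : ℂ) :
    ∃ (i : ℕ) (A' : ℂ[X]), A = (X - C a) ^ i * A' ∧ A'.eval a ≠ 0 := by
  obtain ⟨q, h1, h2⟩ := exists_eq_pow_rootMultiplicity_mul_and_not_dvd A hA a
  exact ⟨_, q, h1, fun h => h2 (dvd_iff_isRoot.2 h)⟩

/-- When A + By vanishes at (a, b) but its conjugate A - By does not, the conjugate serves as s: the
product is the norm A² - B² f, a polynomial in x from which a power of x - a splits off. When both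
vanish, b ≠ 0 forces A(a) = B(a) = 0, and a factor x - a is removed; hence the induction on degrees.
-/
theorem exists_decomp_ev_ne (M : Model f x y) {a b : ℂ} (hb0 : b ≠ 0) :
    ∀ (N : ℕ) (A B : ℂ[X]), A.natDegree + B.natDegree < N → (A ≠ 0 ∨ B ≠ 0) →
    ∃ (k : ℕ) (n s : K), NonVan x y a b n ∧ NonVan x y a b s ∧
      ev x y A B * s = (x - algebraMap ℂ K a) ^ k * n := by
  intro N
  induction N with
  | zero => exact fun A B h => absurd h (Nat.not_lt_zero _)
  | succ N ih =>
    intro A B hN hAB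
    by_cases h1 : A.eval a + B.eval a * b = 0
    · by_cases h2 : A.eval a - B.eval a * b = 0
      · have hA : A.eval a = 0 := by linear_combination (h1 + h2) / 2
        have hB : B.eval a = 0 := by
          apply mul_right_cancel₀ hb0
          linear_combination (h1 - h2) / 2
        obtain ⟨A', rfl⟩ := dvd_iff_isRoot.2 hA
        obtain ⟨B', rfl⟩ := dvd_iff_isRoot.2 hB
        have hdeg : ∀ D : ℂ[X], D ≠ 0 → ((X - C a) * D).natDegree = D.natDegree + 1 := by
          intro D hD
          rw [natDegree_mul (X_sub_C_ne_zero a) hD, natDegree_X_sub_C, add_comm]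
        have hle : ∀ D : ℂ[X], D.natDegree ≤ ((X - C a) * D).natDegree := by
          intro D
          by_cases hD : D = 0
          · simp [hD]
          · rw [hdeg D hD]; omega
        have hAB' : A' ≠ 0 ∨ B' ≠ 0 := hAB.imp right_ne_zero_of_mul right_ne_zero_of_mul
        have hlt : A'.natDegree + B'.natDegree < N := by
          have h3 := hle A'
          have h4 := hle B'
          rcases hAB' with h | h
          · have := hdeg A' h
            omega
          · have := hdeg B' h
            omega
        obtain ⟨k, n, s, hn, hs, h⟩ := ih A' B' hlt hAB'
        refine ⟨k + 1, n, s, hn, hs, ?_⟩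
        rw [pow_succ', mul_assoc, ← h]
        simp only [ev, map_mul, map_sub, aeval_X, aeval_C]
        ring
      · have hne : A ^ 2 - B ^ 2 * f ≠ 0 := by
          intro h0
          have h3 : ev x y A B * ev x y A (-B) = aeval x (A ^ 2 - B ^ 2 * f) := by
            simp only [ev, map_sub, map_mul, map_pow, map_neg, ← M.eq]
            ring
          rw [h0, map_zero, mul_eq_zero] at h3
          rcases h3 with h3 | h3
          · have := M.indep h3
            tauto
          · have := M.indep h3
            rw [neg_eq_zero] at this
            tauto
        obtain ⟨k, D, hD, hDa⟩ := exists_factor hne a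
        refine ⟨k, _, _, nonVan_aeval b hDa, ⟨A, -B, rfl, ?_⟩, ?_⟩
        · rw [eval_neg]
          intro h
          exact h2 (by linear_combination h)
        · have h4 := congrArg (Polynomial.aeval x) hD
          simp only [map_sub, map_mul, map_pow, aeval_X, aeval_C, ← M.eq] at h4
          rw [← h4]
          simp only [ev, map_neg]
          ring
    · exact ⟨0, _, aeval x 1, ⟨A, B, rfl, h1⟩, nonVan_aeval b (by simp), by simp⟩

/-- At a branch point x - a = y²/f₁(x) with f₁(a) ≠ 0. So A has even order 2i and By has odd order
2j + 1; they cannot cancel, and the smaller one decides. -/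
theorem exists_decomp_ev_eq (M : Model f x y) {a : ℂ} (ha : f.eval a = 0) (A B : ℂ[X])
    (hAB : A ≠ 0 ∨ B ≠ 0) :
    ∃ (k : ℕ) (n s : K), NonVan x y a 0 n ∧ NonVan x y a 0 s ∧ ev x y A B * s = y ^ k * n := by
  obtain ⟨f₁, hf⟩ := dvd_iff_isRoot.2 ha
  have hf₁ : f₁.eval a ≠ 0 := by
    have := M.derivative_eval_ne ha
    rw [hf] at this
    simpa using this
  have hy : y ^ 2 = (x - algebraMap ℂ K a) * aeval x f₁ := by
    rw [M.eq, hf]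
    simp
  have key : ∀ (i : ℕ) (D : ℂ[X]),
      aeval x ((X - C a) ^ i * D) * aeval x f₁ ^ i = y ^ (2 * i) * aeval x D := by
    intro i D
    rw [pow_mul, hy, mul_pow]
    simp only [map_mul, map_pow, map_sub, aeval_X, aeval_C]
    ring
  have hs : ∀ i, NonVan x y a 0 (aeval x f₁ ^ i) := by
    intro i
    rw [← map_pow]
    exact nonVan_aeval 0 (by simpa using fun h => absurd h hf₁)
  by_cases hA : A = 0
  · obtain ⟨j, B', hB, hB'⟩ := exists_factor (hAB.resolve_left (not_not.2 hA)) a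
    refine ⟨2 * j + 1, aeval x B', _, nonVan_aeval 0 hB', hs j, ?_⟩
    have := key j B'
    rw [← hB] at this
    rw [hA, ev, map_zero, pow_succ]
    linear_combination y * this
  obtain ⟨i, A', hA1, hA'⟩ := exists_factor hA a
  by_cases hB : B = 0
  · refine ⟨2 * i, aeval x A', _, nonVan_aeval 0 hA', hs i, ?_⟩
    have := key i A'
    rw [← hA1] at this
    rw [hB, ev, map_zero]
    linear_combination this
  obtain ⟨j, B', hB1, hB'⟩ := exists_factor hB a
  have h1 := key i A'
  have h2 := key j B'
  rw [← hA1] at h1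
  rw [← hB1] at h2
  rcases le_or_gt i j with hij | hij
  · obtain ⟨d, rfl⟩ := Nat.exists_eq_add_of_le hij
    refine ⟨2 * i, ev x y (A' * f₁ ^ d) (B' * f ^ d), _, ⟨_, _, rfl, ?_⟩, hs (i + d), ?_⟩
    · simp [hA', hf₁]
    · simp only [ev, map_mul, map_pow, ← M.eq]
      linear_combination aeval x f₁ ^ d * h1 + y * h2
  · obtain ⟨d, rfl⟩ := Nat.exists_eq_add_of_lt hij
    refine ⟨2 * j + 1, ev x y (B' * f₁ ^ (d + 1)) (A' * f ^ d), _, ⟨_, _, rfl, ?_⟩,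
      hs (j + d + 1), ?_⟩
    · simp [hB', hf₁]
    · simp only [ev, map_mul, map_pow, ← M.eq]
      linear_combination h1 + y * aeval x f₁ ^ (d + 1) * h2

/-- Every nonzero function is a power of the uniformizer times a quotient of polynomials in `x`
and `y` which do not vanish at the affine point. -/
theorem exists_decomp (M : Model f x y) {a b : ℂ} (hb : b ^ 2 = f.eval a) {h : K} (hh : h ≠ 0) :
    ∃ (k : ℤ) (n s : K), NonVan x y a b n ∧ NonVan x y a b s ∧ h * s = unif x y a b ^ k * n := by
  have key : ∀ A B : ℂ[X], (A ≠ 0 ∨ B ≠ 0) → ∃ (k : ℕ) (n s : K), NonVan x y a b n ∧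
      NonVan x y a b s ∧ ev x y A B * s = unif x y a b ^ k * n := by
    intro A B hAB
    by_cases hb0 : b = 0
    · subst hb0
      simpa [unif] using M.exists_decomp_ev_eq (a := a) (by rw [← hb]; simp) A B hAB
    · simpa [unif, hb0] using M.exists_decomp_ev_ne hb0 _ A B (Nat.lt_succ_self _) hAB
  have hπ : unif x y a b ≠ 0 := by
    unfold unif
    split_ifs
    · exact M.y_ne_zero
    · have := aeval_ne_zero M.trans (X_sub_C_ne_zero a)
      simpa using this
  obtain ⟨A, B, D, hD, hAB⟩ := M.gen h
  have hDx := aeval_ne_zero M.trans hD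
  have hAB0 : A ≠ 0 ∨ B ≠ 0 := by
    by_contra! h0
    rw [h0.1, h0.2] at hAB
    simp [ev, hh, hDx] at hAB
  obtain ⟨k, n, s, hn, hs, h1⟩ := key A B hAB0
  obtain ⟨l, n', s', hn', hs', h2⟩ := key D 0 (Or.inl hD)
  have hne : ∀ g, NonVan x y a b g → g ≠ 0 := by
    rintro g ⟨A, B, rfl, h⟩ h0
    obtain ⟨rfl, rfl⟩ := M.indep h0
    simp at h
  refine ⟨k - l, n * s', s * n', M.nonVan_mul hb hn hs', M.nonVan_mul hb hs hn', ?_⟩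
  rw [zpow_sub₀ hπ, zpow_natCast, zpow_natCast]
  have h3 : ev x y D 0 = aeval x D := by simp [ev]
  rw [h3] at h2
  have hl := pow_ne_zero l hπ
  have hs'0 := hne _ hs'
  rw [div_mul_eq_mul_div, eq_div_iff hl]
  apply mul_right_cancel₀ hDx
  calc h * (s * n') * unif x y a b ^ l * aeval x D
      = (h * aeval x D) * s * (unif x y a b ^ l * n') := by ring
    _ = unif x y a b ^ k * n * (aeval x D * s') := by rw [hAB, h1, h2]
    _ = _ := by ring

theorem isRegular_y (M : Model f x y) {P : Place K} (h : P.IsRegular x) : P.IsRegular y := by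
  have h1 := P.isRegular_iff.1 (h.aeval f)
  rw [← M.eq, map_pow] at h1
  exact P.isRegular_iff.2 ((pow_le_one_iff two_ne_zero).1 h1)

theorem isRegular_ev (M : Model f x y) {P : Place K} (h : P.IsRegular x) (A B : ℂ[X]) :
    P.IsRegular (ev x y A B) :=
  (h.aeval A).add ((h.aeval B).mul (M.isRegular_y h))

/-- If no x - a vanished at P, every nonzero polynomial in x, being a product of linear factors,
would be a unit there. All quotients (A + By)/D would then be regular, and P would be the trivial
valuation ring. -/
theorem exists_isZero_sub (M : Model f x y) {P : Place K} (h : P.IsRegular x) :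
    ∃ a : ℂ, P.IsZero (x - algebraMap ℂ K a) := by
  by_contra! hne
  have hu : ∀ a : ℂ, P.IsUnitAt (x - algebraMap ℂ K a) := fun a =>
    ((h.sub (P.isRegular_const a)).isUnitAt_or).resolve_right (hne a)
  have hpoly : ∀ D : ℂ[X], D ≠ 0 → P.IsUnitAt (aeval x D) := by
    intro D hD
    have h1 := (IsAlgClosed.splits D).eq_prod_roots
    rw [h1, map_mul, aeval_C]
    refine (P.isUnitAt_const (leadingCoeff_ne_zero.2 hD)).mul ?_
    generalize D.roots = s
    induction s using Multiset.induction with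
    | empty => simp [Place.IsUnitAt]
    | cons a s ih =>
      rw [Multiset.map_cons, Multiset.prod_cons, map_mul]
      refine Place.IsUnitAt.mul ?_ ih
      simpa using hu a
  apply P.ne_top
  ext g
  simp only [ValuationSubring.mem_top, iff_true]
  obtain ⟨A, B, D, hD, hg⟩ := M.gen g
  have h2 : g = ev x y A B / aeval x D := by
    rw [← hg, mul_div_cancel_right₀ _ (aeval_ne_zero M.trans hD)]
  rw [h2, div_eq_mul_inv]
  exact (M.isRegular_ev h A B).mul (hpoly D hD).inv.isRegular

theorem liesOver_isRegular {P : Place K} {a b : ℂ} (h : P.LiesOver x y a b) : P.IsRegular x := by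
  have := h.1.isRegular.add (P.isRegular_const a)
  rwa [sub_add_cancel] at this

theorem isZero_ev_sub {P : Place K} {a b : ℂ} (h : P.LiesOver x y a b) (A B : ℂ[X]) :
    P.IsZero (ev x y A B - algebraMap ℂ K (A.eval a + B.eval a * b)) := by
  have h1 := Place.isZero_aeval_sub h.1 A
  have h2 := Place.isZero_aeval_sub h.1 B
  have hy : P.IsRegular y := by
    have := h.2.isRegular.add (P.isRegular_const b)
    rwa [sub_add_cancel] at this
  have h3 := (h1.add (h2.mul_regular hy)).add (h.2.mul_regular (P.isRegular_const (B.eval a)))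
  convert! h3 using 1
  simp only [ev, map_add, map_mul]
  ring

theorem isUnitAt_of_nonVan {P : Place K} {a b : ℂ} (h : P.LiesOver x y a b) {g : K}
    (hg : NonVan x y a b g) : P.IsUnitAt g := by
  obtain ⟨A, B, rfl, hAB⟩ := hg
  have := (P.isUnitAt_const hAB).add_isZero (isZero_ev_sub h A B)
  rwa [add_sub_cancel] at this

theorem isZero_ev_iff {P : Place K} {a b : ℂ} (h : P.LiesOver x y a b) (A B : ℂ[X]) :
    P.IsZero (ev x y A B) ↔ A.eval a + B.eval a * b = 0 := by
  constructor
  · intro h0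
    by_contra hne
    exact h0.ne (isUnitAt_of_nonVan h ⟨A, B, rfl, hne⟩)
  · intro h0
    have := isZero_ev_sub h A B
    rwa [h0, map_zero, sub_zero] at this

theorem liesOver_sq (M : Model f x y) {P : Place K} {a b : ℂ} (h : P.LiesOver x y a b) :
    b ^ 2 = f.eval a := by
  have h1 := (isZero_ev_iff h (C (b ^ 2) - f) 0).1 ?_
  · simp at h1
    linear_combination h1
  · have h2 : ev x y (C (b ^ 2) - f) 0
        = (-(y + algebraMap ℂ K b)) * (y - algebraMap ℂ K b) := by
      simp only [ev, map_sub, ← M.eq, aeval_C, map_pow, map_zero]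
      ring
    rw [h2]
    refine h.2.mul_regular (Place.IsRegular.neg ((M.isRegular_y (liesOver_isRegular h)).add ?_))
    exact P.isRegular_const b

theorem exists_liesOver (M : Model f x y) {P : Place K} (h : P.IsRegular x) :
    ∃ a b : ℂ, P.LiesOver x y a b := by
  obtain ⟨a, ha⟩ := M.exists_isZero_sub h
  obtain ⟨b, hb⟩ := IsAlgClosed.exists_pow_nat_eq (f.eval a) (n := 2) (by norm_num)
  have h1 := Place.isZero_aeval_sub ha f
  have h2 : P.IsZero ((y - algebraMap ℂ K b) * (y - algebraMap ℂ K (-b))) := by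
    convert! h1 using 1
    rw [← M.eq, ← hb, map_pow, map_neg]
    ring
  have hy := M.isRegular_y h
  rcases (hy.sub (P.isRegular_const b)).isUnitAt_or with h3 | h3
  · refine ⟨a, -b, ha, ?_⟩
    simp only [Place.IsZero, map_mul] at h2 ⊢
    rw [h3.val, one_mul] at h2
    exact h2
  · exact ⟨a, b, ha, h3⟩

/-- There is a place over every affine point. -/
theorem exists_place (M : Model f x y) {a b : ℂ} (hb : b ^ 2 = f.eval a) :
    ∃ P : Place K, P.LiesOver x y a b := by
  let R : Subring K :=
    { carrier := {g | ∃ A B, g = ev x y A B}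
      mul_mem' := by
        rintro _ _ ⟨A, B, rfl⟩ ⟨A', B', rfl⟩
        exact ⟨_, _, M.ev_mul A B A' B'⟩
      one_mem' := ⟨1, 0, by simp [ev]⟩
      add_mem' := by
        rintro _ _ ⟨A, B, rfl⟩ ⟨A', B', rfl⟩
        exact ⟨A + A', B + B', by simp only [ev, map_add]; ring⟩
      zero_mem' := ⟨0, 0, by simp [ev]⟩
      neg_mem' := by
        rintro _ ⟨A, B, rfl⟩
        exact ⟨-A, -B, by simp only [ev, map_neg]; ring⟩ }
  let I : Ideal R :=
    { carrier := {g | ∃ A B, (g : K) = ev x y A B ∧ A.eval a + B.eval a * b = 0}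
      add_mem' := by
        rintro g h ⟨A, B, hg, h1⟩ ⟨A', B', hh, h2⟩
        refine ⟨A + A', B + B', ?_, ?_⟩
        · rw [Subring.coe_add, hg, hh]
          simp only [ev, map_add]
          ring
        · simp only [eval_add]
          linear_combination h1 + h2
      zero_mem' := ⟨0, 0, by simp [ev], by simp⟩
      smul_mem' := by
        rintro ⟨_, A, B, rfl⟩ g ⟨A', B', hg, h1⟩
        refine ⟨A * A' + B * B' * f, A * B' + A' * B, ?_, ?_⟩
        · rw [smul_eq_mul, Subring.coe_mul, hg]
          exact M.ev_mul A B A' B'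
        · simp only [eval_add, eval_mul, ← hb]
          linear_combination (A.eval a + B.eval a * b) * h1 }
  have hI : I ≠ ⊤ := by
    rw [Ideal.ne_top_iff_one]
    rintro ⟨A, B, h1, h2⟩
    have h3 : ev x y 1 0 = ev x y A B := by rw [← h1]; simp [ev]
    obtain ⟨rfl, rfl⟩ := M.ev_inj h3
    simp at h2
  -- The coordinate ring ℂ[x, y] with the ideal of the point (a, b) is dominated by some valuation
  -- ring of K.
  obtain ⟨V, hV, hIV⟩ := Ideal.image_subset_nonunits_valuationSubring I hI
  have hz : ∀ A B, A.eval a + B.eval a * b = 0 → V.valuation (ev x y A B) < 1 := by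
    intro A B h
    have h1 := hIV ⟨⟨ev x y A B, A, B, rfl⟩, ⟨A, B, rfl, h⟩, rfl⟩
    exact (ValuationSubring.mem_nonunits_iff _).1 h1
  have hx : V.valuation (x - algebraMap ℂ K a) < 1 := by
    have := hz (X - C a) 0 (by simp)
    simpa [ev] using this
  have hy : V.valuation (y - algebraMap ℂ K b) < 1 := by
    have := hz (-C b) 1 (by simp)
    simpa [ev, neg_add_eq_sub] using this
  refine ⟨⟨V, fun c => hV ⟨C c, 0, by simp [ev]⟩, ?_⟩, hx, hy⟩
  -- The valuation ring is not all of K, because the nonzero function x - a is a nonunit in it.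
  rintro rfl
  have h1 : (x - algebraMap ℂ K a)⁻¹ ∈ (⊤ : ValuationSubring K) := ValuationSubring.mem_top _
  rw [← ValuationSubring.valuation_le_one_iff, map_inv₀] at h1
  have h2 : x - algebraMap ℂ K a ≠ 0 := by
    have := aeval_ne_zero M.trans (X_sub_C_ne_zero a)
    simpa using this
  have h3 := zero_lt_iff.2 ((Valuation.ne_zero_iff (ValuationSubring.valuation ⊤)).2 h2)
  exact absurd hx (not_lt.2 ((inv_le_one₀ h3).1 h1))

theorem unif_ne_zero (M : Model f x y) (a b : ℂ) : unif x y a b ≠ 0 := by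
  unfold unif
  split_ifs
  · exact M.y_ne_zero
  · have := aeval_ne_zero M.trans (X_sub_C_ne_zero a)
    simpa using this

theorem isZero_unif {P : Place K} {a b : ℂ} (h : P.LiesOver x y a b) :
    P.IsZero (unif x y a b) := by
  unfold unif
  split_ifs with hb
  · have := h.2
    rwa [hb, map_zero, sub_zero] at this
  · exact h.1

theorem isRegular_zpow_mul_iff {P : Place K} {π u : K} (hπ : P.IsZero π) (hπ0 : π ≠ 0)
    (hu : P.IsUnitAt u) (k : ℤ) : P.IsRegular (π ^ k * u) ↔ 0 ≤ k := by
  have h0 : 0 < P.ring.valuation π := zero_lt_iff.2 ((Valuation.ne_zero_iff _).2 hπ0)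
  rw [Place.isRegular_iff, map_mul, hu.val, mul_one, map_zpow₀]
  exact zpow_le_one_iff_right_of_lt_one₀ h0 hπ

theorem isZero_zpow_mul_iff {P : Place K} {π u : K} (hπ : P.IsZero π) (hπ0 : π ≠ 0)
    (hu : P.IsUnitAt u) (k : ℤ) : P.IsZero (π ^ k * u) ↔ 0 < k := by
  have h0 : 0 < P.ring.valuation π := zero_lt_iff.2 ((Valuation.ne_zero_iff _).2 hπ0)
  rw [Place.IsZero, map_mul, hu.val, mul_one, map_zpow₀]
  exact zpow_lt_one_iff_right_of_lt_one₀ h0 hπ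

theorem exists_zpow (M : Model f x y) {a b : ℂ} (hb : b ^ 2 = f.eval a) {h : K} (hh : h ≠ 0) :
    ∃ (k : ℤ) (n s : K), NonVan x y a b n ∧ NonVan x y a b s ∧
      h = unif x y a b ^ k * (n / s) := by
  obtain ⟨k, n, s, hn, hs, h1⟩ := M.exists_decomp hb hh
  obtain ⟨P, hP⟩ := M.exists_place hb
  refine ⟨k, n, s, hn, hs, ?_⟩
  rw [← mul_div_assoc, ← h1, mul_div_cancel_right₀ _ (isUnitAt_of_nonVan hP hs).ne_zero]

/-- Write a function as a power of `unif x y a b` times a unit. The exponent comes from polynomial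
identities that do not mention the place, and its sign decides regularity at every place over (a,
b). -/
theorem liesOver_unique (M : Model f x y) {P Q : Place K} {a b : ℂ} (hP : P.LiesOver x y a b)
    (hQ : Q.LiesOver x y a b) : P = Q := by
  ext h
  by_cases hh : h = 0
  · subst hh
    simp
  · obtain ⟨k, n, s, hn, hs, rfl⟩ := M.exists_zpow (M.liesOver_sq hP) hh
    have key : ∀ R : Place K, R.LiesOver x y a b →
        (unif x y a b ^ k * (n / s) ∈ R.ring ↔ 0 ≤ k) := fun R hR =>
      isRegular_zpow_mul_iff (isZero_unif hR) (M.unif_ne_zero a b)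
        ((isUnitAt_of_nonVan hR hn).div (isUnitAt_of_nonVan hR hs)) k
    rw [key P hP, key Q hQ]

theorem exists_zpow_unit (M : Model f x y) {P : Place K} {a b : ℂ} (hP : P.LiesOver x y a b)
    {h : K} (hh : h ≠ 0) : ∃ (k : ℤ) (u : K), P.IsUnitAt u ∧ h = unif x y a b ^ k * u := by
  obtain ⟨k, n, s, hn, hs, rfl⟩ := M.exists_zpow (M.liesOver_sq hP) hh
  exact ⟨k, _, (isUnitAt_of_nonVan hP hn).div (isUnitAt_of_nonVan hP hs), rfl⟩

theorem isUniformizer_unif (M : Model f x y) {P : Place K} {a b : ℂ} (hP : P.LiesOver x y a b) :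
    P.IsUniformizer (unif x y a b) := by
  refine ⟨isZero_unif hP, fun h hz => ?_⟩
  by_cases hh : h = 0
  · exact ⟨0, P.ring.zero_mem, by simp [hh]⟩
  · obtain ⟨k, u, hu, rfl⟩ := M.exists_zpow_unit hP hh
    have h0 := M.unif_ne_zero a b
    rw [isZero_zpow_mul_iff (isZero_unif hP) h0 hu] at hz
    refine ⟨unif x y a b ^ (k - 1) * u, ?_, ?_⟩
    · rw [isRegular_zpow_mul_iff (isZero_unif hP) h0 hu]
      omega
    · rw [zpow_sub_one₀ h0]
      field_simp

/-- A regular function is a quotient of polynomials in `x` and `y` whose denominator does not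
vanish at the point. -/
theorem exists_quotient (M : Model f x y) {P : Place K} {a b : ℂ} (hP : P.LiesOver x y a b)
    {h : K} (hreg : P.IsRegular h) : ∃ A B s, NonVan x y a b s ∧ h * s = ev x y A B := by
  by_cases hh : h = 0
  · exact ⟨0, 0, 1, ⟨1, 0, by simp [ev], by simp⟩, by simp [hh, ev]⟩
  · obtain ⟨k, n, s, hn, hs, rfl⟩ := M.exists_zpow (M.liesOver_sq hP) hh
    rw [isRegular_zpow_mul_iff (isZero_unif hP) (M.unif_ne_zero a b)
      ((isUnitAt_of_nonVan hP hn).div (isUnitAt_of_nonVan hP hs))] at hreg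
    lift k to ℕ using hreg
    have hs0 := (isUnitAt_of_nonVan hP hs).ne_zero
    have hpoly : ∃ A B, unif x y a b ^ k = ev x y A B := by
      have h1 : ∃ A B, unif x y a b = ev x y A B := by
        unfold unif
        split_ifs
        · exact ⟨0, 1, by simp [ev]⟩
        · exact ⟨X - C a, 0, by simp [ev]⟩
      obtain ⟨A, B, h1⟩ := h1
      rw [h1]
      clear hh
      induction k with
      | zero => exact ⟨1, 0, by simp [ev]⟩
      | succ k ih =>
        obtain ⟨A', B', ih⟩ := ih
        exact ⟨_, _, by rw [pow_succ, ih]; exact M.ev_mul _ _ _ _⟩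
    obtain ⟨A, B, h1⟩ := hpoly
    obtain ⟨A', B', rfl, -⟩ := hn
    refine ⟨A * A' + B * B' * f, A * B' + A' * B, s, hs, ?_⟩
    rw [zpow_natCast, h1, mul_assoc, div_mul_cancel₀ _ hs0]
    exact M.ev_mul _ _ _ _

end Model

end

/-! ### Differentials and the local generator dx/y -/

section

variable {K : Type u} [Field K] [Algebra ℂ K]

/-- K is finite over ℂ(x), and separable in characteristic 0, so it is formally étale over ℂ[X].
Thus Ω of K is the base change of Ω of ℂ[X], which is free on dX. -/
theorem exists_kaehler_equiv {x y : K} (hx : Transcendental ℂ x)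
    (gen : ∀ h : K, ∃ A B D : ℂ[X], D ≠ 0 ∧ h * aeval x D = ev x y A B) :
    ∃ φ : Ω[K⁄ℂ] ≃ₗ[K] K, φ (KaehlerDifferential.D ℂ K x) = 1 := by
  let _ : Algebra ℂ[X] K := (aeval x : ℂ[X] →ₐ[ℂ] K).toAlgebra
  have hmap : ∀ A : ℂ[X], algebraMap ℂ[X] K A = aeval x A := fun _ => rfl
  have _ : IsScalarTower ℂ ℂ[X] K := IsScalarTower.of_algebraMap_eq fun c => by
    rw [hmap, algebraMap_eq, aeval_C]
  have _ : FaithfulSMul ℂ[X] K :=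
    (faithfulSMul_iff_algebraMap_injective _ _).2 (transcendental_iff_injective.1 hx)
  let _ : Algebra (FractionRing ℂ[X]) K := FractionRing.liftAlgebra ℂ[X] K
  have _ : IsScalarTower ℂ[X] (FractionRing ℂ[X]) K := FractionRing.isScalarTower_liftAlgebra _ _
  have _ : IsScalarTower ℂ (FractionRing ℂ[X]) K := IsScalarTower.of_algebraMap_eq fun c => by
    rw [IsScalarTower.algebraMap_apply ℂ ℂ[X] (FractionRing ℂ[X]),
      ← IsScalarTower.algebraMap_apply ℂ[X] (FractionRing ℂ[X]) K,
      ← IsScalarTower.algebraMap_apply ℂ ℂ[X] K]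
  have _ : Module.Finite (FractionRing ℂ[X]) K := by
    classical
    refine ⟨({1, y} : Finset K), ?_⟩
    rw [eq_top_iff]
    rintro h -
    obtain ⟨A, B, D, hD, hh⟩ := gen h
    have hDx := Model.aeval_ne_zero hx hD
    rw [Finset.coe_pair, Submodule.mem_span_pair]
    have key : ∀ N : ℂ[X], algebraMap (FractionRing ℂ[X]) K
        (algebraMap ℂ[X] _ N / algebraMap ℂ[X] _ D) = aeval x N / aeval x D := by
      intro N
      rw [map_div₀, ← IsScalarTower.algebraMap_apply, ← IsScalarTower.algebraMap_apply]
      rfl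
    refine ⟨algebraMap ℂ[X] _ A / algebraMap ℂ[X] _ D,
      algebraMap ℂ[X] _ B / algebraMap ℂ[X] _ D, ?_⟩
    rw [Algebra.smul_def, Algebra.smul_def, key, key]
    field_simp
    rw [mul_comm _ h, hh, ev]
  have _ : Algebra.FormallyEtale (FractionRing ℂ[X]) K := Algebra.FormallyEtale.of_isSeparable _ _
  have _ : Algebra.FormallyEtale ℂ[X] (FractionRing ℂ[X]) :=
    Algebra.FormallyEtale.of_isLocalization (nonZeroDivisors ℂ[X])
  have _ : Algebra.FormallyEtale ℂ[X] K := Algebra.FormallyEtale.comp ℂ[X] (FractionRing ℂ[X]) K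
  refine ⟨(KaehlerDifferential.tensorKaehlerEquivOfFormallyEtale ℂ ℂ[X] K).symm ≪≫ₗ
    (KaehlerDifferential.polynomialEquiv ℂ).baseChange ℂ[X] K _ _ ≪≫ₗ
    TensorProduct.AlgebraTensorModule.rid ℂ[X] K K, ?_⟩
  have : x = algebraMap ℂ[X] K X := by rw [hmap, aeval_X]
  conv_lhs => rw [this]
  simp [KaehlerDifferential.tensorKaehlerEquivOfFormallyEtale_symm_D_algebraMap]

variable (K) in
theorem algebraMap_half_mul_two : algebraMap ℂ K (1 / 2) * 2 = 1 := by
  rw [← map_ofNat (algebraMap ℂ K) 2, ← map_mul]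
  norm_num

/-- The `q`-differential `η ^ q`. -/
def qpow (q : ℕ) (η : Ω[K⁄ℂ]) : QDiff K q := PiTensorProduct.tprod K fun _ : Fin q => η

theorem qpow_smul (q : ℕ) (c : K) (η : Ω[K⁄ℂ]) : qpow q (c • η) = c ^ q • qpow q η := by
  unfold qpow
  rw [MultilinearMap.map_smul_univ (PiTensorProduct.tprod K) (fun _ : Fin q => c)]
  simp

/-- `η` spans the space of differentials, which is one-dimensional. -/
def IsGenerator (η : Ω[K⁄ℂ]) : Prop := ∃ φ : Ω[K⁄ℂ] ≃ₗ[K] K, φ η = 1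

theorem IsGenerator.smul {η : Ω[K⁄ℂ]} (h : IsGenerator η) {c : K} (hc : c ≠ 0) :
    IsGenerator (c • η) := by
  obtain ⟨φ, hφ⟩ := h
  refine ⟨φ ≪≫ₗ LinearEquiv.smulOfNeZero K K c⁻¹ (inv_ne_zero hc), ?_⟩
  simp [hφ, hc]

theorem IsGenerator.exists_eq {η : Ω[K⁄ℂ]} (h : IsGenerator η) {q : ℕ} (ψ : QDiff K q) :
    ∃ g : K, ψ = g • qpow q η := by
  obtain ⟨φ, hφ⟩ := h
  have h1 : ∀ θ : Ω[K⁄ℂ], θ = φ θ • η := fun θ => φ.injective (by simp [hφ])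
  have h2 : ψ ∈ Submodule.span K
      (Set.range (PiTensorProduct.tprod K (s := fun _ : Fin q => Ω[K⁄ℂ]))) := by
    rw [PiTensorProduct.span_tprod_eq_top]
    trivial
  induction h2 using Submodule.span_induction with
  | mem ψ hψ =>
    obtain ⟨θ, rfl⟩ := hψ
    have h3 : θ = fun i => φ (θ i) • η := funext fun i => h1 (θ i)
    refine ⟨∏ i, φ (θ i), ?_⟩
    conv_lhs => rw [h3]
    exact MultilinearMap.map_smul_univ (PiTensorProduct.tprod K) _ _
  | zero => exact ⟨0, (zero_smul K _).symm⟩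
  | add a b _ _ ha hb =>
    obtain ⟨g, rfl⟩ := ha
    obtain ⟨g', rfl⟩ := hb
    exact ⟨g + g', (add_smul g g' _).symm⟩
  | smul c a _ ha =>
    obtain ⟨g, rfl⟩ := ha
    exact ⟨c * g, (mul_smul c g _).symm⟩

/-- The coordinate φ with φ(η) = 1 induces the functional θ₁ ⊗ … ⊗ θ_q ↦ ∏ φ(θᵢ), which takes the
value 1 at η^q. -/
theorem IsGenerator.smul_inj {η : Ω[K⁄ℂ]} (h : IsGenerator η) {q : ℕ} {g g' : K}
    (hg : g • qpow q η = g' • qpow q η) : g = g' := by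
  obtain ⟨φ, hφ⟩ := h
  let L : QDiff K q →ₗ[K] K := PiTensorProduct.lift
    ((MultilinearMap.mkPiAlgebra K (Fin q) K).compLinearMap fun _ => φ.toLinearMap)
  have hL : L (qpow q η) = 1 := by
    simp [L, qpow, hφ]
  have := congrArg L hg
  simpa [hL] using this

namespace Place

/-- `η` generates the differentials at `P`: it is neither zero nor infinite at `P`. -/
def LocalGen (P : Place K) (η : Ω[K⁄ℂ]) : Prop :=
  ∀ π, P.IsUniformizer π → ∃ c, P.IsUnitAt c ∧ KaehlerDifferential.D ℂ K π = c • η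

variable {P : Place K} {η : Ω[K⁄ℂ]}

theorem LocalGen.dpow_eq (h : P.LocalGen η) {π : K} (hπ : P.IsUniformizer π) (q : ℕ) :
    ∃ c, P.IsUnitAt c ∧ dpow q π = c • qpow q η := by
  obtain ⟨c, hc, h1⟩ := h π hπ
  refine ⟨c ^ q, hc.pow q, ?_⟩
  rw [← qpow_smul, ← h1]
  rfl

/-- Every (dπ)^q is a unit times η^q, so the condition over all uniformizers reduces to the one
coefficient g. The given π₀ ensures that this condition is not vacuous. -/
theorem LocalGen.holo_iff (h : P.LocalGen η) (hη : IsGenerator η) {π₀ : K}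
    (hπ₀ : P.IsUniformizer π₀) {q : ℕ} {g : K} :
    (∀ π, P.IsUniformizer π → ∃ r, P.IsRegular r ∧ g • qpow q η = r • dpow q π) ↔
      P.IsRegular g := by
  constructor
  · intro hg
    obtain ⟨r, hr, h1⟩ := hg π₀ hπ₀
    obtain ⟨c, hc, h2⟩ := h.dpow_eq hπ₀ q
    rw [h2, smul_smul] at h1
    rw [hη.smul_inj h1]
    exact hr.mul hc.isRegular
  · intro hg π hπ
    obtain ⟨c, hc, h2⟩ := h.dpow_eq hπ q
    refine ⟨g * c⁻¹, hg.mul hc.inv.isRegular, ?_⟩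
    rw [h2, smul_smul, inv_mul_cancel_right₀ hc.ne_zero]

theorem LocalGen.hasOrd_iff (h : P.LocalGen η) (hη : IsGenerator η) {q : ℕ} {g : K} {n : ℤ} :
    P.HasOrd (g • qpow q η) n ↔
      ∃ π c, P.IsUniformizer π ∧ P.IsUnitAt c ∧ g = π ^ n * c := by
  constructor
  · rintro ⟨π, c, hπ, hc, h1⟩
    obtain ⟨e, he, h2⟩ := h.dpow_eq hπ q
    rw [h2, smul_smul] at h1
    refine ⟨π, c * e, hπ, hc.mul he, ?_⟩
    rw [hη.smul_inj h1]
    ring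
  · rintro ⟨π, c, hπ, hc, rfl⟩
    obtain ⟨e, he, h2⟩ := h.dpow_eq hπ q
    refine ⟨π, c * e⁻¹, hπ, hc.mul he.inv, ?_⟩
    rw [h2, smul_smul]
    congr 1
    have := he.ne_zero
    field_simp

/-- Two uniformizers differ by a unit. -/
theorem IsUniformizer.exists_unit {π π' : K} (hπ : P.IsUniformizer π) (hπ' : P.IsUniformizer π')
    (h0 : π ≠ 0) : ∃ c, P.IsUnitAt c ∧ π' = c * π := by
  obtain ⟨g, hg, h1⟩ := hπ.2 π' hπ'.1
  obtain ⟨g', hg', h2⟩ := hπ'.2 π hπ.1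
  have h3 : g * g' = 1 := by
    apply mul_right_cancel₀ h0
    rw [one_mul]
    nth_rw 2 [h2]
    rw [h1]
    ring
  refine ⟨g, ?_, h1⟩
  rcases hg.isUnitAt_or with h | h
  · exact h
  · have := h.mul_regular hg'
    rw [mul_comm, h3] at this
    simp [IsZero] at this

end Place

namespace Model

variable {f : ℂ[X]} {x y : K}

/-- The differential `dx / y`. -/
def omega (x y : K) : Ω[K⁄ℂ] := y⁻¹ • KaehlerDifferential.D ℂ K x

theorem isGenerator_D (M : Model f x y) : IsGenerator (KaehlerDifferential.D ℂ K x) :=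
  exists_kaehler_equiv M.trans M.gen

theorem isGenerator_omega (M : Model f x y) : IsGenerator (omega x y) :=
  M.isGenerator_D.smul (inv_ne_zero M.y_ne_zero)

/-- The derivation `d / dx`. -/
theorem exists_derivation (M : Model f x y) :
    ∃ δ : Derivation ℂ K K, δ x = 1 ∧ 2 * y * δ y = aeval x (derivative f) ∧
      ∀ g, KaehlerDifferential.D ℂ K g = δ g • KaehlerDifferential.D ℂ K x := by
  obtain ⟨φ, hφ⟩ := M.isGenerator_D
  refine ⟨φ.toLinearMap.compDer (KaehlerDifferential.D ℂ K), by simpa using hφ, ?_, fun g => ?_⟩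
  · have h1 := congrArg (φ.toLinearMap.compDer (KaehlerDifferential.D ℂ K)) M.eq
    rw [Derivation.map_aeval, Derivation.leibniz_pow] at h1
    have h2 : (φ.toLinearMap.compDer (KaehlerDifferential.D ℂ K)) x = 1 := by simpa using hφ
    rw [h2, smul_eq_mul, smul_eq_mul, mul_one] at h1
    rw [← h1]
    simp only [Nat.add_one_sub_one, pow_one, nsmul_eq_mul, Nat.cast_ofNat]
    ring
  · apply φ.injective
    simp [hφ]

/-- The derivation y d/dx maps ℂ[x, y] into itself because y · dy/dx = f'(x)/2; the quotient rule
extends this to local rings. -/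
theorem isRegular_derivation (M : Model f x y) {δ : Derivation ℂ K K} (hx : δ x = 1)
    (hy : 2 * y * δ y = aeval x (derivative f)) {P : Place K} (h : P.IsRegular x) {g : K}
    (hg : P.IsRegular g) : P.IsRegular (y * δ g) := by
  obtain ⟨a, b, hP⟩ := M.exists_liesOver h
  have hev : ∀ A B, P.IsRegular (y * δ (ev x y A B)) := by
    intro A B
    have h1 : y * δ (ev x y A B) = aeval x (derivative A) * y + aeval x (derivative B) * y ^ 2
        + algebraMap ℂ K (1 / 2) * aeval x B * aeval x (derivative f) := by
      rw [← hy, ev, map_add, Derivation.leibniz, Derivation.map_aeval, Derivation.map_aeval, hx]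
      simp only [smul_eq_mul, mul_one]
      linear_combination (-aeval x B * y * δ y) * algebraMap_half_mul_two K
    rw [h1]
    have hy' := M.isRegular_y h
    exact (((h.aeval _).mul hy').add ((h.aeval _).mul (hy'.pow 2))).add
      (((P.isRegular_const _).mul (h.aeval _)).mul (h.aeval _))
  obtain ⟨A, B, s, hs, h1⟩ := M.exists_quotient hP hg
  have hsu := isUnitAt_of_nonVan hP hs
  obtain ⟨A', B', rfl, -⟩ := hs
  have h2 := congrArg δ h1
  rw [Derivation.leibniz, smul_eq_mul, smul_eq_mul] at h2
  have h3 : y * δ g = (y * δ (ev x y A B) - g * (y * δ (ev x y A' B'))) * (ev x y A' B')⁻¹ := by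
    have := hsu.ne_zero
    rw [← h2]
    field_simp
    ring
  rw [h3]
  exact ((hev _ _).sub (hg.mul (hev _ _))).mul hsu.inv.isRegular

/-- At a branch point the value is f'(x)/2, nonzero because roots of f are simple; elsewhere it is y
itself. -/
theorem isUnitAt_derivation_unif (M : Model f x y) {δ : Derivation ℂ K K} (hx : δ x = 1)
    (hy : 2 * y * δ y = aeval x (derivative f)) {P : Place K} {a b : ℂ}
    (hP : P.LiesOver x y a b) : P.IsUnitAt (y * δ (unif x y a b)) := by
  unfold unif
  split_ifs with hb
  · have hfa : f.eval a = 0 := by rw [← M.liesOver_sq hP, hb]; simp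
    have h1 : y * δ y = algebraMap ℂ K (1 / 2) * aeval x (derivative f) := by
      rw [← hy]
      linear_combination (-y * δ y) * algebraMap_half_mul_two K
    rw [h1]
    exact (P.isUnitAt_const (by norm_num)).mul
      (isUnitAt_of_nonVan hP (nonVan_aeval b (M.derivative_eval_ne hfa)))
  · rw [map_sub, hx, Derivation.map_algebraMap, sub_zero, mul_one]
    exact isUnitAt_of_nonVan hP ⟨0, 1, by simp [ev], by simpa using hb⟩

theorem localGen_omega (M : Model f x y) {P : Place K} (h : P.IsRegular x) :
    P.LocalGen (omega x y) := by
  intro π hπ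
  obtain ⟨a, b, hP⟩ := M.exists_liesOver h
  obtain ⟨δ, hx, hy, hD⟩ := M.exists_derivation
  obtain ⟨c, hc, rfl⟩ := (M.isUniformizer_unif hP).exists_unit hπ (M.unif_ne_zero a b)
  refine ⟨y * δ (c * unif x y a b), ?_, ?_⟩
  · have h1 : y * δ (c * unif x y a b)
        = c * (y * δ (unif x y a b)) + (y * δ c) * unif x y a b := by
      rw [Derivation.leibniz, smul_eq_mul, smul_eq_mul]
      ring
    rw [h1]
    exact (hc.mul (M.isUnitAt_derivation_unif hx hy hP)).add_isZero
      ((isZero_unif hP).mul_regular (M.isRegular_derivation hx hy h hc.isRegular))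
  · rw [hD, omega, smul_smul]
    congr 1
    have := M.y_ne_zero
    field_simp

end Model

end

/-! ### The chart at infinity and holomorphic differentials -/

section

variable {K : Type u} [Field K] [Algebra ℂ K]

theorem aeval_inv_reflect {x : K} (hx : x ≠ 0) {A : ℂ[X]} {N : ℕ} (hN : A.natDegree ≤ N) :
    aeval x⁻¹ (reflect N A) * x ^ N = aeval x A := by
  let _ := invertibleOfNonzero hx
  have := eval₂_reflect_mul_pow (algebraMap ℂ K) x N A hN
  rwa [invOf_eq_inv] at this

theorem aeval_reflect {x : K} (hx : x ≠ 0) {A : ℂ[X]} {N : ℕ} (hN : A.natDegree ≤ N) :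
    aeval x (reflect N A) = aeval x⁻¹ A * x ^ N := by
  have h1 := aeval_inv_reflect (inv_ne_zero hx) hN
  rw [inv_inv, inv_pow] at h1
  have := pow_ne_zero N hx
  rw [← h1]
  field_simp

namespace Model

variable {f : ℂ[X]} {x y : K}

theorem x_ne_zero (M : Model f x y) : x ≠ 0 := by
  have := aeval_ne_zero M.trans X_ne_zero
  simpa using this

/-- A function without poles in the affine part is a polynomial in `x` and `y`. -/
theorem exists_eq_ev (M : Model f x y) {h : K}
    (hreg : ∀ P : Place K, P.IsRegular x → P.IsRegular h) : ∃ A B, h = ev x y A B := by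
  have key : ∀ (N : ℕ) (A B D : ℂ[X]), D.natDegree ≤ N → D ≠ 0 → h * aeval x D = ev x y A B →
      ∃ A B, h = ev x y A B := by
    intro N
    induction N with
    | zero =>
      intro A B D hN hD hh
      obtain ⟨c, rfl⟩ := natDegree_eq_zero.1 (Nat.le_zero.1 hN)
      have hc : c ≠ 0 := by simpa using hD
      refine ⟨C c⁻¹ * A, C c⁻¹ * B, ?_⟩
      have h1 : ev x y (C c⁻¹ * A) (C c⁻¹ * B) = algebraMap ℂ K c⁻¹ * ev x y A B := by
        simp only [ev, map_mul, aeval_C]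
        ring
      rw [h1, ← hh, aeval_C, mul_comm, mul_assoc, ← map_mul, mul_inv_cancel₀ hc, map_one, mul_one]
    | succ N ih =>
      intro A B D hN hD hh
      by_cases hdeg : D.natDegree ≤ N
      · exact ih A B D hdeg hD hh
      obtain ⟨a, ha⟩ := IsAlgClosed.exists_root D (by
        rw [degree_eq_natDegree hD]
        norm_cast
        omega)
      obtain ⟨D', rfl⟩ := dvd_iff_isRoot.2 ha
      have hzero : ∀ (P : Place K) (b : ℂ), P.LiesOver x y a b → A.eval a + B.eval a * b = 0 := by
        intro P b hP
        rw [← isZero_ev_iff hP, ← hh, map_mul]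
        have h1 := hreg P (liesOver_isRegular hP)
        have h2 := (liesOver_isRegular hP).aeval D'
        have h3 := hP.1.mul_regular (h1.mul h2)
        convert! h3 using 1
        simp only [map_sub, aeval_X, aeval_C]
        ring
      obtain ⟨b, hb⟩ := IsAlgClosed.exists_pow_nat_eq (f.eval a) (n := 2) (by norm_num)
      -- The factor X - a of the denominator cancels. If b ≠ 0, A ± Bb vanish at the two points over
      -- a.
      have hAB : A.eval a = 0 ∧ B.eval a = 0 := by
        obtain ⟨P, hP⟩ := M.exists_place hb
        have h1 := hzero P b hP
        by_cases hb0 : b = 0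
        · subst hb0
          have hA : A.eval a = 0 := by simpa using h1
          refine ⟨hA, ?_⟩
          have hfa : f.eval a = 0 := by rw [← hb]; simp
          obtain ⟨f₁, hf⟩ := dvd_iff_isRoot.2 hfa
          have hf₁ : f₁.eval a ≠ 0 := by
            have := M.derivative_eval_ne hfa
            rw [hf] at this
            simpa using this
          obtain ⟨A', rfl⟩ := dvd_iff_isRoot.2 hA
          have hxa : x - algebraMap ℂ K a ≠ 0 := by
            have := aeval_ne_zero M.trans (X_sub_C_ne_zero a)
            simpa using this
          have hy2 := M.eq
          rw [hf] at hy2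
          simp only [ev, map_mul, map_sub, aeval_X, aeval_C] at hh hy2
          -- At a branch point only A(a) = 0 is immediate. Dividing by x - a = y²/f₁ exhibits B f₁
          -- as a regular function times y, so B(a) = 0 too.
          have h2 : ev x y (B * f₁) 0 = (h * aeval x D' - aeval x A') * y := by
            apply mul_left_cancel₀ hxa
            simp only [ev, map_mul, map_zero]
            linear_combination (-y) * hh - (aeval x B) * hy2
          have hx := liesOver_isRegular hP
          have h3 : P.IsZero (ev x y (B * f₁) 0) := by
            rw [h2]
            have hy0 := hP.2
            rw [map_zero, sub_zero] at hy0
            exact hy0.mul_regular (((hreg P hx).mul (hx.aeval _)).sub (hx.aeval _))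
          rw [isZero_ev_iff hP] at h3
          simpa [hf₁] using h3
        · obtain ⟨Q, hQ⟩ := M.exists_place (a := a) (b := -b) (by rw [← hb]; ring)
          have h2 := hzero Q _ hQ
          refine ⟨by linear_combination (h1 + h2) / 2, ?_⟩
          apply mul_right_cancel₀ hb0
          linear_combination (h1 - h2) / 2
      obtain ⟨A', rfl⟩ := dvd_iff_isRoot.2 hAB.1
      obtain ⟨B', rfl⟩ := dvd_iff_isRoot.2 hAB.2
      have hD' : D' ≠ 0 := right_ne_zero_of_mul hD
      refine ih A' B' D' ?_ hD' ?_
      · rw [natDegree_mul (X_sub_C_ne_zero a) hD', natDegree_X_sub_C] at hN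
        omega
      · have hxa : x - algebraMap ℂ K a ≠ 0 := by
          have := aeval_ne_zero M.trans (X_sub_C_ne_zero a)
          simpa using this
        apply mul_left_cancel₀ hxa
        simp only [ev, map_mul, map_sub, aeval_X, aeval_C] at hh ⊢
        linear_combination hh
  obtain ⟨A, B, D, hD, hh⟩ := M.gen h
  exact key _ A B D le_rfl hD hh

theorem not_X_sq_dvd_reflect {f : ℂ[X]} {m : ℕ} (hf : f ≠ 0) (h1 : f.natDegree ≤ 2 * m)
    (h2 : 2 * m ≤ f.natDegree + 1) : ¬ (X ^ 2 ∣ reflect (2 * m) f) := by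
  intro h
  rw [X_pow_dvd_iff] at h
  have h3 := leadingCoeff_ne_zero.2 hf
  apply h3
  rw [leadingCoeff]
  have h4 := h (2 * m - f.natDegree) (by omega)
  rwa [coeff_reflect, revAt_le (by omega), Nat.sub_sub_self h1] at h4

/-- Reflecting back a square factor p² gives a square factor of f, so the reflection of p is
constant and p is a monomial. It must then be constant, as X² does not divide the reflection when
deg f ≥ 2m - 1. -/
theorem squarefree_reflect {f : ℂ[X]} {m : ℕ} (hf : Squarefree f) (h1 : f.natDegree ≤ 2 * m)
    (h2 : 2 * m ≤ f.natDegree + 1) : Squarefree (reflect (2 * m) f) := by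
  intro p hp
  obtain ⟨g, hg⟩ := hp
  have hr0 : reflect (2 * m) f ≠ 0 := by
    rw [Ne, reflect_eq_zero_iff]
    exact hf.ne_zero
  have hp0 : p ≠ 0 := by
    rintro rfl
    simp at hg
    exact hf.ne_zero hg
  have hg0 : g ≠ 0 := by
    rintro rfl
    simp at hg
    exact hf.ne_zero hg
  have hdeg : p.natDegree + p.natDegree + g.natDegree ≤ 2 * m := by
    have h3 : (reflect (2 * m) f).natDegree ≤ 2 * m := by
      have := natDegree_reflect_le (p := f) (N := 2 * m)
      omega
    rwa [hg, natDegree_mul (mul_ne_zero hp0 hp0) hg0, natDegree_mul hp0 hp0] at h3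
  obtain ⟨d, hd⟩ := Nat.exists_eq_add_of_le hdeg
  have h4 : f = reflect p.natDegree p * reflect p.natDegree p * reflect (g.natDegree + d) g := by
    rw [← reflect_mul p p le_rfl le_rfl, ← reflect_mul (p * p) g natDegree_mul_le (by omega), ← hg,
      ← add_assoc, ← hd, reflect_reflect]
  have hu := hf (reflect p.natDegree p) ⟨_, h4⟩
  obtain ⟨c, hc, hc'⟩ := Polynomial.isUnit_iff.1 hu
  have h5 : p = C c * X ^ p.natDegree := by
    rw [← reflect_C, hc', reflect_reflect]
  by_cases hp1 : p.natDegree = 0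
  · rw [hp1, pow_zero, mul_one] at h5
    rw [h5]
    exact isUnit_C.2 hc
  · exfalso
    apply not_X_sq_dvd_reflect hf.ne_zero h1 h2
    have hX : X ∣ p := by
      rw [h5]
      exact (dvd_pow_self X hp1).mul_left _
    rw [hg, pow_two]
    exact (mul_dvd_mul hX hX).mul_right _

/-- The chart at infinity. -/
theorem recip (M : Model f x y) {m : ℕ} (h1 : f.natDegree ≤ 2 * m)
    (h2 : 2 * m ≤ f.natDegree + 1) : Model (reflect (2 * m) f) x⁻¹ (y * x⁻¹ ^ m) := by
  have hm : m ≠ 0 := by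
    have := M.deg
    omega
  have hx := M.x_ne_zero
  refine ⟨squarefree_reflect M.sqf h1 h2, ?_, ?_, ?_, ?_⟩
  · intro h0
    obtain ⟨c, hc⟩ := natDegree_eq_zero.1 h0
    have h3 : f = C c * X ^ (2 * m) := by rw [← reflect_C, hc, reflect_reflect]
    have hX : IsUnit (X : ℂ[X]) := M.sqf X (by
      rw [h3, ← pow_two]
      exact (pow_dvd_pow X (by omega)).mul_left _)
    exact not_isUnit_X hX
  · intro h
    exact M.trans (by simpa using h.inv)
  · have h3 := aeval_inv_reflect hx h1
    rw [mul_pow, M.eq, ← h3, ← pow_mul, mul_comm m 2, mul_assoc, ← mul_pow, mul_inv_cancel₀ hx,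
      one_pow, mul_one]
  · intro h
    obtain ⟨A, B, D, hD, hh⟩ := M.gen h
    let n := A.natDegree + B.natDegree + D.natDegree
    refine ⟨reflect (n + m) A, reflect n B, reflect (n + m) D, ?_, ?_⟩
    · rwa [Ne, reflect_eq_zero_iff]
    · have hA := aeval_inv_reflect hx (A := A) (N := n + m) (by omega)
      have hB := aeval_inv_reflect hx (A := B) (N := n) (by omega)
      have hD := aeval_inv_reflect hx (A := D) (N := n + m) (by omega)
      have hxm := pow_ne_zero m hx
      have hxn := pow_ne_zero (n + m) hx
      apply mul_right_cancel₀ hxn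
      rw [ev] at hh ⊢
      rw [mul_assoc, hD, hh, ← hA, ← hB, inv_pow, pow_add]
      field_simp

theorem omega_recip (M : Model f x y) (m : ℕ) :
    omega x y = (-x ^ (2 - (m : ℤ))) • omega x⁻¹ (y * x⁻¹ ^ m) := by
  have hx := M.x_ne_zero
  have hy := M.y_ne_zero
  rw [omega, omega, Derivation.leibniz_inv, smul_smul, smul_smul]
  congr 1
  rw [zpow_sub₀ hx, zpow_natCast]
  simp only [inv_pow]
  field_simp

theorem exists_uniformizer (M : Model f x y) {P : Place K} (h : P.IsRegular x) :
    ∃ π, P.IsUniformizer π := by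
  obtain ⟨a, b, hP⟩ := M.exists_liesOver h
  exact ⟨_, M.isUniformizer_unif hP⟩

/-- In each chart the local generator is that chart's dx/y. Passing from one to the other costs a
factor -x^(2-m) (`omega_recip`), whence the twist at infinity. -/
theorem mem_holoDiff_iff (M : Model f x y) {m : ℕ} (h1 : f.natDegree ≤ 2 * m)
    (h2 : 2 * m ≤ f.natDegree + 1) {q : ℕ} {h : K} : h • qpow q (omega x y) ∈ holoDiff K q ↔
      (∀ P : Place K, P.IsRegular x → P.IsRegular h) ∧
      (∀ P : Place K, P.IsRegular x⁻¹ → P.IsRegular (h * x ^ (-(q * (m - 2) : ℤ)))) := by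
  have M' := M.recip h1 h2
  have hmem : h • qpow q (omega x y) ∈ holoDiff K q ↔ ∀ (P : Place K) (π : K),
      P.IsUniformizer π → ∃ g, P.IsRegular g ∧ h • qpow q (omega x y) = g • dpow q π := Iff.rfl
  have haff : ∀ P : Place K, P.IsRegular x → ((∀ π, P.IsUniformizer π →
      ∃ g, P.IsRegular g ∧ h • qpow q (omega x y) = g • dpow q π) ↔ P.IsRegular h) := by
    intro P hP
    obtain ⟨π, hπ⟩ := M.exists_uniformizer hP
    exact (M.localGen_omega hP).holo_iff M.isGenerator_omega hπ
  have hinf : ∀ P : Place K, P.IsRegular x⁻¹ → ((∀ π, P.IsUniformizer π →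
      ∃ g, P.IsRegular g ∧ h • qpow q (omega x y) = g • dpow q π) ↔
        P.IsRegular (h * x ^ (-(q * (m - 2) : ℤ)))) := by
    intro P hP
    obtain ⟨π, hπ⟩ := M'.exists_uniformizer hP
    rw [M.omega_recip m, qpow_smul, smul_smul, (M'.localGen_omega hP).holo_iff
      M'.isGenerator_omega hπ]
    have h3 : h * (-x ^ (2 - (m : ℤ))) ^ q
        = algebraMap ℂ K ((-1) ^ q) * (h * x ^ (-(q * (m - 2) : ℤ))) := by
      rw [neg_pow, ← zpow_natCast (x ^ _), ← zpow_mul, map_pow, map_neg, map_one]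
      rw [show (2 - (m : ℤ)) * (q : ℤ) = -(q * (m - 2) : ℤ) by ring]
      ring
    rw [h3]
    have hu : P.IsUnitAt (algebraMap ℂ K ((-1) ^ q)) := P.isUnitAt_const (by simp)
    constructor
    · intro h4
      have := hu.inv.isRegular.mul h4
      rwa [inv_mul_cancel_left₀ hu.ne_zero] at this
    · exact fun h4 => hu.isRegular.mul h4
  rw [hmem]
  constructor
  · exact fun h3 => ⟨fun P hP => (haff P hP).1 (h3 P), fun P hP => (hinf P hP).1 (h3 P)⟩
  · rintro ⟨h3, h4⟩ P
    by_cases hP : P.IsRegular x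
    · exact (haff P hP).2 (h3 P hP)
    · exact (hinf P (Place.isRegular_inv_of_not hP)).2 (h4 P (Place.isRegular_inv_of_not hP))

theorem isRegular_aeval_mul_zpow {x : K} (hx : x ≠ 0) {P : Place K} (hP : P.IsRegular x⁻¹)
    {A : ℂ[X]} {e : ℤ} (hA : A ≠ 0 → (A.natDegree : ℤ) ≤ e) : P.IsRegular (aeval x A * x ^ (-e)) := by
  by_cases hA0 : A = 0
  · subst hA0
    rw [map_zero, zero_mul]
    exact P.ring.zero_mem
  · have h1 := hA hA0
    lift e to ℕ using by omega
    rw [← aeval_inv_reflect hx (by exact_mod_cast h1), mul_assoc, zpow_neg, zpow_natCast,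
      mul_inv_cancel₀ (pow_ne_zero e hx), mul_one]
    exact hP.aeval _

/-- Regularity at infinity makes x^(-e)(A + By), with e = q(m - 2), a polynomial A' + B' · y x^(-m)
in the coordinates of the chart at infinity. Multiplying by a large power of x and comparing
coefficients bounds the degrees. -/
theorem ev_mem_holoDiff_iff (M : Model f x y) {m : ℕ} (h1 : f.natDegree ≤ 2 * m)
    (h2 : 2 * m ≤ f.natDegree + 1) {q : ℕ} {A B : ℂ[X]} :
    ev x y A B • qpow q (omega x y) ∈ holoDiff K q ↔
      (A ≠ 0 → (A.natDegree : ℤ) ≤ q * (m - 2)) ∧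
      (B ≠ 0 → (B.natDegree : ℤ) ≤ q * (m - 2) - m) := by
  have hx := M.x_ne_zero
  have M' := M.recip h1 h2
  rw [M.mem_holoDiff_iff h1 h2]
  generalize (q * (m - 2) : ℤ) = e
  constructor
  · rintro ⟨-, h3⟩
    obtain ⟨A', B', h4⟩ := M'.exists_eq_ev h3
    -- The integer e may be negative; the summand |e| keeps N and k nonnegative, with k = N + m - e.
    obtain ⟨k, hk⟩ : ∃ k : ℕ, (k : ℤ) = (A'.natDegree + B'.natDegree + m + e.natAbs : ℕ) - e :=
      ⟨((A'.natDegree + B'.natDegree + m + e.natAbs : ℕ) - e).toNat, by omega⟩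
    obtain ⟨N, hN⟩ : ∃ N, N = A'.natDegree + B'.natDegree + e.natAbs := ⟨_, rfl⟩
    have hA' := aeval_reflect hx (A := A') (N := N + m) (by omega)
    have hB' := aeval_reflect hx (A := B') (N := N) (by omega)
    have h5 : ev x y (X ^ k * A) (X ^ k * B) = ev x y (reflect (N + m) A') (reflect N B') := by
      have hxm := pow_ne_zero m hx
      have h6 : (x : K) ^ k = x ^ (-e) * x ^ (N + m) := by
        rw [← zpow_natCast, ← zpow_natCast, ← zpow_add₀ hx, hk, hN]
        congr 1
        push_cast
        ring
      simp only [ev, map_mul, map_pow, aeval_X, hA', hB'] at h4 ⊢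
      rw [h6]
      have h7 : x⁻¹ ^ m * x ^ m = 1 := by rw [← mul_pow, inv_mul_cancel₀ hx, one_pow]
      have h8 : x ^ (N + m) = x ^ N * x ^ m := pow_add x N m
      linear_combination x ^ (N + m) * h4 + aeval x⁻¹ B' * y * x⁻¹ ^ m * h8
        + aeval x⁻¹ B' * y * x ^ N * h7
    obtain ⟨hA, hB⟩ := M.ev_inj h5
    constructor
    · intro hA0
      have h6 := congrArg natDegree hA
      rw [natDegree_mul (pow_ne_zero k X_ne_zero) hA0, natDegree_X_pow] at h6
      have := natDegree_reflect_le (p := A') (N := N + m)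
      omega
    · intro hB0
      have h6 := congrArg natDegree hB
      rw [natDegree_mul (pow_ne_zero k X_ne_zero) hB0, natDegree_X_pow] at h6
      have := natDegree_reflect_le (p := B') (N := N)
      omega
  · rintro ⟨hA, hB⟩
    refine ⟨fun P hP => M.isRegular_ev hP A B, fun P hP => ?_⟩
    have h3 : ev x y A B * x ^ (-e) = aeval x A * x ^ (-e)
        + aeval x B * x ^ (-(e - m)) * (y * x⁻¹ ^ m) := by
      rw [show -(e - (m : ℤ)) = -e + m by ring, zpow_add₀ hx, zpow_natCast, ev, inv_pow]
      have hxm := pow_ne_zero m hx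
      field_simp
    rw [h3]
    exact (isRegular_aeval_mul_zpow hx hP hA).add
      ((isRegular_aeval_mul_zpow hx hP hB).mul (M'.isRegular_y hP))

theorem exists_of_mem_holoDiff (M : Model f x y) {q : ℕ} {ψ : QDiff K q} (hψ : ψ ∈ holoDiff K q) :
    ∃ A B, ψ = ev x y A B • qpow q (omega x y) := by
  obtain ⟨h, rfl⟩ := M.isGenerator_omega.exists_eq ψ
  obtain ⟨m, h1, h2⟩ : ∃ m, f.natDegree ≤ 2 * m ∧ 2 * m ≤ f.natDegree + 1 :=
    ⟨(f.natDegree + 1) / 2, by omega, by omega⟩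
  obtain ⟨A, B, rfl⟩ := M.exists_eq_ev ((M.mem_holoDiff_iff h1 h2).1 hψ).1
  exact ⟨A, B, rfl⟩

/-- Holomorphic differentials are the `A(x) dx / y` with `A` of degree at most `m - 2`. -/
theorem mem_holoDiff_one_iff (M : Model f x y) {m : ℕ} (h1 : f.natDegree ≤ 2 * m)
    (h2 : 2 * m ≤ f.natDegree + 1) {ψ : QDiff K 1} :
    ψ ∈ holoDiff K 1 ↔ ∃ A ∈ degreeLT ℂ (m - 1), ψ = aeval x A • qpow 1 (omega x y) := by
  have hdeg : ∀ A : ℂ[X], A ∈ degreeLT ℂ (m - 1) ↔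
      (A ≠ 0 → (A.natDegree : ℤ) ≤ (1 : ℕ) * (m - 2)) := by
    intro A
    have := M.deg
    by_cases hA : A = 0
    · simp [hA]
    · rw [mem_degreeLT, degree_eq_natDegree hA, Nat.cast_lt]
      simp only [hA, ne_eq, not_false_iff, true_imp_iff]
      omega
  constructor
  · intro h
    obtain ⟨A, B, rfl⟩ := M.exists_of_mem_holoDiff h
    rw [M.ev_mem_holoDiff_iff h1 h2, ← hdeg] at h
    -- For q = 1 the bound on deg B is (m - 2) - m = -2.
    have hB : B = 0 := by
      by_contra hB
      have := h.2 hB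
      omega
    exact ⟨A, h.1, by rw [hB, ev, map_zero, zero_mul, add_zero]⟩
  · rintro ⟨A, hA, rfl⟩
    have h3 : aeval x A = ev x y A 0 := by rw [ev, map_zero, zero_mul, add_zero]
    rw [h3, M.ev_mem_holoDiff_iff h1 h2, ← hdeg]
    exact ⟨hA, fun h => absurd rfl h⟩

theorem genus_eq (M : Model f x y) {m : ℕ} (h1 : f.natDegree ≤ 2 * m)
    (h2 : 2 * m ≤ f.natDegree + 1) : genus K = m - 1 := by
  let L : ℂ[X] →ₗ[ℂ] QDiff K 1 :=
    { toFun := fun A => aeval x A • qpow 1 (omega x y)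
      map_add' := fun A B => by rw [map_add, add_smul]
      map_smul' := fun c A => by rw [map_smul, smul_assoc, RingHom.id_apply] }
  have hL : Function.Injective L := fun A B h =>
    aeval_inj M.trans (M.isGenerator_omega.smul_inj h)
  have hmap : holoDiff K 1 = (degreeLT ℂ (m - 1)).map L := by
    ext ψ
    rw [M.mem_holoDiff_one_iff h1 h2, Submodule.mem_map]
    exact exists_congr fun A => and_congr_right fun _ => eq_comm
  rw [genus, hmap, ← (Submodule.equivMapOfInjective L hL _).finrank_eq,
    (degreeLTEquiv ℂ (m - 1)).finrank_eq, Module.finrank_fin_fun]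

end Model

end

/-! ### Orders, adapted bases and weights -/

section

variable {K : Type u} [Field K] [Algebra ℂ K]

namespace Place

variable {P : Place K}

theorem exists_valuation_sum_eq {ι : Type*} {h : ι → K} (s : Finset ι) (hs : s.Nonempty)
    (hinj : ∀ i ∈ s, ∀ j ∈ s, P.ring.valuation (h i) = P.ring.valuation (h j) → i = j) :
    ∃ i ∈ s, P.ring.valuation (∑ j ∈ s, h j) = P.ring.valuation (h i) := by
  classical
  induction hs using Finset.Nonempty.cons_induction with
  | singleton a => exact ⟨a, by simp, by simp⟩
  | cons a s ha hs ih =>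
    obtain ⟨i, hi, h1⟩ := ih fun i hi j hj => hinj i (by simp [hi]) j (by simp [hj])
    rw [Finset.sum_cons]
    have hne : P.ring.valuation (h a) ≠ P.ring.valuation (∑ j ∈ s, h j) := by
      rw [h1]
      intro h2
      exact ha (hinj a (by simp) i (by simp [hi]) h2 ▸ hi)
    rw [Valuation.map_add_of_distinct_val _ hne, h1]
    rcases max_choice (P.ring.valuation (h a)) (P.ring.valuation (h i)) with h2 | h2
    · exact ⟨a, by simp, h2⟩
    · exact ⟨i, by simp [hi], h2⟩

/-- The order of `h` at `P` is `n`. -/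
def OrdEq (P : Place K) (h : K) (n : ℤ) : Prop :=
  ∃ π c, P.IsUniformizer π ∧ P.IsUnitAt c ∧ h = π ^ n * c

theorem OrdEq.valuation {π h : K} {n : ℤ} (hπ : P.IsUniformizer π) (h0 : π ≠ 0)
    (hh : P.OrdEq h n) : P.ring.valuation h = P.ring.valuation π ^ n := by
  obtain ⟨π', c, hπ', hc, rfl⟩ := hh
  obtain ⟨e, he, rfl⟩ := hπ.exists_unit hπ' h0
  rw [map_mul, map_zpow₀, map_mul, hc.val, he.val, one_mul, mul_one]

theorem valuation_zpow_inj {π : K} (hπ : P.IsZero π) (h0 : π ≠ 0) {m n : ℤ}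
    (h : P.ring.valuation π ^ m = P.ring.valuation π ^ n) : m = n :=
  (zpow_right_injective₀ (zero_lt_iff.2 ((Valuation.ne_zero_iff _).2 h0)) hπ.ne) h

/-- Terms of distinct orders cannot cancel. This yields both the independence of functions with
distinct orders and the fact that a combination has one of the given orders. -/
theorem exists_order_of_sum {π : K} (hπ : P.IsUniformizer π) (h0 : π ≠ 0) {d : ℕ} {h : Fin d → K}
    {o : Fin d → ℤ} (ho : Function.Injective o) (hh : ∀ i, P.OrdEq (h i) (o i)) {c : Fin d → ℂ}
    (hc : c ≠ 0) :
    ∃ i, P.ring.valuation (∑ j, algebraMap ℂ K (c j) * h j) = P.ring.valuation π ^ o i := by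
  classical
  let s : Finset (Fin d) := Finset.univ.filter fun i => c i ≠ 0
  have hs : s.Nonempty := by
    obtain ⟨i, hi⟩ := Function.ne_iff.1 hc
    exact ⟨i, by simpa [s] using hi⟩
  have hval : ∀ i ∈ s, P.ring.valuation (algebraMap ℂ K (c i) * h i)
      = P.ring.valuation π ^ o i := by
    intro i hi
    have hi' : c i ≠ 0 := by simpa [s] using hi
    rw [map_mul, (P.isUnitAt_const hi').val, one_mul, (hh i).valuation hπ h0]
  obtain ⟨i, hi, h1⟩ := exists_valuation_sum_eq (P := P)
    (h := fun i => algebraMap ℂ K (c i) * h i) s hs (by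
      intro i hi j hj hij
      rw [hval i hi, hval j hj] at hij
      exact ho (valuation_zpow_inj hπ.1 h0 hij))
  refine ⟨i, ?_⟩
  rw [← hval i hi, ← h1]
  congr 1
  refine (Finset.sum_filter_of_ne ?_).symm
  intro j _ hj hcj
  rw [hcj, map_zero, zero_mul] at hj
  exact hj rfl

variable {η : Ω[K⁄ℂ]}

theorem LocalGen.hasOrd_iff_ordEq (h : P.LocalGen η) (hη : IsGenerator η) {q : ℕ} {g : K}
    {n : ℤ} : P.HasOrd (g • qpow q η) n ↔ P.OrdEq g n := h.hasOrd_iff hη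

theorem sum_smul_qpow {d q : ℕ} (c : Fin d → ℂ) (h : Fin d → K) :
    ∑ i, c i • (h i • qpow q η) = (∑ i, algebraMap ℂ K (c i) * h i) • qpow q η := by
  rw [Finset.sum_smul]
  refine Finset.sum_congr rfl fun i _ => ?_
  rw [mul_smul, algebraMap_smul]

/-- The set of orders of holomorphic differentials at a place is the set of orders of an adapted
basis. -/
theorem LocalGen.range_eq (hP : P.LocalGen η) (hη : IsGenerator η) {π : K}
    (hπ : P.IsUniformizer π) (h0 : π ≠ 0) {q d : ℕ} (ψ : Module.Basis (Fin d) ℂ (holoDiff K q))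
    {o : Fin d → ℤ} (ho : StrictMono o) (hψ : ∀ i, P.HasOrd (ψ i : QDiff K q) (o i)) :
    Set.range o = {n | ∃ θ ∈ holoDiff K q, P.HasOrd θ n} := by
  ext n
  constructor
  · rintro ⟨i, rfl⟩
    exact ⟨ψ i, (ψ i).2, hψ i⟩
  · rintro ⟨θ, hθ, hn⟩
    choose h hh using fun i => hη.exists_eq (ψ i : QDiff K q)
    obtain ⟨g, rfl⟩ := hη.exists_eq θ
    have h1 := ψ.sum_repr ⟨_, hθ⟩
    set c := fun i => ψ.repr ⟨_, hθ⟩ i with hc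
    have h2 := congrArg Subtype.val h1
    simp only [Submodule.coe_sum, Submodule.coe_smul, hh] at h2
    rw [sum_smul_qpow] at h2
    have h3 := hη.smul_inj h2
    rw [hP.hasOrd_iff_ordEq hη] at hn
    have hord : ∀ i, P.OrdEq (h i) (o i) := fun i => by
      rw [← hP.hasOrd_iff_ordEq hη (q := q), ← hh]
      exact hψ i
    have hv := hn.valuation hπ h0
    have hc0 : c ≠ 0 := by
      intro hc0
      have h4 : ∀ i, ψ.repr ⟨_, hθ⟩ i = 0 := fun i => congrFun hc0 i
      simp only [h4, map_zero, zero_mul, Finset.sum_const_zero] at h3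
      rw [← h3, map_zero] at hv
      exact zpow_ne_zero n ((Valuation.ne_zero_iff _).2 h0) hv.symm
    obtain ⟨i, hi⟩ := exists_order_of_sum hπ h0 ho.injective hord hc0
    rw [h3, hv] at hi
    exact ⟨i, (valuation_zpow_inj hπ.1 h0 hi).symm⟩

/-- The increasing sequence of orders is determined by its range, which by `range_eq` does not
depend on the basis. -/
theorem LocalGen.hasWeight_unique (hP : P.LocalGen η) (hη : IsGenerator η) {π : K}
    (hπ : P.IsUniformizer π) (h0 : π ≠ 0) {q w w' : ℕ} (hw : P.HasWeight q w)
    (hw' : P.HasWeight q w') : w = w' := by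
  obtain ⟨d, ψ, o, ho, hψ, h1⟩ := hw
  obtain ⟨d', ψ', o', ho', hψ', h1'⟩ := hw'
  obtain rfl : d = d' := by
    have h2 := Module.finrank_eq_card_basis ψ
    have h3 := Module.finrank_eq_card_basis ψ'
    simpa using h2.symm.trans h3
  have h4 : o = o' := (ho.range_inj ho').1
    ((hP.range_eq hη hπ h0 ψ ho hψ).trans (hP.range_eq hη hπ h0 ψ' ho' hψ').symm)
  subst h4
  exact_mod_cast h1.trans h1'.symm

theorem LocalGen.hasWeight (hP : P.LocalGen η) (hη : IsGenerator η) {π : K}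
    (hπ : P.IsUniformizer π) (h0 : π ≠ 0) {q d w : ℕ} (hd : d ≠ 0)
    (hdim : Module.finrank ℂ (holoDiff K q) = d)
    {h : Fin d → K} (hh : ∀ i, h i • qpow q η ∈ holoDiff K q) {o : Fin d → ℤ} (ho : StrictMono o)
    (hord : ∀ i, P.OrdEq (h i) (o i)) (hw : (w : ℤ) = ∑ i : Fin d, (o i - (i : ℕ))) :
    P.HasWeight q w := by
  have hli : LinearIndependent ℂ (fun i => (⟨_, hh i⟩ : holoDiff K q)) := by
    rw [Fintype.linearIndependent_iff]
    intro c hc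
    by_contra! hne
    have hc0 : c ≠ 0 := by
      rintro rfl
      obtain ⟨i, hi⟩ := hne
      exact hi rfl
    have h2 := congrArg Subtype.val hc
    simp only [Submodule.coe_sum, Submodule.coe_smul] at h2
    rw [sum_smul_qpow, Submodule.coe_zero, ← zero_smul K (qpow q η)] at h2
    obtain ⟨i, hi⟩ := exists_order_of_sum hπ h0 ho.injective hord hc0
    rw [hη.smul_inj h2, map_zero] at hi
    exact zpow_ne_zero _ ((Valuation.ne_zero_iff _).2 h0) hi.symm
  have _ : Nonempty (Fin d) := ⟨⟨0, Nat.pos_of_ne_zero hd⟩⟩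
  refine ⟨d, basisOfLinearIndependentOfCardEqFinrank hli (by simp [hdim]), o, ho, ?_, ?_⟩
  · intro i
    rw [coe_basisOfLinearIndependentOfCardEqFinrank, hP.hasOrd_iff_ordEq hη]
    exact hord i
  · rw [hw]
    exact Finset.sum_congr rfl fun i _ => by ring

end Place

/-! ### Quadratic differentials in genus three -/

namespace Model

variable {f : ℂ[X]} {x y : K}

/-- On a hyperelliptic curve of genus three the holomorphic quadratic differentials are the
`(A(x) + c y) (dx / y)²` with `A` of degree at most four. -/
theorem smul_mem_holoDiff_two (M : Model f x y) (h1 : f.natDegree ≤ 8) (h2 : 7 ≤ f.natDegree)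
    {A : ℂ[X]} (hA : A.natDegree ≤ 4) (c : ℂ) :
    ev x y A (C c) • qpow 2 (omega x y) ∈ holoDiff K 2 := by
  rw [M.ev_mem_holoDiff_iff (m := 4) h1 (by omega)]
  refine ⟨fun _ => ?_, fun _ => ?_⟩
  · push_cast
    omega
  · rw [natDegree_C]
    norm_num

/-- With m = 4 and q = 2 the bounds are deg A ≤ 4 and deg B ≤ 0, giving 5 + 1 parameters. -/
theorem finrank_holoDiff_two (M : Model f x y) (h1 : f.natDegree ≤ 8) (h2 : 7 ≤ f.natDegree) :
    Module.finrank ℂ (holoDiff K 2) = 6 := by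
  have hdeg : ∀ A : ℂ[X], A ∈ degreeLT ℂ 5 ↔ A.natDegree ≤ 4 := by
    intro A
    rw [mem_degreeLT]
    by_cases hA : A = 0
    · subst hA
      simp only [degree_zero, natDegree_zero]
      exact ⟨fun _ => by omega, fun _ => WithBot.bot_lt_coe 5⟩
    · rw [degree_eq_natDegree hA]
      norm_cast
      omega
  let L : (degreeLT ℂ 5 × ℂ) →ₗ[ℂ] holoDiff K 2 :=
    { toFun := fun p => ⟨ev x y p.1 (C p.2) • qpow 2 (omega x y),
        M.smul_mem_holoDiff_two h1 h2 ((hdeg _).1 p.1.2) p.2⟩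
      map_add' := fun p p' => Subtype.ext (by
        simp only [ev, Prod.fst_add, Prod.snd_add, Submodule.coe_add, map_add, ← add_smul]
        congr 1
        ring)
      map_smul' := fun c p => Subtype.ext (by
        simp only [ev, Prod.smul_fst, Prod.smul_snd, Submodule.coe_smul, smul_eq_mul, map_mul,
          aeval_C, AlgHom.commutes, RingHom.id_apply, Algebra.smul_def, ← smul_assoc]
        congr 1
        ring) }
  have hL : Function.Bijective L := by
    constructor
    · rintro ⟨⟨A, hA⟩, c⟩ ⟨⟨B, hB⟩, e⟩ h
      have h3 := M.isGenerator_omega.smul_inj (congrArg Subtype.val h)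
      obtain ⟨h4, h5⟩ := M.ev_inj h3
      simp only [C_inj] at h4 h5
      subst h4 h5
      rfl
    · rintro ⟨θ, hθ⟩
      obtain ⟨A, B, rfl⟩ := M.exists_of_mem_holoDiff hθ
      obtain ⟨hA, hB⟩ := (M.ev_mem_holoDiff_iff (m := 4) h1 (by omega)).1 hθ
      have hA' : A ∈ degreeLT ℂ 5 := by
        rw [hdeg]
        by_cases hA0 : A = 0
        · simp [hA0]
        · have := hA hA0
          push_cast at this
          omega
      have hB' : B.natDegree = 0 := by
        by_cases hB0 : B = 0
        · simp [hB0]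
        · have := hB hB0
          push_cast at this
          omega
      obtain ⟨c, rfl⟩ := natDegree_eq_zero.1 hB'
      exact ⟨⟨⟨A, hA'⟩, c⟩, rfl⟩
  rw [← (LinearEquiv.ofBijective L hL).finrank_eq, Module.finrank_prod,
    (degreeLTEquiv ℂ 5).finrank_eq, Module.finrank_fin_fun, Module.finrank_self]

end Model

end

/-! ### Weights from the fifth derivative of y -/

section

variable {K : Type u} [Field K] [Algebra ℂ K]

/-- The polynomials `N_k` with `2 ^ k y ^ (2 k - 1) d^k y / dx^k = N_k(x)` for `k ≥ 1`, where
`y² = f(x)`. -/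
def derivNum (f : ℂ[X]) : ℕ → ℂ[X]
  | 0 => 1
  | k + 1 => 2 * derivative (derivNum f k) * f - (2 * (k : ℂ[X]) - 1) * derivNum f k * derivative f

/-- At a root of f only the term with the odd, hence nonzero, factor 2k - 1 survives. So branch
points are never zeros of these polynomials and do not disturb the count of points over their roots.
-/
theorem derivNum_eval_ne_zero {f : ℂ[X]} {a : ℂ} (h : f.eval a = 0)
    (h' : f.derivative.eval a ≠ 0) (k : ℕ) : (derivNum f k).eval a ≠ 0 := by
  induction k with
  | zero => simp [derivNum]
  | succ k ih =>
    rw [derivNum]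
    simp only [eval_sub, eval_mul, h, mul_zero, zero_sub, eval_ofNat, eval_natCast, eval_one, ne_eq,
      neg_eq_zero]
    refine mul_ne_zero (mul_ne_zero ?_ ih) h'
    rw [sub_ne_zero]
    norm_cast
    omega

namespace Model

variable {f : ℂ[X]} {x y : K}

theorem iterate_derivation_y (M : Model f x y) {δ : Derivation ℂ K K} (hx : δ x = 1)
    (hy : 2 * y * δ y = aeval x (derivative f)) (k : ℕ) :
    δ^[k] y * (2 * y ^ 2) ^ k = aeval x (derivNum f k) * y := by
  induction k with
  | zero => simp [derivNum]
  | succ k ih =>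
    rw [Function.iterate_succ_apply']
    have h1 := congrArg δ ih
    have hδ : δ (2 * y ^ 2) = 2 * aeval x (derivative f) := by
      rw [← hy, Derivation.leibniz, Derivation.leibniz_pow]
      have h2 : δ (2 : K) = 0 := by simpa using δ.map_natCast 2
      rw [h2]
      simp only [Nat.add_one_sub_one, pow_one, smul_eq_mul, nsmul_eq_mul, Nat.cast_ofNat]
      ring
    have h3 : (2 * y ^ 2) * δ ((2 * y ^ 2) ^ k)
        = k * (2 * y ^ 2) ^ k * (2 * aeval x (derivative f)) := by
      rw [Derivation.leibniz_pow, hδ, smul_eq_mul, nsmul_eq_mul]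
      cases k with
      | zero => simp
      | succ k =>
        rw [Nat.add_sub_cancel]
        ring
    simp only [Derivation.leibniz, Derivation.map_aeval, hx, smul_eq_mul, mul_one] at h1
    simp only [derivNum, map_sub, map_mul, map_ofNat, map_natCast, map_one, ← M.eq]
    rw [pow_succ]
    linear_combination (2 * y ^ 2) * h1 - δ^[k] y * h3
      + aeval x (derivNum f k) * y * hy - 2 * k * aeval x (derivative f) * ih

theorem isRegular_derivation_of_ne (M : Model f x y) {δ : Derivation ℂ K K} (hx : δ x = 1)
    (hy : 2 * y * δ y = aeval x (derivative f)) {P : Place K} {a b : ℂ} (hP : P.LiesOver x y a b)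
    (hb : b ≠ 0) {g : K} (hg : P.IsRegular g) : P.IsRegular (δ g) := by
  have hyu : P.IsUnitAt y := isUnitAt_of_nonVan hP ⟨0, 1, by simp [ev], by simpa using hb⟩
  have h1 := hyu.inv.isRegular.mul (M.isRegular_derivation hx hy (liesOver_isRegular hP) hg)
  rwa [inv_mul_cancel_left₀ hyu.ne_zero] at h1

/-- Away from branch points x - a is a uniformizer and d/dx preserves regularity, so each
differentiation lowers a positive order by exactly one; the integer factor that appears is a unit.
-/
theorem iterate_derivation_zpow_mul (M : Model f x y) {δ : Derivation ℂ K K} (hx : δ x = 1)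
    (hy : 2 * y * δ y = aeval x (derivative f)) {P : Place K} {a b : ℂ} (hP : P.LiesOver x y a b)
    (hb : b ≠ 0) {u : K} (hu : P.IsUnitAt u) (k n : ℕ) :
    ∃ u', P.IsUnitAt u' ∧ δ^[n] ((x - algebraMap ℂ K a) ^ (k + n) * u)
      = (x - algebraMap ℂ K a) ^ k * u' := by
  induction n generalizing u with
  | zero => exact ⟨u, hu, rfl⟩
  | succ n ih =>
    set π := x - algebraMap ℂ K a with hπ
    have hδ : δ π = 1 := by rw [hπ, map_sub, hx, Derivation.map_algebraMap, sub_zero]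
    have h1 : δ (π ^ (k + n + 1) * u)
        = π ^ (k + n) * (algebraMap ℂ K (k + n + 1 : ℕ) * u + δ u * π) := by
      rw [Derivation.leibniz, Derivation.leibniz_pow, hδ, Nat.add_sub_cancel, smul_eq_mul,
        smul_eq_mul, smul_eq_mul, nsmul_eq_mul, map_natCast]
      ring
    rw [Function.iterate_succ_apply, ← add_assoc, h1]
    refine ih (((P.isUnitAt_const ?_).mul hu).add_isZero
      (hP.1.mul_regular (M.isRegular_derivation_of_ne hx hy hP hb hu.isRegular)))
    exact_mod_cast Nat.succ_ne_zero (k + n)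

theorem exists_isZero_sub_const (M : Model f x y) {P : Place K} {a b : ℂ}
    (hP : P.LiesOver x y a b) {g : K} (hg : P.IsRegular g) :
    ∃ c : ℂ, P.IsZero (g - algebraMap ℂ K c) := by
  obtain ⟨A, B, s, hs, h1⟩ := M.exists_quotient hP hg
  have hsu := isUnitAt_of_nonVan hP hs
  obtain ⟨A', B', rfl, hne⟩ := hs
  refine ⟨(A.eval a + B.eval a * b) / (A'.eval a + B'.eval a * b), ?_⟩
  set c := (A.eval a + B.eval a * b) / (A'.eval a + B'.eval a * b) with hc
  have h2 := isZero_ev_sub hP A B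
  have h3 := isZero_ev_sub hP A' B'
  have h4 := (h2.sub (h3.mul_regular (P.isRegular_const c))).mul_regular hsu.inv.isRegular
  have h5 : A.eval a + B.eval a * b = c * (A'.eval a + B'.eval a * b) := by
    rw [hc, div_mul_cancel₀ _ hne]
  convert! h4 using 1
  rw [← h1, h5, map_mul]
  have := hsu.ne_zero
  field_simp
  ring

/-- Taylor expansion at an unramified point. -/
theorem exists_taylor (M : Model f x y) {P : Place K} {a b : ℂ} (hP : P.LiesOver x y a b)
    (hb : b ≠ 0) {g : K} (hg : P.IsRegular g) (n : ℕ) :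
    ∃ (T : ℂ[X]) (r : K), T.natDegree ≤ n ∧ P.IsRegular r ∧
      g - aeval x T = (x - algebraMap ℂ K a) ^ (n + 1) * r := by
  have hstep : ∀ r : K, P.IsRegular r → ∃ (c : ℂ) (r' : K), P.IsRegular r' ∧
      r = algebraMap ℂ K c + (x - algebraMap ℂ K a) * r' := by
    intro r hr
    obtain ⟨c, hc⟩ := M.exists_isZero_sub_const hP hr
    have hu := M.isUniformizer_unif hP
    rw [unif, if_neg hb] at hu
    obtain ⟨r', hr', h1⟩ := hu.2 _ hc
    exact ⟨c, r', hr', by linear_combination h1⟩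
  induction n with
  | zero =>
    obtain ⟨c, r', hr', h1⟩ := hstep g hg
    refine ⟨C c, r', by simp, hr', ?_⟩
    rw [aeval_C]
    linear_combination h1
  | succ n ih =>
    obtain ⟨T, r, hT, hr, h1⟩ := ih
    obtain ⟨c, r', hr', h2⟩ := hstep r hr
    refine ⟨T + C c * (X - C a) ^ (n + 1), r', ?_, hr', ?_⟩
    · refine natDegree_add_le_of_degree_le (hT.trans (Nat.le_succ n)) ?_
      refine (natDegree_C_mul_le _ _).trans ?_
      rw [natDegree_pow, natDegree_X_sub_C, mul_one]
    · simp only [map_add, map_mul, map_pow, map_sub, aeval_X, aeval_C]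
      rw [pow_succ]
      linear_combination h1 + (x - algebraMap ℂ K a) ^ (n + 1) * h2

theorem hasWeight_two (M : Model f x y) (h1 : f.natDegree ≤ 8) (h2 : 7 ≤ f.natDegree)
    {P : Place K} (hP : P.IsRegular x) {A : Fin 6 → ℂ[X]} {c : Fin 6 → ℂ}
    (hA : ∀ i, (A i).natDegree ≤ 4) {o : Fin 6 → ℤ} (ho : StrictMono o)
    (hord : ∀ i, P.OrdEq (ev x y (A i) (C (c i))) (o i)) {w : ℕ}
    (hw : (w : ℤ) = ∑ i : Fin 6, (o i - (i : ℕ))) : P.HasWeight 2 w := by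
  obtain ⟨a, b, hab⟩ := M.exists_liesOver hP
  exact (M.localGen_omega hP).hasWeight M.isGenerator_omega (M.isUniformizer_unif hab)
    (M.unif_ne_zero a b) (by norm_num) (M.finrank_holoDiff_two h1 h2)
    (fun i => M.smul_mem_holoDiff_two h1 h2 (hA i) (c i)) ho hord hw

theorem hasWeight_unique (M : Model f x y) {P : Place K} (hP : P.IsRegular x) {q w w' : ℕ}
    (hw : P.HasWeight q w) (hw' : P.HasWeight q w') : w = w' := by
  obtain ⟨a, b, hab⟩ := M.exists_liesOver hP
  exact (M.localGen_omega hP).hasWeight_unique M.isGenerator_omega (M.isUniformizer_unif hab)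
    (M.unif_ne_zero a b) hw hw'

theorem natDegree_X_sub_C_pow_le (a : ℂ) {k : ℕ} (hk : k ≤ 4) : ((X - C a) ^ k).natDegree ≤ 4 := by
  rwa [natDegree_pow, natDegree_X_sub_C, mul_one]

/-- Here y is a uniformizer and x - a has order 2, so the orders are 0, 1, 2, 4, 6, 8 with sum 21 =
15 + 6. -/
theorem hasWeight_branch (M : Model f x y) (h1 : f.natDegree ≤ 8) (h2 : 7 ≤ f.natDegree)
    {P : Place K} {a : ℂ} (hP : P.LiesOver x y a 0) : P.HasWeight 2 6 := by
  have hfa : f.eval a = 0 := by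
    rw [← M.liesOver_sq hP]
    simp
  obtain ⟨f₁, hf⟩ := dvd_iff_isRoot.2 hfa
  have hf₁ : f₁.eval a ≠ 0 := by
    have := M.derivative_eval_ne hfa
    rw [hf] at this
    simpa using this
  have hu := isUnitAt_of_nonVan hP (nonVan_aeval 0 hf₁)
  have hπ := M.isUniformizer_unif hP
  rw [unif, if_pos rfl] at hπ
  have hxa : x - algebraMap ℂ K a = y ^ 2 * (aeval x f₁)⁻¹ := by
    rw [M.eq, hf, map_mul, mul_inv_cancel_right₀ hu.ne_zero]
    simp
  have hord : ∀ k : ℕ, P.OrdEq (ev x y ((X - C a) ^ k) (C 0)) (2 * k : ℕ) := by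
    intro k
    refine ⟨y, (aeval x f₁)⁻¹ ^ k, hπ, hu.inv.pow k, ?_⟩
    simp only [ev, map_pow, map_sub, aeval_X, aeval_C, map_zero, zero_mul, add_zero, zpow_natCast]
    rw [hxa]
    ring
  refine M.hasWeight_two h1 h2 (liesOver_isRegular hP)
    (A := ![(X - C a) ^ 0, 0, (X - C a) ^ 1, (X - C a) ^ 2, (X - C a) ^ 3, (X - C a) ^ 4])
    (c := ![0, 1, 0, 0, 0, 0]) (o := ![(2 * 0 : ℕ), 1, (2 * 1 : ℕ), (2 * 2 : ℕ), (2 * 3 : ℕ),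
      (2 * 4 : ℕ)]) ?_ ?_ ?_ ?_
  · intro i
    fin_cases i
    · exact natDegree_X_sub_C_pow_le a (by norm_num)
    · exact natDegree_zero.le.trans (by norm_num)
    · exact natDegree_X_sub_C_pow_le a (by norm_num)
    · exact natDegree_X_sub_C_pow_le a (by norm_num)
    · exact natDegree_X_sub_C_pow_le a (by norm_num)
    · exact natDegree_X_sub_C_pow_le a (by norm_num)
  · rw [Fin.strictMono_iff_lt_succ]
    intro i
    fin_cases i <;> decide
  · intro i
    fin_cases i
    · exact hord 0
    · refine ⟨y, 1, hπ, by simp [Place.IsUnitAt], ?_⟩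
      simp [ev]
    · exact hord 1
    · exact hord 2
    · exact hord 3
    · exact hord 4
  · simp [Fin.sum_univ_succ]

/-- The powers of x - a take the orders 0, …, 4, and y - T(x), with T the Taylor polynomial of
degree at most 4, has some order l + 5. The weight is l, and differentiating five times identifies l
with the multiplicity of a in N₅. -/
theorem hasWeight_of_ne (M : Model f x y) (h1 : f.natDegree ≤ 8) (h2 : 7 ≤ f.natDegree)
    {P : Place K} {a b : ℂ} (hP : P.LiesOver x y a b) (hb : b ≠ 0) {r : ℕ} {D : ℂ[X]}
    (hD : derivNum f 5 = (X - C a) ^ r * D) (hDa : D.eval a ≠ 0) : P.HasWeight 2 r := by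
  have hπ := M.isUniformizer_unif hP
  have h0 := M.unif_ne_zero a b
  rw [unif, if_neg hb] at hπ h0
  set π := x - algebraMap ℂ K a with hπdef
  have hyu : P.IsUnitAt y := isUnitAt_of_nonVan hP ⟨0, 1, by simp [ev], by simpa using hb⟩
  obtain ⟨T, s, hT, hs, h3⟩ := M.exists_taylor hP hb hyu.isRegular 4
  obtain ⟨δ, hx, hy, -⟩ := M.exists_derivation
  have hev : ev x y (-T) (C 1) = y - aeval x T := by
    simp only [ev, map_neg, map_one]
    ring
  have hne : y - aeval x T ≠ 0 := by
    rw [← hev]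
    intro h
    have := (M.indep h).2
    simp at this
  obtain ⟨k, u, hu, h4⟩ := M.exists_zpow_unit hP hne
  rw [unif, if_neg hb] at h4
  have hk : 5 ≤ k := by
    have h5 : P.IsRegular (π ^ (k - 5) * u) := by
      have h6 : π ^ (k - 5) * u = s := by
        apply mul_left_cancel₀ (pow_ne_zero 5 h0)
        rw [← h3, h4, ← mul_assoc, ← zpow_natCast, ← zpow_add₀ h0]
        congr 2
        push_cast
        ring
      rw [h6]
      exact hs
    rw [isRegular_zpow_mul_iff hπ.1 h0 hu] at h5
    omega
  obtain ⟨l, rfl⟩ : ∃ l : ℕ, k = (l + 5 : ℕ) := ⟨(k - 5).toNat, by omega⟩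
  obtain ⟨u', hu', h5⟩ := M.iterate_derivation_zpow_mul hx hy hP hb hu l 5
  -- Five differentiations kill T, whose degree is at most 4.
  have h6 : δ^[5] (y - aeval x T) = δ^[5] y := by
    have h7 : ∀ (n : ℕ) (g : K), δ^[n] (g - aeval x T)
        = δ^[n] g - aeval x (derivative^[n] T) := by
      intro n g
      induction n with
      | zero => rfl
      | succ n ih =>
        rw [Function.iterate_succ_apply', Function.iterate_succ_apply', ih, map_sub,
          Derivation.map_aeval, hx, smul_eq_mul, mul_one, Function.iterate_succ_apply']
    rw [h7, iterate_derivative_eq_zero (by omega), map_zero, sub_zero]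
  -- Both sides of d⁵y/dx⁵ · (2y²)⁵ = N₅(x) y are compared at P, where 2 and y are units.
  have hl : l = r := by
    have h7 := M.iterate_derivation_y hx hy 5
    rw [← h6, h4, zpow_natCast, h5, hD, map_mul, map_pow, map_sub, aeval_X, aeval_C] at h7
    have hDu := isUnitAt_of_nonVan hP (nonVan_aeval b hDa)
    have h2u : P.IsUnitAt (2 * y ^ 2) := by
      have : P.IsUnitAt (algebraMap ℂ K 2) := P.isUnitAt_const two_ne_zero
      rw [map_ofNat] at this
      exact this.mul (hyu.pow 2)
    have h8 := congrArg P.ring.valuation h7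
    simp only [map_mul, map_pow] at h8
    rw [hu'.val, hDu.val, hyu.val] at h8
    have h9 : P.ring.valuation 2 = 1 := by
      have := h2u.val
      rwa [map_mul, map_pow, hyu.val, one_pow, mul_one] at this
    rw [h9] at h8
    simp only [one_pow, mul_one] at h8
    have h10 := Place.valuation_zpow_inj hπ.1 h0 (m := l) (n := r) (by
      rw [zpow_natCast, zpow_natCast]
      exact h8)
    exact_mod_cast h10
  subst hl
  have hord : ∀ k : ℕ, P.OrdEq (ev x y ((X - C a) ^ k) (C 0)) k := by
    intro k
    refine ⟨π, 1, hπ, by simp [Place.IsUnitAt], ?_⟩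
    simp [ev, hπdef]
  refine M.hasWeight_two h1 h2 (liesOver_isRegular hP)
    (A := ![(X - C a) ^ 0, (X - C a) ^ 1, (X - C a) ^ 2, (X - C a) ^ 3, (X - C a) ^ 4, -T])
    (c := ![0, 0, 0, 0, 0, 1]) (o := ![(0 : ℕ), (1 : ℕ), (2 : ℕ), (3 : ℕ), (4 : ℕ), (l + 5 : ℕ)])
    ?_ ?_ ?_ ?_
  · intro i
    fin_cases i
    · exact natDegree_X_sub_C_pow_le a (by norm_num)
    · exact natDegree_X_sub_C_pow_le a (by norm_num)
    · exact natDegree_X_sub_C_pow_le a (by norm_num)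
    · exact natDegree_X_sub_C_pow_le a (by norm_num)
    · exact natDegree_X_sub_C_pow_le a (by norm_num)
    · exact (natDegree_neg T).le.trans hT
  · rw [Fin.strictMono_iff_lt_succ]
    intro i
    fin_cases i
    · exact Nat.cast_lt.2 (by norm_num)
    · exact Nat.cast_lt.2 (by norm_num)
    · exact Nat.cast_lt.2 (by norm_num)
    · exact Nat.cast_lt.2 (by norm_num)
    · exact Nat.cast_lt.2 (by omega)
  · intro i
    fin_cases i
    · exact hord 0
    · exact hord 1
    · exact hord 2
    · exact hord 3
    · exact hord 4
    · exact ⟨π, u, hπ, hu, hev.trans h4⟩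
  · simp [Fin.sum_univ_succ]
    ring

end Model

end

/-! ### The fifth derivative for the octic, multiplicities and point counts -/

section

/-- The factor of the fifth derivative whose roots are the `x⁴` of the generic points of positive
weight. -/
def quartic (t : ℂ) : ℂ[X] :=
  C (7 * t ^ 2) * X ^ 4 - C (18 * t ^ 2) * X ^ 3 + C (3 * t ^ 2 - 98 * t) * X ^ 2
    - C (18 * t) * X + C 7

/-- The shape x³ G(x⁴) reflects the symmetry x ↦ ix, y ↦ y, under which d⁵/dx⁵ is multiplied by
i^(-5) = i³. -/
theorem derivNum_octic (t : ℂ) : derivNum (octic t) 5 = C (3840 * t * (4 - t)) * X ^ 3 *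
    expand ℂ 4 ((1 - C t * X ^ 2) * quartic t) := by
  have hd : derivative (octic t) = 8 * C t * X ^ 7 + 4 * C t * X ^ 3 := by
    simp [octic, map_ofNat]
    ring
  have h1 : derivNum (octic t) 1 = 8 * C t * X ^ 7 + 4 * C t * X ^ 3 := by
    rw [derivNum, hd]
    simp [derivNum]
  have h2 : derivNum (octic t) 2 = 24 * C t * X ^ 2 + 112 * C t * X ^ 6 + 8 * C t ^ 2 * X ^ 6
      + 72 * C t ^ 2 * X ^ 10 + 48 * C t ^ 2 * X ^ 14 := by
    rw [derivNum, hd, h1, octic]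
    simp [derivative_pow, map_ofNat]
    ring
  have h3 : derivNum (octic t) 3 = 96 * C t * X + 1344 * C t * X ^ 5 - 96 * C t ^ 2 * X ^ 5
      + 960 * C t ^ 2 * X ^ 9 + 480 * C t ^ 3 * X ^ 13 + 480 * C t ^ 3 * X ^ 17
      + 192 * C t ^ 3 * X ^ 21 := by
    rw [derivNum, hd, h2, octic]
    simp [derivative_pow, map_ofNat]
    ring
  have h4 : derivNum (octic t) 4 = 192 * C t + 13440 * C t * X ^ 4 - 2688 * C t ^ 2 * X ^ 4
      + 192 * C t ^ 2 * X ^ 8 + 960 * C t ^ 3 * X ^ 8 - 40320 * C t ^ 2 * X ^ 12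
      + 13440 * C t ^ 3 * X ^ 12 - 4800 * C t ^ 3 * X ^ 16 + 2880 * C t ^ 4 * X ^ 16
      + 8064 * C t ^ 3 * X ^ 20 + 1344 * C t ^ 4 * X ^ 24 + 384 * C t ^ 4 * X ^ 28 := by
    rw [derivNum, hd, h3, octic]
    simp [derivative_pow, map_ofNat]
    ring
  rw [derivNum, hd, h4, octic, quartic]
  simp [map_ofNat, derivative_pow]
  ring

/-- All roots of `p` are simple. -/
def SimpleRoots (p : ℂ[X]) : Prop := ∀ a, p.eval a = 0 → p.derivative.eval a ≠ 0

theorem SimpleRoots.ne_zero {p : ℂ[X]} (h : SimpleRoots p) : p ≠ 0 := by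
  rintro rfl
  exact h 0 (by simp) (by simp)

theorem SimpleRoots.squarefree {p : ℂ[X]} (h : SimpleRoots p) : Squarefree p := by
  intro q hq
  have hq0 : q ≠ 0 := by
    rintro rfl
    rw [zero_mul, zero_dvd_iff] at hq
    exact h.ne_zero hq
  by_contra hu
  obtain ⟨a, ha⟩ := IsAlgClosed.exists_root q (fun hd => hu (isUnit_iff_degree_eq_zero.2 hd))
  obtain ⟨r, rfl⟩ := dvd_iff_isRoot.2 ha
  obtain ⟨s, hs⟩ := hq
  refine h a ?_ ?_
  · rw [hs]; simp
  · rw [hs]; simp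

theorem SimpleRoots.mul {p q : ℂ[X]} (hp : SimpleRoots p) (hq : SimpleRoots q)
    (h : ∀ a, p.eval a = 0 → q.eval a ≠ 0) : SimpleRoots (p * q) := by
  intro a ha
  rw [eval_mul, mul_eq_zero] at ha
  rw [derivative_mul, eval_add, eval_mul, eval_mul]
  rcases ha with ha | ha
  · rw [ha, zero_mul, add_zero]
    exact mul_ne_zero (hp a ha) (h a ha)
  · have hpa : p.eval a ≠ 0 := fun h' => h a h' ha
    rw [ha, mul_zero, zero_add]
    exact mul_ne_zero hpa (hq a ha)

/-- The map x ↦ xⁿ is unramified away from 0, and 0 is not a root of p. -/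
theorem SimpleRoots.X_mul_expand {p : ℂ[X]} (hp : SimpleRoots p) (h0 : p.eval 0 ≠ 0) {n : ℕ}
    (hn : n ≠ 0) : SimpleRoots (X * expand ℂ n p) := by
  intro a ha
  rw [eval_mul, eval_X, expand_eval] at ha
  rw [derivative_mul, derivative_X, one_mul, eval_add, eval_mul, eval_X, derivative_expand,
    eval_mul, expand_eval, expand_eval]
  by_cases ha0 : a = 0
  · subst ha0
    rw [zero_mul, add_zero, zero_pow hn]
    exact h0
  · have h1 : p.eval (a ^ n) = 0 := (mul_eq_zero.1 ha).resolve_left ha0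
    rw [h1, zero_add]
    simp only [eval_mul, eval_pow, eval_X, eval_natCast]
    exact mul_ne_zero ha0 (mul_ne_zero (hp _ h1)
      (mul_ne_zero (Nat.cast_ne_zero.2 hn) (pow_ne_zero _ ha0)))

theorem eval_ne_zero_of_squarefree {p r : ℂ[X]} {a : ℂ} (hp : Squarefree p)
    (h : p = (X - C a) * r) : r.eval a ≠ 0 := by
  intro h0
  obtain ⟨s, rfl⟩ := dvd_iff_isRoot.2 h0
  have hu := hp (X - C a) ⟨s, by rw [h, mul_assoc]⟩
  have := natDegree_eq_zero_of_isUnit hu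
  rw [natDegree_X_sub_C] at this
  exact one_ne_zero this

/-- The order of vanishing of `g₁ g₂² g₃³` at a root of `g_r`. -/
theorem exists_multiplicity {N g₁ g₂ g₃ : ℂ[X]} {c : ℂ} (hc : c ≠ 0)
    (hN : N = C c * (g₁ * g₂ ^ 2 * g₃ ^ 3)) (hg : Squarefree (g₁ * g₂ * g₃)) (a : ℂ) :
    ∃ (r : ℕ) (D : ℂ[X]), N = (X - C a) ^ r * D ∧ D.eval a ≠ 0 ∧
      (r = 1 ↔ g₁.eval a = 0) ∧ (r = 2 ↔ g₂.eval a = 0) ∧ (r = 3 ↔ g₃.eval a = 0) := by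
  by_cases h1 : g₁.eval a = 0
  · obtain ⟨h, rfl⟩ := dvd_iff_isRoot.2 h1
    have := eval_ne_zero_of_squarefree (r := h * g₂ * g₃) (a := a) hg (by ring)
    simp only [eval_mul, mul_ne_zero_iff] at this
    refine ⟨1, C c * (h * g₂ ^ 2 * g₃ ^ 3), by rw [hN]; ring, ?_, ?_⟩ <;> simp [this, hc]
  by_cases h2 : g₂.eval a = 0
  · obtain ⟨h, rfl⟩ := dvd_iff_isRoot.2 h2
    have := eval_ne_zero_of_squarefree (r := g₁ * h * g₃) (a := a) hg (by ring)
    simp only [eval_mul, mul_ne_zero_iff] at this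
    refine ⟨2, C c * (g₁ * h ^ 2 * g₃ ^ 3), by rw [hN]; ring, ?_, ?_⟩ <;> simp [this, hc]
  by_cases h3 : g₃.eval a = 0
  · obtain ⟨h, rfl⟩ := dvd_iff_isRoot.2 h3
    have := eval_ne_zero_of_squarefree (r := g₁ * g₂ * h) (a := a) hg (by ring)
    simp only [eval_mul, mul_ne_zero_iff] at this
    refine ⟨3, C c * (g₁ * g₂ ^ 2 * h ^ 3), by rw [hN]; ring, ?_, ?_⟩ <;> simp [this, hc]
  · exact ⟨0, N, by simp, by simp [hN, hc, h1, h2, h3], by simp [h1, h2, h3]⟩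

variable {K : Type u} [Field K] [Algebra ℂ K]

namespace Model

variable {f : ℂ[X]} {x y : K}

theorem liesOver_coord {P : Place K} {a b a' b' : ℂ} (h : P.LiesOver x y a b)
    (h' : P.LiesOver x y a' b') : a = a' ∧ b = b' := by
  have h1 := h'.1.sub h.1
  have h2 := h'.2.sub h.2
  rw [sub_sub_sub_cancel_left, ← map_sub, Place.isZero_const_iff] at h1 h2
  exact ⟨sub_eq_zero.1 h1, sub_eq_zero.1 h2⟩

/-- The number of affine points over the roots of `g`. -/
theorem encard_liesOver (M : Model f x y) {g : ℂ[X]} (hg : Squarefree g)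
    (hgf : ∀ a, g.eval a = 0 → f.eval a ≠ 0) :
    Set.encard {P : Place K | ∃ a b, P.LiesOver x y a b ∧ g.eval a = 0}
      = (2 * g.natDegree : ℕ) := by
  classical
  -- The points over a are (a, ±s(a)), indexed by a sign; they are distinct because f(a) ≠ 0 at the
  -- roots of g.
  choose s hs using fun a : ℂ => IsAlgClosed.exists_pow_nat_eq (f.eval a) (n := 2) (by norm_num)
  have hs' : ∀ (a : ℂ) (ε : ℤˣ), ((ε : ℤ) * s a : ℂ) ^ 2 = f.eval a := by
    intro a ε
    rw [mul_pow, hs, ← Int.cast_pow, ← Units.val_pow_eq_pow_val, Int.units_sq]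
    simp
  choose p hp using fun q : ℂ × ℤˣ => M.exists_place (hs' q.1 q.2)
  have hset : {P : Place K | ∃ a b, P.LiesOver x y a b ∧ g.eval a = 0}
      = p '' ((g.roots.toFinset ×ˢ (Finset.univ : Finset ℤˣ) : Finset (ℂ × ℤˣ)) : Set (ℂ × ℤˣ)) := by
    ext P
    constructor
    · rintro ⟨a, b, hP, ha⟩
      have h1 : b ^ 2 = s a ^ 2 := by rw [hs, M.liesOver_sq hP]
      have h2 : ∃ ε : ℤˣ, b = (ε : ℤ) * s a := by
        rcases sq_eq_sq_iff_eq_or_eq_neg.1 h1 with h | h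
        · exact ⟨1, by simp [h]⟩
        · exact ⟨-1, by simp [h]⟩
      obtain ⟨ε, rfl⟩ := h2
      refine ⟨(a, ε), ?_, M.liesOver_unique (hp (a, ε)) hP⟩
      simp [hg.ne_zero, ha, Int.units_eq_one_or ε]
    · rintro ⟨⟨a, ε⟩, ha, rfl⟩
      refine ⟨a, _, hp (a, ε), ?_⟩
      have : (g ≠ 0 ∧ g.eval a = 0) ∧ (ε = 1 ∨ ε = -1) := by simpa using ha
      exact this.1.2
  have hinj : Set.InjOn p ((g.roots.toFinset ×ˢ (Finset.univ : Finset ℤˣ) : Finset (ℂ × ℤˣ)) :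
      Set (ℂ × ℤˣ)) := by
    rintro ⟨a, ε⟩ ha ⟨a', ε'⟩ - h
    have h1 := hp (a, ε)
    rw [h] at h1
    obtain ⟨h2, h3⟩ := liesOver_coord h1 (hp (a', ε'))
    simp only at h2 h3
    subst h2
    have hga : (g ≠ 0 ∧ g.eval a = 0) ∧ (ε = 1 ∨ ε = -1) := by simpa using ha
    have hsa : s a ≠ 0 := by
      intro h0
      apply hgf a hga.1.2
      rw [← hs, h0]
      simp
    have h4 := mul_right_cancel₀ hsa h3
    simp only [Int.cast_inj, Units.val_inj] at h4
    rw [h4]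
  have hsep : g.Separable := PerfectField.separable_iff_squarefree.2 hg
  rw [hset, hinj.encard_image, Set.encard_coe_eq_coe_finsetCard, Finset.card_product,
    Multiset.toFinset_card_of_nodup (nodup_roots hsep),
    splits_iff_card_roots.1 (IsAlgClosed.splits g), Finset.card_univ, Fintype.card_units_int, mul_comm]

/-- Scaling of the coordinates. -/
theorem rescale (M : Model f x y) {c d : ℂ} (hc : c ≠ 0) (hd : d ≠ 0) {f' : ℂ[X]}
    (hf' : C (d ^ 2) * f' = f.comp (C c * X)) {x' y' : K} (hx : x = algebraMap ℂ K c * x')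
    (hy : y = algebraMap ℂ K d * y') : Model f' x' y' := by
  have hcomp : ∀ A : ℂ[X], aeval x A = aeval x' (A.comp (C c * X)) := by
    intro A
    rw [aeval_comp, map_mul, aeval_C, aeval_X, hx]
  have hback : ∀ A : ℂ[X], (A.comp (C c⁻¹ * X)).comp (C c * X) = A := by
    intro A
    rw [comp_assoc]
    simp [← mul_assoc, ← C_mul, inv_mul_cancel₀ hc]
  have hdeg : ∀ (A : ℂ[X]) (e : ℂ), e ≠ 0 → (A.comp (C e * X)).natDegree = A.natDegree := by
    intro A e he
    rw [natDegree_comp, natDegree_C_mul_X _ he, mul_one]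
  have hdK : algebraMap ℂ K d ≠ 0 := by simpa using hd
  have hd2 : C (d ^ 2) ≠ 0 := by simpa using hd
  have hff : f' = C (d ^ 2)⁻¹ * f.comp (C c * X) := by
    rw [← hf', ← mul_assoc, ← C_mul, inv_mul_cancel₀ (pow_ne_zero 2 hd), C_1, one_mul]
  refine ⟨?_, ?_, ?_, ?_, ?_⟩
  · rintro p ⟨q, hq⟩
    have h1 : f = p.comp (C c⁻¹ * X) * p.comp (C c⁻¹ * X) * (C (d ^ 2) * q).comp (C c⁻¹ * X) := by
      rw [← mul_comp, ← mul_comp, show p * p * (C (d ^ 2) * q) = C (d ^ 2) * f' by rw [hq]; ring, hf',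
        comp_assoc]
      simp [← mul_assoc, ← C_mul, mul_inv_cancel₀ hc]
    have hu := M.sqf _ ⟨_, h1⟩
    have h2 := natDegree_eq_zero_of_isUnit hu
    rw [hdeg _ _ (inv_ne_zero hc)] at h2
    obtain ⟨e, rfl⟩ := natDegree_eq_zero.1 h2
    rw [C_comp] at hu
    exact hu
  · rw [hff, natDegree_C_mul (inv_ne_zero (pow_ne_zero 2 hd)), hdeg _ _ hc]
    exact M.deg
  · intro h
    apply M.trans
    rw [hx]
    exact (isAlgebraic_algebraMap c).mul h
  · have h1 := congrArg (aeval x') hf'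
    rw [← hcomp, ← M.eq, hy, map_mul, aeval_C, map_pow, mul_pow] at h1
    exact (mul_left_cancel₀ (pow_ne_zero 2 hdK) h1).symm
  · intro h
    obtain ⟨A, B, D, hD, h1⟩ := M.gen h
    refine ⟨A.comp (C c * X), C d * B.comp (C c * X), D.comp (C c * X), ?_, ?_⟩
    · intro h0
      apply aeval_ne_zero M.trans hD
      rw [hcomp, h0, map_zero]
    · rw [← hcomp, h1, ev, ev, ← hcomp, map_mul, aeval_C, ← hcomp, hy]
      ring

end Model

end

/-! ### The table of weights for C_t -/

section

variable {K : Type u} [Field K] [Algebra ℂ K]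

theorem derivNum_octic_eval_zero_ne {t : ℂ} (h0 : t ≠ 0) (h4 : t ≠ 4) :
    (C (3840 * t * (4 - t)) * expand ℂ 4 ((1 - C t * X ^ 2) * quartic t)).eval 0 ≠ 0 := by
  have h4' : 4 - t ≠ 0 := sub_ne_zero.2 h4.symm
  simp [quartic, h0, h4']

namespace Model

variable {t : ℂ} {x y : K}

/-- The symmetry exchanging the points over `0` and `∞`. -/
theorem exists_recip_octic (M : Model (octic t) x y) (h0 : t ≠ 0) (h4 : t ≠ 4) :
    ∃ (x' y' : K) (κ : ℂ), κ ≠ 0 ∧ x⁻¹ = algebraMap ℂ K κ * x' ∧ Model (octic t) x' y' := by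
  have hdeg := octic_natDegree ⟨t, h0, h4⟩
  simp only at hdeg
  have M' := M.recip (m := 4) (by omega) (by omega)
  -- The reflected polynomial is X⁸ + tX⁴ + t. Substituting κX with κ⁴ = t turns it into t times the
  -- octic, and t = (κ²)² is absorbed into y.
  obtain ⟨κ, hκ⟩ := IsAlgClosed.exists_pow_nat_eq t (n := 4) (by norm_num)
  have hκ0 : κ ≠ 0 := by
    rintro rfl
    apply h0
    rw [← hκ]
    simp
  have hκK : algebraMap ℂ K κ ≠ 0 := by simpa using hκ0
  have hr : reflect (2 * 4) (octic t) = C t + C t * X ^ 4 + X ^ 8 := by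
    have h1 : (1 : ℂ[X]) = C 1 := C_1.symm
    rw [octic, reflect_add, reflect_add, reflect_C_mul_X_pow, reflect_C_mul_X_pow, h1, reflect_C,
      revAt_le (by norm_num), revAt_le (by norm_num)]
    simp
  rw [hr] at M'
  refine ⟨(algebraMap ℂ K κ)⁻¹ * x⁻¹, (algebraMap ℂ K (κ ^ 2))⁻¹ * (y * x⁻¹ ^ 4), κ, hκ0, ?_,
    M'.rescale hκ0 (pow_ne_zero 2 hκ0) ?_ ?_ ?_⟩
  · rw [mul_inv_cancel_left₀ hκK]
  · rw [← pow_mul, hκ, octic]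
    simp only [add_comp, mul_comp, C_comp, X_pow_comp, mul_pow, ← C_pow]
    rw [show κ ^ 8 = t ^ 2 by rw [← hκ]; ring, hκ, C_pow]
    ring
  · rw [mul_inv_cancel_left₀ hκK]
  · rw [mul_inv_cancel_left₀ (by simpa using hκ0)]

theorem hasWeight_zero (M : Model (octic t) x y) (h0 : t ≠ 0) (h4 : t ≠ 4) {P : Place K} {b : ℂ}
    (hP : P.LiesOver x y 0 b) : P.HasWeight 2 3 := by
  have hdeg := octic_natDegree ⟨t, h0, h4⟩
  simp only at hdeg
  have hb : b ≠ 0 := by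
    rintro rfl
    have := M.liesOver_sq hP
    simp [octic] at this
  refine M.hasWeight_of_ne (by omega) (by omega) hP hb ?_ (derivNum_octic_eval_zero_ne h0 h4)
  rw [derivNum_octic]
  simp only [map_zero, sub_zero]
  ring

theorem pole_iff {κ : ℂ} (hκ : κ ≠ 0) {x' y' : K} (M' : Model (octic t) x' y')
    (hx0 : x ≠ 0) (hx : x⁻¹ = algebraMap ℂ K κ * x') (P : Place K) :
    ¬ P.IsRegular x ↔ ∃ a b, P.LiesOver x' y' a b ∧ (X : ℂ[X]).eval a = 0 := by
  have hu := P.isUnitAt_const hκ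
  have hx' : x' = (algebraMap ℂ K κ)⁻¹ * x⁻¹ := by
    rw [hx, inv_mul_cancel_left₀ hu.ne_zero]
  simp only [eval_X]
  constructor
  · intro h
    have h1 := Place.isZero_inv_of_not h
    have h2 : P.IsZero x' := by
      rw [hx']
      exact h1.mul_regular hu.inv.isRegular
    obtain ⟨a, b, hab⟩ := M'.exists_liesOver h2.isRegular
    have h3 := h2.sub hab.1
    rw [sub_sub_cancel, Place.isZero_const_iff] at h3
    exact ⟨a, b, hab, h3⟩
  · rintro ⟨a, b, hab, rfl⟩ h
    have h1 := hab.1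
    rw [map_zero, sub_zero] at h1
    have h2 := (h1.mul_regular hu.isRegular).mul_regular h
    rw [← hx, mul_inv_cancel₀ hx0] at h2
    simp [Place.IsZero] at h2

theorem encard_poles (M : Model (octic t) x y) (h0 : t ≠ 0) (h4 : t ≠ 4) :
    Set.encard {P : Place K | ¬ P.IsRegular x} = 2 := by
  obtain ⟨x', y', κ, hκ, hx, M'⟩ := M.exists_recip_octic h0 h4
  simp only [pole_iff hκ M' M.x_ne_zero hx]
  rw [M'.encard_liesOver (prime_X.squarefree)]
  · simp
  · intro a ha
    rw [eval_X] at ha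
    simp [ha, octic]

theorem hasWeight_pole (M : Model (octic t) x y) (h0 : t ≠ 0) (h4 : t ≠ 4) {P : Place K}
    (hP : ¬ P.IsRegular x) : P.HasWeight 2 3 := by
  obtain ⟨x', y', κ, hκ, hx, M'⟩ := M.exists_recip_octic h0 h4
  obtain ⟨a, b, hab, ha⟩ := (pole_iff hκ M' M.x_ne_zero hx P).1 hP
  rw [eval_X] at ha
  subst ha
  exact M'.hasWeight_zero h0 h4 hab

theorem hasWeight_pole_unique (M : Model (octic t) x y) (h0 : t ≠ 0) (h4 : t ≠ 4) {P : Place K}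
    (hP : ¬ P.IsRegular x) {r : ℕ} (h : P.HasWeight 2 r) : r = 3 := by
  obtain ⟨x', y', κ, hκ, hx, M'⟩ := M.exists_recip_octic h0 h4
  obtain ⟨a, b, hab, -⟩ := (pole_iff hκ M' M.x_ne_zero hx P).1 hP
  exact M'.hasWeight_unique (liesOver_isRegular hab) h (M.hasWeight_pole h0 h4 hP)

/-- The numbers of points of given weight, in terms of the factorization of the fifth derivative
of `y`. -/
theorem numWeight_eq (M : Model (octic t) x y) (h0 : t ≠ 0) (h4 : t ≠ 4) {g₁ g₂ g₃ : ℂ[X]} {c : ℂ}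
    (hc : c ≠ 0) (hN : derivNum (octic t) 5 = C c * (g₁ * g₂ ^ 2 * g₃ ^ 3))
    (hg : Squarefree (g₁ * g₂ * g₃)) :
    numWeight K 1 = (2 * g₁.natDegree : ℕ) ∧ numWeight K 2 = (2 * g₂.natDegree : ℕ) ∧
      numWeight K 3 = (2 * g₃.natDegree + 2 : ℕ) := by
  have hdeg := octic_natDegree ⟨t, h0, h4⟩
  simp only at hdeg
  have key : ∀ (P : Place K) (a b : ℂ), P.LiesOver x y a b →
      ∃ w, P.HasWeight 2 w ∧ (w = 1 ↔ g₁.eval a = 0) ∧ (w = 2 ↔ g₂.eval a = 0) ∧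
        (w = 3 ↔ g₃.eval a = 0) := by
    intro P a b hP
    obtain ⟨r, D, hD, hDa, hr⟩ := exists_multiplicity hc hN hg a
    by_cases hb : b = 0
    · subst hb
      have hfa : (octic t).eval a = 0 := by
        rw [← M.liesOver_sq hP]
        simp
      have hNa := derivNum_eval_ne_zero hfa (M.derivative_eval_ne hfa) 5
      rw [hN] at hNa
      simp only [eval_mul, eval_pow, eval_C, mul_ne_zero_iff, ne_eq, pow_eq_zero_iff,
        OfNat.ofNat_ne_zero, not_false_iff] at hNa
      -- Weight 6 is none of 1, 2, 3, in agreement with no gᵢ vanishing at a branch point.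
      refine ⟨6, M.hasWeight_branch (by omega) (by omega) hP, ?_, ?_, ?_⟩ <;> simp [hNa]
    · exact ⟨r, M.hasWeight_of_ne (by omega) (by omega) hP hb hD hDa, hr⟩
  have haff : ∀ (P : Place K) (r : ℕ) (g : ℂ[X]), P.IsRegular x →
      (∀ a b w, P.LiesOver x y a b → P.HasWeight 2 w → (w = r ↔ g.eval a = 0)) →
      (P.HasWeight 2 r ↔ ∃ a b, P.LiesOver x y a b ∧ g.eval a = 0) := by
    intro P r g hP hr
    constructor
    · intro hw
      obtain ⟨a, b, hab⟩ := M.exists_liesOver hP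
      exact ⟨a, b, hab, (hr a b r hab hw).1 rfl⟩
    · rintro ⟨a, b, hab, ha⟩
      obtain ⟨w, hw, -⟩ := key P a b hab
      rwa [(hr a b w hab hw).2 ha] at hw
  have hkey : ∀ (P : Place K) a b w, P.LiesOver x y a b → P.HasWeight 2 w →
      (w = 1 ↔ g₁.eval a = 0) ∧ (w = 2 ↔ g₂.eval a = 0) ∧ (w = 3 ↔ g₃.eval a = 0) := by
    intro P a b w hab hw
    obtain ⟨w', hw', h⟩ := key P a b hab
    rwa [M.hasWeight_unique (liesOver_isRegular hab) hw hw']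
  have hroot : ∀ g : ℂ[X], (∀ a, g.eval a = 0 → (derivNum (octic t) 5).eval a = 0) →
      ∀ a, g.eval a = 0 → (octic t).eval a ≠ 0 := fun g h a ha hfa =>
    derivNum_eval_ne_zero hfa (M.derivative_eval_ne hfa) 5 (h a ha)
  have hlow : ∀ (r : ℕ) (g : ℂ[X]), r ≠ 3 → Squarefree g →
      (∀ a, g.eval a = 0 → (derivNum (octic t) 5).eval a = 0) →
      (∀ (P : Place K) a b w, P.LiesOver x y a b → P.HasWeight 2 w → (w = r ↔ g.eval a = 0)) →
      numWeight K r = (2 * g.natDegree : ℕ) := by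
    intro r g hr3 hsq hgN hr
    rw [numWeight, ← M.encard_liesOver hsq (hroot g hgN)]
    congr 1
    ext P
    by_cases hP : P.IsRegular x
    · exact haff P r g hP (hr P)
    · refine ⟨fun hw => absurd (M.hasWeight_pole_unique h0 h4 hP hw) hr3, ?_⟩
      rintro ⟨a, b, hab, -⟩
      exact absurd (liesOver_isRegular hab) hP
  have hg₁ : Squarefree g₁ := hg.squarefree_of_dvd ((dvd_mul_right g₁ g₂).mul_right g₃)
  have hg₂ : Squarefree g₂ := hg.squarefree_of_dvd ((dvd_mul_left g₂ g₁).mul_right g₃)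
  have hg₃ : Squarefree g₃ := hg.squarefree_of_dvd (dvd_mul_left g₃ (g₁ * g₂))
  refine ⟨hlow 1 g₁ (by norm_num) hg₁ (fun a ha => by simp [hN, ha])
      fun P a b w h hw => (hkey P a b w h hw).1,
    hlow 2 g₂ (by norm_num) hg₂ (fun a ha => by simp [hN, ha])
      fun P a b w h hw => (hkey P a b w h hw).2.1, ?_⟩
  -- The two poles of x also have weight 3; they account for the summand 2.
  have hset : {P : Place K | P.HasWeight 2 3} =
      {P : Place K | ∃ a b, P.LiesOver x y a b ∧ g₃.eval a = 0} ∪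
        {P : Place K | ¬ P.IsRegular x} := by
    ext P
    by_cases hP : P.IsRegular x
    · simpa [hP] using haff P 3 g₃ hP fun a b w h hw => (hkey P a b w h hw).2.2
    · simpa [hP] using M.hasWeight_pole h0 h4 hP
  have hdisj : Disjoint {P : Place K | ∃ a b, P.LiesOver x y a b ∧ g₃.eval a = 0}
      {P : Place K | ¬ P.IsRegular x} := by
    rw [Set.disjoint_left]
    rintro P ⟨a, b, hab, -⟩ h
    exact h (liesOver_isRegular hab)
  rw [numWeight, hset, Set.encard_union_eq hdisj, M.encard_poles h0 h4,
    M.encard_liesOver hg₃ (hroot g₃ fun a ha => by simp [hN, ha])]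
  norm_cast

theorem squarefree_X_mul_expand {p : ℂ[X]} (hp : SimpleRoots p) (h0 : p.eval 0 ≠ 0) :
    Squarefree (X * expand ℂ 4 p) :=
  (hp.X_mul_expand h0 (by norm_num)).squarefree

theorem natDegree_expand_four {p : ℂ[X]} {n : ℕ} (h : p.natDegree = n) :
    (expand ℂ 4 p).natDegree = n * 4 := by
  rw [natDegree_expand, h]

/-- At t = 196 the root 1/14 of 1 - 196X² is also a double root of the quartic, so it is a triple
root of G. -/
theorem numWeight_special (M : Model (octic 196) x y) :
    numWeight K 1 = 24 ∧ numWeight K 2 = 0 ∧ numWeight K 3 = 12 := by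
  have hp : SimpleRoots (((1 + C 14 * X) * (C 196 * X ^ 2 - C 476 * X + 1)) * (1 - C 14 * X)) := by
    have h1 : SimpleRoots (1 + C 14 * X) := fun a _ => by simp
    have h2 : SimpleRoots (1 - C 14 * X) := fun a _ => by simp
    have h3 : SimpleRoots (C 196 * X ^ 2 - C 476 * X + 1) := by
      intro a h h'
      simp at h h'
      -- For p = 196X² - 476X + 1, the combination 4·196·p - p'² is minus the discriminant 225792.
      have : (1 : ℂ) = 0 := by linear_combination (784 * h - (392 * a - 476) * h') / (-225792)
      exact one_ne_zero this
    refine (h1.mul h3 ?_).mul h2 ?_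
    · intro a h h'
      simp at h h'
      have : (1 : ℂ) = 0 := by linear_combination (h' - (14 * a - 35) * h) / 36
      exact one_ne_zero this
    · intro a h h'
      simp at h h'
      have ha : a = 1 / 14 := by linear_combination -h' / 14
      subst ha
      norm_num at h
  have hN : derivNum (octic 196) 5 = C (3840 * 196 * (4 - 196) * 7) *
      (expand ℂ 4 ((1 + C 14 * X) * (C 196 * X ^ 2 - C 476 * X + 1)) * 1 ^ 2 *
        (X * expand ℂ 4 (1 - C 14 * X)) ^ 3) := by
    have h1 : (1 - C 196 * X ^ 2) * quartic 196 = C 7 * (((1 + C 14 * X) *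
        (C 196 * X ^ 2 - C 476 * X + 1)) * (1 - C 14 * X) ^ 3) := by
      rw [quartic]
      apply Polynomial.funext
      intro a
      simp
      ring
    rw [derivNum_octic, h1, C_mul (a := 3840 * 196 * (4 - 196)), map_mul (expand ℂ 4),
      map_mul (expand ℂ 4), map_pow (expand ℂ 4), expand_C]
    ring
  have h := M.numWeight_eq (by norm_num) (by norm_num) (by norm_num) hN (by
    have := squarefree_X_mul_expand hp (by simp)
    rw [map_mul] at this
    convert this using 1
    ring)
  have hd1 : (expand ℂ 4 ((1 + C 14 * X) * (C 196 * X ^ 2 - C 476 * X + 1))).natDegree = 3 * 4 := by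
    apply natDegree_expand_four
    have : (1 + C 14 * X) * (C 196 * X ^ 2 - C 476 * X + 1)
      = C 2744 * X ^ 3 + C (-6468) * X ^ 2 + C (-462) * X + C (1 : ℂ) := by
      apply Polynomial.funext
      intro a
      simp
      ring
    rw [this]
    exact natDegree_cubic (by norm_num)
  have hd3 : (X * expand ℂ 4 (1 - C 14 * X)).natDegree = 1 * 4 + 1 := by
    have h1 : (1 - C 14 * X : ℂ[X]).natDegree = 1 := by
      compute_degree!
    rw [natDegree_X_mul, natDegree_expand_four h1]
    intro h0
    rw [expand_eq_zero (by norm_num)] at h0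
    rw [h0] at h1
    simp at h1
  rw [hd1, hd3, natDegree_one] at h
  exact h

/-- At t = -196/15 the quartic is 7 times the square of a quadratic polynomial. -/
theorem numWeight_special' (M : Model (octic (-196 / 15)) x y) :
    numWeight K 1 = 16 ∧ numWeight K 2 = 16 ∧ numWeight K 3 = 4 := by
  have h1 : SimpleRoots (C (196 / 15) * X ^ 2 + 1) := by
    intro a h h'
    simp at h h'
    subst h'
    simp at h
  have h2 : SimpleRoots (C (-196 / 15) * X ^ 2 + C (84 / 5) * X + 1) := by
    intro a h h'
    simp at h h'
    have ha : a = 9 / 14 := by linear_combination -15 / 392 * h'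
    subst ha
    norm_num at h
  have hp : SimpleRoots ((C (196 / 15) * X ^ 2 + 1) *
      (C (-196 / 15) * X ^ 2 + C (84 / 5) * X + 1)) := by
    refine h1.mul h2 ?_
    intro a h h'
    simp at h h'
    have ha : a = -5 / 42 := by linear_combination (h + h') * 5 / 84
    subst ha
    norm_num at h
  have hN : derivNum (octic (-196 / 15)) 5 = C (3840 * (-196 / 15) * (4 - (-196 / 15)) * 7) *
      (expand ℂ 4 (C (196 / 15) * X ^ 2 + 1) *
        (expand ℂ 4 (C (-196 / 15) * X ^ 2 + C (84 / 5) * X + 1)) ^ 2 * X ^ 3) := by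
    have h3 : (1 - C (-196 / 15) * X ^ 2) * quartic (-196 / 15) = C 7 * ((C (196 / 15) * X ^ 2 + 1) *
        (C (-196 / 15) * X ^ 2 + C (84 / 5) * X + 1) ^ 2) := by
      rw [quartic]
      apply Polynomial.funext
      intro a
      simp
      ring
    rw [derivNum_octic, h3, C_mul (a := 3840 * (-196 / 15) * (4 - (-196 / 15))),
      map_mul (expand ℂ 4), map_mul (expand ℂ 4), map_pow (expand ℂ 4), expand_C]
    ring
  have h := M.numWeight_eq (by norm_num) (by norm_num) (by norm_num) hN (by
    have := squarefree_X_mul_expand hp (by simp)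
    rw [map_mul] at this
    convert this using 1
    ring)
  have hd1 : (expand ℂ 4 (C (196 / 15) * X ^ 2 + 1)).natDegree = 2 * 4 := by
    apply natDegree_expand_four
    compute_degree!
  have hd2 : (expand ℂ 4 (C (-196 / 15) * X ^ 2 + C (84 / 5) * X + 1)).natDegree = 2 * 4 := by
    apply natDegree_expand_four
    compute_degree!
  rw [hd1, hd2, natDegree_X] at h
  exact h

/-- The quartic q is invariant under X ↦ 1/(tX) up to the factor t²X⁴, and the roots of 1 - tX² are
the fixed points. In terms of S = tX² + 1 it reads 7S² - 18tXS + (3t² - 112t)X², so coincidences of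
roots come down to quadratic equations. -/
theorem simpleRoots_generic (h0 : t ≠ 0) (h4 : t ≠ 4) (h5 : t ≠ 196) (h6 : t ≠ -196 / 15) :
    SimpleRoots ((1 - C t * X ^ 2) * quartic t) := by
  have hcommon : ∀ a, t * a ^ 2 = 1 → (quartic t).eval a ≠ 0 := by
    intro a h h'
    simp [quartic] at h'
    -- Put S = 2 at a fixed point. Squaring and using ta² = 1 gives 144t = (t - 28)², that is (t -
    -- 4)(t - 196) = 0.
    have ha : 12 * (t * a) = t - 28 := by
      linear_combination -h' / 3 + (7 / 3 * (t * a ^ 2) - 6 * t * a + (3 * t - 91) / 3) * h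
    have h7 : (t - 4) * (t - 196) = 0 := by
      linear_combination (-(12 * (t * a)) - (t - 28)) * ha + 144 * t * h
    rcases mul_eq_zero.1 h7 with h8 | h8
    · exact h4 (sub_eq_zero.1 h8)
    · exact h5 (sub_eq_zero.1 h8)
  have h1 : SimpleRoots (1 - C t * X ^ 2) := by
    intro a h h'
    simp [h0] at h h'
    rw [h'] at h
    simp at h
  refine h1.mul ?_ fun a h => hcommon a ?_
  · intro a h h'
    have hq := h
    simp [quartic, derivative_pow] at h h'
    -- The polynomial Xq' - 2q is antisymmetric under the involution, which explains the factor tX²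
    -- - 1. On the other factor S = (9/7)ta, and q becomes -(4/7)a²t(15t + 196).
    have h7 : (14 * (t * a ^ 2 + 1) - 18 * t * a) * (t * a ^ 2 - 1) = 0 := by
      linear_combination a * h' - 2 * h
    rcases mul_eq_zero.1 h7 with h8 | h8
    · have h9 : a ^ 2 * t * (15 * t + 196) = 0 := by
        linear_combination (-7 / 4) * h
          + (7 / 4) * ((t * a ^ 2 + 1) / 2 - (9 / 14) * t * a) * h8
      have ha : a ≠ 0 := by
        rintro rfl
        simp at h
      have h10 : 15 * t + 196 = 0 := by simpa [ha, h0] using h9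
      exact h6 (by linear_combination h10 / 15)
    · exact hcommon a (sub_eq_zero.1 h8) hq
  · simp at h
    linear_combination -h

theorem numWeight_generic (M : Model (octic t) x y) (h0 : t ≠ 0) (h4 : t ≠ 4) (h5 : t ≠ 196)
    (h6 : t ≠ -196 / 15) : numWeight K 1 = 48 ∧ numWeight K 2 = 0 ∧ numWeight K 3 = 4 := by
  have hp := simpleRoots_generic h0 h4 h5 h6
  have h4' : 4 - t ≠ 0 := sub_ne_zero.2 h4.symm
  have hN : derivNum (octic t) 5 = C (3840 * t * (4 - t)) *
      (expand ℂ 4 ((1 - C t * X ^ 2) * quartic t) * 1 ^ 2 * X ^ 3) := by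
    rw [derivNum_octic]
    ring
  have h := M.numWeight_eq h0 h4 (by simp [h0, h4']) hN (by
    have := squarefree_X_mul_expand hp (by simp [quartic])
    convert this using 1
    ring)
  have hd1 : (expand ℂ 4 ((1 - C t * X ^ 2) * quartic t)).natDegree = 6 * 4 := by
    apply natDegree_expand_four
    have ha : (1 - C t * X ^ 2).natDegree = 2 := by compute_degree!
    have hb : (quartic t).natDegree = 4 := by
      unfold quartic
      compute_degree!
    rw [natDegree_mul, ha, hb]
    · intro h; rw [h] at ha; simp at ha
    · intro h; rw [h] at hb; simp at hb
  rw [hd1, natDegree_one, natDegree_X] at h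
  exact h

end Model

end

/-! ### Isomorphisms between models and the standard function field -/

section

namespace Model

variable {K : Type u} [Field K] [Algebra ℂ K] {L : Type v} [Field L] [Algebra ℂ L]
  {f : ℂ[X]} {x y : K}

theorem map_ev (e : K →ₐ[ℂ] L) (A B : ℂ[X]) : e (ev x y A B) = ev (e x) (e y) A B := by
  simp only [ev, map_add, map_mul, aeval_algHom_apply]

/-- Transport along an isomorphism of function fields. -/
theorem map (M : Model f x y) (e : K ≃ₐ[ℂ] L) : Model f (e x) (e y) := by
  refine ⟨M.sqf, M.deg, ?_, ?_, ?_⟩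
  · rw [transcendental_iff]
    intro p hp
    apply transcendental_iff.1 M.trans p
    apply e.injective
    rw [map_zero, ← hp, aeval_algHom_apply]
  · rw [← map_pow, M.eq, aeval_algHom_apply]
  · intro h
    obtain ⟨A, B, D, hD, h1⟩ := M.gen (e.symm h)
    refine ⟨A, B, D, hD, ?_⟩
    have h2 := congrArg e h1
    rw [map_mul, e.apply_symm_apply] at h2
    rw [← aeval_algHom_apply] at *
    exact h2.trans (map_ev e.toAlgHom A B)

end Model

theorem adjoinRoot_eq (s : RatFunc ℂ) (z : AdjoinRoot (X ^ 2 - C s)) :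
    ∃ a b : RatFunc ℂ, z = AdjoinRoot.of _ a + AdjoinRoot.of _ b * AdjoinRoot.root _ := by
  obtain ⟨p, rfl⟩ := AdjoinRoot.mk_surjective z
  have hm : (X ^ 2 - C s).Monic := monic_X_pow_sub_C s two_ne_zero
  have hdeg : (p %ₘ (X ^ 2 - C s)).natDegree ≤ 1 := by
    have h1 := natDegree_modByMonic_lt p hm (by
      intro h
      have := congrArg natDegree h
      rw [natDegree_X_pow_sub_C, natDegree_one] at this
      norm_num at this)
    rw [natDegree_X_pow_sub_C] at h1
    omega
  obtain ⟨a, b, h2⟩ := exists_eq_X_add_C_of_natDegree_le_one hdeg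
  refine ⟨b, a, ?_⟩
  have h3 := congrArg (AdjoinRoot.mk (X ^ 2 - C s)) (modByMonic_add_div p (X ^ 2 - C s))
  rw [h2] at h3
  simp only [map_add, map_mul, AdjoinRoot.mk_C, AdjoinRoot.mk_X, AdjoinRoot.mk_self, zero_mul,
    add_zero] at h3
  rw [← h3]
  ring

theorem ratFunc_eq_div (a : RatFunc ℂ) : ∃ p q : ℂ[X], q ≠ 0 ∧
    a = algebraMap ℂ[X] (RatFunc ℂ) p / algebraMap ℂ[X] (RatFunc ℂ) q :=
  ⟨a.num, a.denom, a.denom_ne_zero, (RatFunc.num_div_denom a).symm⟩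

namespace Model

variable {K : Type u} [Field K] [Algebra ℂ K] {L : Type v} [Field L] [Algebra ℂ L]
  {f : ℂ[X]} {x y : K}

/-- The standard presentation of the function field. -/
theorem exists_equiv_adjoinRoot (M : Model f x y) :
    ∃ e : AdjoinRoot (X ^ 2 - C (algebraMap ℂ[X] (RatFunc ℂ) f)) ≃ₐ[ℂ] K,
      e (AdjoinRoot.of _ RatFunc.X) = x ∧ e (AdjoinRoot.root _) = y := by
  have hle : nonZeroDivisors ℂ[X] ≤ (nonZeroDivisors K).comap (aeval x : ℂ[X] →ₐ[ℂ] K) := by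
    intro A hA
    exact mem_nonZeroDivisors_of_ne_zero (aeval_ne_zero M.trans (nonZeroDivisors.ne_zero hA))
  let i : RatFunc ℂ →ₐ[ℂ] K := RatFunc.liftAlgHom (aeval x) hle
  have hi : ∀ A : ℂ[X], i (algebraMap ℂ[X] (RatFunc ℂ) A) = aeval x A := by
    intro A
    have := RatFunc.liftAlgHom_apply_div (φ := (aeval x : ℂ[X] →ₐ[ℂ] K)) hle A 1
    simpa using this
  have hroot : (X ^ 2 - C (algebraMap ℂ[X] (RatFunc ℂ) f)).eval₂ (i : RatFunc ℂ →+* K) y = 0 := by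
    rw [eval₂_sub, eval₂_X_pow, eval₂_C, M.eq]
    exact sub_eq_zero.2 (hi f).symm
  let e : AdjoinRoot (X ^ 2 - C (algebraMap ℂ[X] (RatFunc ℂ) f)) →ₐ[ℂ] K :=
    AdjoinRoot.liftAlgHom _ i y hroot
  have he : ∀ a, e (AdjoinRoot.of _ a) = i a := fun a => AdjoinRoot.liftAlgHom_of _ _ _ _ _
  have her : e (AdjoinRoot.root _) = y := AdjoinRoot.liftAlgHom_root _ _ _ _
  have hbij : Function.Bijective e := by
    constructor
    · rw [injective_iff_map_eq_zero]
      intro z hz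
      obtain ⟨a, b, rfl⟩ := adjoinRoot_eq _ z
      obtain ⟨p, q, hq, rfl⟩ := ratFunc_eq_div a
      obtain ⟨p', q', hq', rfl⟩ := ratFunc_eq_div b
      rw [map_add, map_mul, he, he, her, map_div₀, map_div₀, hi, hi, hi, hi] at hz
      have h1 := aeval_ne_zero M.trans hq
      have h2 := aeval_ne_zero M.trans hq'
      have h3 : ev x y (p * q') (p' * q) = 0 := by
        rw [ev, map_mul, map_mul]
        field_simp at hz
        linear_combination hz
      obtain ⟨h4, h5⟩ := M.indep h3
      have hp : p = 0 := (mul_eq_zero.1 h4).resolve_right hq'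
      have hp' : p' = 0 := (mul_eq_zero.1 h5).resolve_right hq
      simp [hp, hp']
    · intro h
      obtain ⟨A, B, D, hD, h1⟩ := M.gen h
      refine ⟨AdjoinRoot.of _ (algebraMap ℂ[X] _ A / algebraMap ℂ[X] _ D) +
        AdjoinRoot.of _ (algebraMap ℂ[X] _ B / algebraMap ℂ[X] _ D) * AdjoinRoot.root _, ?_⟩
      have h2 := aeval_ne_zero M.trans hD
      rw [map_add, map_mul, he, he, her, map_div₀, map_div₀, hi, hi, hi]
      rw [ev] at h1
      field_simp
      linear_combination -h1
  refine ⟨AlgEquiv.ofBijective e hbij, ?_, her⟩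
  have h1 : e (AdjoinRoot.of _ RatFunc.X) = x := by
    rw [he, ← RatFunc.algebraMap_X, hi, aeval_X]
  exact h1

/-- Two models with the same equation are isomorphic. -/
theorem exists_equiv (M : Model f x y) {x' y' : L} (M' : Model f x' y') :
    ∃ e : K ≃ₐ[ℂ] L, e x = x' ∧ e y = y' := by
  obtain ⟨e, hx, hy⟩ := M.exists_equiv_adjoinRoot
  obtain ⟨e', hx', hy'⟩ := M'.exists_equiv_adjoinRoot
  refine ⟨e.symm.trans e', ?_, ?_⟩
  · rw [AlgEquiv.trans_apply, ← hx, e.symm_apply_apply, hx']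
  · rw [AlgEquiv.trans_apply, ← hy, e.symm_apply_apply, hy']

end Model

theorem curveField_model (t : Param) : Model (octic t.1) (xCoord t) (yCoord t) := by
  have hmap : ∀ A : ℂ[X], aeval (xCoord t) A
      = AdjoinRoot.of (curvePoly t.1) (algebraMap ℂ[X] (RatFunc ℂ) A) := by
    intro A
    let φ : ℂ[X] →ₐ[ℂ] CurveField t := (IsScalarTower.toAlgHom ℂ (RatFunc ℂ) (CurveField t)).comp
      (IsScalarTower.toAlgHom ℂ ℂ[X] (RatFunc ℂ))
    have h1 : aeval (xCoord t) = φ := by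
      ext
      rw [aeval_X, xCoord, ← RatFunc.algebraMap_X]
      rfl
    rw [h1]
    rfl
  have hinj : Function.Injective (AdjoinRoot.of (curvePoly t.1)) := RingHom.injective _
  have htr : Transcendental ℂ (xCoord t) := by
    rw [transcendental_iff]
    intro p hp
    rw [hmap, ← map_zero (AdjoinRoot.of (curvePoly t.1))] at hp
    have h2 := hinj hp
    rwa [map_eq_zero_iff _ (RatFunc.algebraMap_injective ℂ)] at h2
  refine ⟨octic_squarefree t, ?_, htr, ?_, ?_⟩
  · rw [octic_natDegree]
    norm_num
  · rw [yCoord_sq, octic]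
    simp
  · intro h
    obtain ⟨a, b, h1⟩ := adjoinRoot_eq _ h
    obtain ⟨p, q, hq, rfl⟩ := ratFunc_eq_div a
    obtain ⟨p', q', hq', rfl⟩ := ratFunc_eq_div b
    refine ⟨p * q', p' * q, q * q', mul_ne_zero hq hq', ?_⟩
    have h2 := Model.aeval_ne_zero htr hq
    have h3 := Model.aeval_ne_zero htr hq'
    have h4 : h = aeval (xCoord t) p / aeval (xCoord t) q
        + aeval (xCoord t) p' / aeval (xCoord t) q' * yCoord t := by
      rw [hmap, hmap, hmap, hmap, ← map_div₀ (AdjoinRoot.of (curvePoly t.1)),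
        ← map_div₀ (AdjoinRoot.of (curvePoly t.1))]
      exact h1
    rw [h4, ev, map_mul, map_mul, map_mul]
    field_simp

/-- The points over `x = 0` and at infinity, and the table of weights. -/
theorem curveField_weights (t : Param) :
    (∀ b : ℂ, (b = 1 ∨ b = -1) → ∃ P : Place (CurveField t),
      (∀ Q, IsAffinePoint t Q 0 b ↔ Q = P) ∧ P.HasWeight 2 3) ∧
    (Set.encard {P | IsAtInfinity t P} = 2 ∧ ∀ P, IsAtInfinity t P → P.HasWeight 2 3) ∧
    (∀ (K : Type u) [Field K] [Algebra ℂ K], Nonempty (K ≃ₐ[ℂ] CurveField t) →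
      ((t : ℂ) = 196 → numWeight K 1 = 24 ∧ numWeight K 2 = 0 ∧ numWeight K 3 = 12) ∧
      ((t : ℂ) = -196 / 15 → numWeight K 1 = 16 ∧ numWeight K 2 = 16 ∧ numWeight K 3 = 4) ∧
      ((t : ℂ) ≠ 196 → (t : ℂ) ≠ -196 / 15 →
        numWeight K 1 = 48 ∧ numWeight K 2 = 0 ∧ numWeight K 3 = 4)) := by
  have M := curveField_model t
  refine ⟨?_, ⟨M.encard_poles t.2.1 t.2.2, fun P hP => M.hasWeight_pole t.2.1 t.2.2 hP⟩, ?_⟩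
  · intro b hb
    have hb2 : b ^ 2 = (octic t.1).eval 0 := by
      rcases hb with rfl | rfl <;> simp [octic]
    obtain ⟨P, hP⟩ := M.exists_place hb2
    refine ⟨P, fun Q => ⟨fun hQ => M.liesOver_unique hQ hP, ?_⟩, M.hasWeight_zero t.2.1 t.2.2 hP⟩
    rintro rfl
    exact hP
  · rintro K _ _ ⟨e⟩
    have MK := M.map e.symm
    obtain ⟨t, h0, h4⟩ := t
    refine ⟨?_, ?_, fun h5 h6 => MK.numWeight_generic h0 h4 h5 h6⟩
    · rintro rfl
      exact MK.numWeight_special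
    · rintro rfl
      exact MK.numWeight_special'

end

/-! ### Functions of degree two and the Möbius action -/

section

open IntermediateField

variable {K : Type u} [Field K] [Algebra ℂ K]

/-- `x` is a function of degree two. -/
def DegTwo (x : K) : Prop :=
  Transcendental ℂ x ∧ Module.finrank (IntermediateField.adjoin ℂ ({x} : Set K)) K = 2

theorem DegTwo.congr {x x' : K} (h : DegTwo x) (h1 : x ∈ IntermediateField.adjoin ℂ ({x'} : Set K))
    (h2 : x' ∈ IntermediateField.adjoin ℂ ({x} : Set K)) : DegTwo x' := by
  have heq : IntermediateField.adjoin ℂ ({x'} : Set K) = IntermediateField.adjoin ℂ ({x} : Set K) :=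
    le_antisymm (adjoin_simple_le_iff.2 h2) (adjoin_simple_le_iff.2 h1)
  refine ⟨fun halg => h.1 ?_, by rw [heq]; exact h.2⟩
  have hx' : IsAlgebraic ℂ x' := halg
  have := isAlgebraic_adjoin_simple hx'.isIntegral
  exact (isAlgebraic_iff (S := IntermediateField.adjoin ℂ ({x'} : Set K)) (x := ⟨x, h1⟩)).1
    (Algebra.IsAlgebraic.isAlgebraic _)

/-- A function field of degree two over `ℂ(x)` has an equation `y² = f(x)`. -/
theorem DegTwo.exists_model {x : K} (h : DegTwo x) : ∃ (f : ℂ[X]) (y : K), Model f x y := by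
  classical
  obtain ⟨hx, hfin⟩ := h
  set F := IntermediateField.adjoin ℂ ({x} : Set K) with hF
  have _ : FiniteDimensional F K := Module.finite_of_finrank_eq_succ hfin
  have hFx : x ∈ F := mem_adjoin_simple_self ℂ x
  have haev : ∀ A : ℂ[X], aeval x A ∈ F := fun A =>
    (mem_adjoin_simple_iff ℂ _).2 ⟨A, 1, by simp⟩
  have hspan : ∀ y : K, y ∉ F → ∀ g : K, ∃ α β : F, g = α + β * y := by
    intro y hy g
    have hli : LinearIndependent F ![1, y] := by
      rw [LinearIndependent.pair_iff]
      intro s r hsr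
      rw [Algebra.smul_def, Algebra.smul_def, mul_one] at hsr
      have hr : r = 0 := by
        by_contra hr
        apply hy
        have hr' : (r : K) ≠ 0 := by simpa using hr
        have h1 : y = ((-s / r : F) : K) := by
          push_cast
          rw [eq_div_iff hr']
          change (s : K) + (r : K) * y = 0 at hsr
          linear_combination hsr
        rw [h1]
        exact SetLike.coe_mem _
      subst hr
      refine ⟨?_, rfl⟩
      simpa using hsr
    have htop := hli.span_eq_top_of_card_eq_finrank' (by simp [hfin])
    have hg : g ∈ Submodule.span F (Set.range ![1, y]) := by rw [htop]; trivial
    rw [Matrix.range_cons, Matrix.range_cons, Matrix.range_empty, Set.union_empty,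
      Set.singleton_union, Submodule.mem_span_pair] at hg
    obtain ⟨α, β, h1⟩ := hg
    refine ⟨α, β, ?_⟩
    rw [← h1, Algebra.smul_def, Algebra.smul_def, mul_one]
    rfl
  have hex : ∃ n : ℕ, ∃ (f : ℂ[X]) (y : K), f ≠ 0 ∧ y ∉ F ∧ y ^ 2 = aeval x f ∧
      f.natDegree = n := by
    obtain ⟨w, hw⟩ : ∃ w, w ∉ F := by
      by_contra! hall
      have htop : F = ⊤ := eq_top_iff.2 fun w _ => hall w
      have := IntermediateField.finrank_top (F := ℂ) (E := K)
      rw [← htop, hfin] at this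
      norm_num at this
    obtain ⟨α, β, h1⟩ := hspan w hw (w ^ 2)
    -- Completing the square in w² = α + βw. Multiplying z by the denominator of z² then makes the
    -- square a polynomial in x.
    obtain ⟨z, hz⟩ : ∃ z : K, z = w - algebraMap ℂ K (1 / 2) * β := ⟨_, rfl⟩
    have hβ : algebraMap ℂ K (1 / 2) * β ∈ F := F.mul_mem (F.algebraMap_mem _) β.2
    have hzF : z ∉ F := by
      intro h2
      apply hw
      have := F.add_mem h2 hβ
      rwa [hz, sub_add_cancel] at this
    have hz2 : z ^ 2 ∈ F := by
      have h3 : z ^ 2 = α + (algebraMap ℂ K (1 / 2) * β) ^ 2 := by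
        rw [hz]
        linear_combination h1 - β * w * algebraMap_half_mul_two K
      rw [h3]
      exact F.add_mem α.2 (_root_.pow_mem hβ 2)
    obtain ⟨r, s, hrs⟩ := (mem_adjoin_simple_iff ℂ _).1 hz2
    have hz0 : z ≠ 0 := by
      rintro rfl
      exact hzF F.zero_mem
    have hs : aeval x s ≠ 0 := by
      intro hs
      rw [hs, div_zero] at hrs
      exact hz0 (pow_eq_zero_iff two_ne_zero |>.1 hrs)
    refine ⟨_, r * s, z * aeval x s, ?_, ?_, ?_, rfl⟩
    · intro h0
      rcases mul_eq_zero.1 h0 with h0 | h0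
      · rw [h0, map_zero, zero_div] at hrs
        exact hz0 (pow_eq_zero_iff two_ne_zero |>.1 hrs)
      · exact hs (by rw [h0, map_zero])
    · intro h2
      apply hzF
      have := F.div_mem h2 (haev s)
      rwa [mul_div_cancel_right₀ _ hs] at this
    · rw [mul_pow, hrs, map_mul]
      field_simp
  -- An f of minimal degree is squarefree: if p² divided f, y/p would satisfy an equation of degree
  -- smaller by 2 deg p.
  obtain ⟨f, y, hf0, hyF, hyf, hdeg⟩ := Nat.find_spec hex
  have hmin : ∀ (g : ℂ[X]) (z : K), g ≠ 0 → z ∉ F → z ^ 2 = aeval x g →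
      f.natDegree ≤ g.natDegree := by
    intro g z hg hz hzg
    rw [hdeg]
    exact Nat.find_min' hex ⟨g, z, hg, hz, hzg, rfl⟩
  refine ⟨f, y, ?_, ?_, hx, hyf, ?_⟩
  · rintro p ⟨g, hg⟩
    have hp : p ≠ 0 := by
      rintro rfl
      exact hf0 (by rw [hg]; ring)
    have hg0 : g ≠ 0 := by
      rintro rfl
      exact hf0 (by rw [hg]; ring)
    have hpx := Model.aeval_ne_zero hx hp
    have h1 := hmin g (y / aeval x p) hg0 (fun h2 => hyF (by
      have := F.mul_mem h2 (haev p)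
      rwa [div_mul_cancel₀ _ hpx] at this)) (by
        rw [div_pow, hyf, hg, map_mul, map_mul]
        field_simp)
    rw [hg, natDegree_mul (mul_ne_zero hp hp) hg0, natDegree_mul hp hp] at h1
    have h2 : p.natDegree = 0 := by omega
    obtain ⟨c, rfl⟩ := natDegree_eq_zero.1 h2
    have hc : c ≠ 0 := by simpa using hp
    exact isUnit_C.2 hc.isUnit
  · intro h0
    obtain ⟨c, rfl⟩ := natDegree_eq_zero.1 h0
    obtain ⟨s, hs⟩ := IsAlgClosed.exists_pow_nat_eq c (n := 2) (by norm_num)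
    rw [aeval_C, ← hs, map_pow] at hyf
    apply hyF
    rcases sq_eq_sq_iff_eq_or_eq_neg.1 hyf with h1 | h1
    · rw [h1]
      exact F.algebraMap_mem s
    · rw [h1]
      exact F.neg_mem (F.algebraMap_mem s)
  · intro g
    obtain ⟨α, β, h1⟩ := hspan y hyF g
    obtain ⟨r, s, hrs⟩ := (mem_adjoin_simple_iff ℂ _).1 α.2
    obtain ⟨r', s', hrs'⟩ := (mem_adjoin_simple_iff ℂ _).1 β.2
    have hnz : ∀ (r s : ℂ[X]), ∃ r' s' : ℂ[X], s' ≠ 0 ∧ aeval x r / aeval x s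
        = aeval x r' / aeval x s' := by
      intro r s
      by_cases hs : s = 0
      · exact ⟨0, 1, one_ne_zero, by simp [hs]⟩
      · exact ⟨r, s, hs, rfl⟩
    obtain ⟨p, q, hq, hpq⟩ := hnz r s
    obtain ⟨p', q', hq', hpq'⟩ := hnz r' s'
    refine ⟨p * q', p' * q, q * q', mul_ne_zero hq hq', ?_⟩
    have h2 := Model.aeval_ne_zero hx hq
    have h3 := Model.aeval_ne_zero hx hq'
    rw [h1, hrs, hrs', hpq, hpq', ev, map_mul, map_mul, map_mul]
    field_simp

theorem exists_sq_of_associated {p d : ℂ[X]} (h : Associated (d ^ 2) p) : ∃ e, p = e ^ 2 := by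
  obtain ⟨v, hv⟩ := h
  obtain ⟨c, hc, hc'⟩ := Polynomial.isUnit_iff.1 v.isUnit
  obtain ⟨s, hs⟩ := IsAlgClosed.exists_pow_nat_eq c (n := 2) (by norm_num)
  refine ⟨d * C s, ?_⟩
  rw [← hv, ← hc', ← hs, mul_pow, C_pow]

namespace Model

variable {f : ℂ[X]} {x y : K}

/-- Automorphisms act on the hyperelliptic coordinate by Möbius transformations. -/
theorem exists_moebius (M : Model f x y) (h1 : f.natDegree ≤ 8) (h2 : 7 ≤ f.natDegree)
    (g : K ≃ₐ[ℂ] K) : ∃ a b c d : ℂ, (c ≠ 0 ∨ d ≠ 0) ∧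
      (algebraMap ℂ K c * x + algebraMap ℂ K d) * g x
        = algebraMap ℂ K a * x + algebraMap ℂ K b := by
  have M' := M.map g
  have hmem := fun ψ => M.mem_holoDiff_one_iff (m := 4) h1 (by omega) (ψ := ψ)
  have hmem' := fun ψ => M'.mem_holoDiff_one_iff (m := 4) h1 (by omega) (ψ := ψ)
  have hdeg : ∀ A : ℂ[X], A ∈ degreeLT ℂ (4 - 1) ↔ A.natDegree ≤ 2 := by
    intro A
    rw [mem_degreeLT]
    by_cases hA : A = 0
    · subst hA
      simp only [degree_zero, natDegree_zero]
      exact ⟨fun _ => by omega, fun _ => WithBot.bot_lt_coe 3⟩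
    · rw [degree_eq_natDegree hA, Nat.cast_lt]
      omega
  -- Holomorphic differentials are the polynomials of degree at most 2 times dx/y, both for x, y and
  -- for their images under g. So l, l·g(x), l·g(x)² are polynomials p₀, p₁, p₂ in x of degree at
  -- most 2 with p₀p₂ = p₁²: the canonical image is a conic.
  obtain ⟨l, hl⟩ := M.isGenerator_omega.exists_eq (qpow 1 (omega (g x) (g y)))
  have hfw : ∀ A : ℂ[X], A.natDegree ≤ 2 → ∃ B : ℂ[X], B.natDegree ≤ 2 ∧
      aeval (g x) A * l = aeval x B := by
    intro A hA
    obtain ⟨B, hB, h3⟩ := (hmem _).1 ((hmem' _).2 ⟨A, (hdeg A).2 hA, rfl⟩)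
    rw [hl, smul_smul] at h3
    exact ⟨B, (hdeg B).1 hB, M.isGenerator_omega.smul_inj h3⟩
  obtain ⟨p₀, hd₀, hp₀⟩ := hfw 1 (by simp)
  obtain ⟨p₁, hd₁, hp₁⟩ := hfw X (by simp)
  obtain ⟨p₂, hd₂, hp₂⟩ := hfw (X ^ 2) (by simp)
  rw [map_one, one_mul] at hp₀
  rw [aeval_X] at hp₁
  rw [map_pow, aeval_X] at hp₂
  obtain ⟨r, hr, hr1⟩ : ∃ r : ℂ[X], r.natDegree ≤ 2 ∧ aeval (g x) r * l = 1 := by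
    have h3 : (1 : K) • qpow 1 (omega x y) ∈ holoDiff K 1 :=
      (hmem _).2 ⟨1, (hdeg 1).2 (by simp), by rw [map_one]⟩
    obtain ⟨r, hr, h4⟩ := (hmem' _).1 h3
    rw [hl, smul_smul] at h4
    exact ⟨r, (hdeg r).1 hr, (M.isGenerator_omega.smul_inj h4).symm⟩
  have hrel : p₀ * p₂ = p₁ ^ 2 := by
    apply aeval_inj M.trans
    rw [map_mul, map_pow, ← hp₀, ← hp₁, ← hp₂]
    ring
  have hone : C (r.coeff 0) * p₀ + C (r.coeff 1) * p₁ + C (r.coeff 2) * p₂ = 1 := by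
    apply aeval_inj M.trans
    rw [map_one, ← hr1, aeval_eq_sum_range' (Nat.lt_succ_of_le hr)]
    simp only [map_add, map_mul, aeval_C, ← hp₀, ← hp₁, ← hp₂, Finset.sum_range_succ,
      Finset.sum_range_zero, Algebra.smul_def]
    ring
  -- Since dx/y is itself a combination of the transformed differentials, r₀p₀ + r₁p₁ + r₂p₂ = 1.
  -- Squaring this and replacing p₁² by p₀p₂ gives a Bézout identity. Coprime factors of a square
  -- are squares over ℂ, so p₀ = D², p₂ = E² and g(x) = p₁/p₀ = ±E/D.
  have hcop : IsCoprime p₀ p₂ := by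
    generalize C (r.coeff 0) = r₀ at hone
    generalize C (r.coeff 1) = r₁ at hone
    generalize C (r.coeff 2) = r₂ at hone
    refine ⟨r₀ * (r₀ * p₀ + 2 * r₁ * p₁ + 2 * r₂ * p₂) + r₁ ^ 2 * p₂,
      r₂ * (2 * r₁ * p₁ + r₂ * p₂), ?_⟩
    linear_combination (r₀ * p₀ + r₁ * p₁ + r₂ * p₂ + 1) * hone + r₁ ^ 2 * hrel
  obtain ⟨D, hD⟩ := exists_sq_of_associated (exists_associated_pow_of_mul_eq_pow' hcop hrel).choose_spec
  obtain ⟨E, hE⟩ := exists_sq_of_associated (exists_associated_pow_of_mul_eq_pow' hcop.symm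
    (by rw [mul_comm]; exact hrel)).choose_spec
  have hD1 : D.natDegree ≤ 1 := by
    rw [hD, natDegree_pow] at hd₀
    omega
  have hE1 : E.natDegree ≤ 1 := by
    rw [hE, natDegree_pow] at hd₂
    omega
  have hl0 : l ≠ 0 := by
    rintro rfl
    simp at hr1
  have hD0 : D ≠ 0 := by
    rintro rfl
    rw [hD] at hp₀
    exact hl0 (by rw [hp₀]; simp)
  have hDx := aeval_ne_zero M.trans hD0
  have hsq : p₁ ^ 2 = (D * E) ^ 2 := by rw [← hrel, hD, hE]; ring
  obtain ⟨E', hE', h3⟩ : ∃ E' : ℂ[X], E'.natDegree ≤ 1 ∧ p₁ = D * E' := by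
    rcases sq_eq_sq_iff_eq_or_eq_neg.1 hsq with h | h
    · exact ⟨E, hE1, h⟩
    · exact ⟨-E, by rwa [natDegree_neg], by rw [h]; ring⟩
  have h4 : aeval x D * g x = aeval x E' := by
    apply mul_left_cancel₀ hDx
    rw [h3, hp₀, hD, map_pow, map_mul] at hp₁
    linear_combination hp₁
  obtain ⟨c, d, rfl⟩ := exists_eq_X_add_C_of_natDegree_le_one hD1
  obtain ⟨a, b, rfl⟩ := exists_eq_X_add_C_of_natDegree_le_one hE'
  refine ⟨a, b, c, d, ?_, by simpa using h4⟩
  by_contra! h5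
  rw [h5.1, h5.2] at hD0
  simp at hD0

end Model

theorem DegTwo.exists_model_of_genus {x : K} (h : DegTwo x) (hg : genus K = 3) :
    ∃ (f : ℂ[X]) (y : K), Model f x y ∧ f.natDegree ≤ 8 ∧ 7 ≤ f.natDegree := by
  obtain ⟨f, y, M⟩ := h.exists_model
  have := M.genus_eq (m := (f.natDegree + 1) / 2) (by omega) (by omega)
  exact ⟨f, y, M, by omega, by omega⟩

theorem DegTwo.exists_moebius {x : K} (h : DegTwo x) (hg : genus K = 3) (g : K ≃ₐ[ℂ] K) :
    ∃ a b c d : ℂ, (c ≠ 0 ∨ d ≠ 0) ∧ (algebraMap ℂ K c * x + algebraMap ℂ K d) * g x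
        = algebraMap ℂ K a * x + algebraMap ℂ K b := by
  obtain ⟨f, y, M, h1, h2⟩ := h.exists_model_of_genus hg
  exact M.exists_moebius h1 h2 g

end

/-! ### Diagonal coordinates and the hyperelliptic involution -/

section

open IntermediateField

variable {K : Type u} [Field K] [Algebra ℂ K]

theorem DegTwo.ne_algebraMap {x : K} (h : DegTwo x) (c : ℂ) : x ≠ algebraMap ℂ K c := by
  rintro rfl
  exact h.1 (isAlgebraic_algebraMap c)

theorem DegTwo.sq_ne_algebraMap {x : K} (h : DegTwo x) (c : ℂ) : x ^ 2 ≠ algebraMap ℂ K c := by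
  intro h1
  obtain ⟨s, rfl⟩ := IsAlgClosed.exists_pow_nat_eq c (n := 2) (by norm_num)
  rw [map_pow] at h1
  rcases sq_eq_sq_iff_eq_or_eq_neg.1 h1 with h1 | h1
  · exact h.ne_algebraMap s h1
  · exact h.ne_algebraMap (-s) (by rw [h1, map_neg])

theorem DegTwo.ne_zero {x : K} (h : DegTwo x) : x ≠ 0 := by
  simpa using h.ne_algebraMap 0

theorem DegTwo.eq_one_of_mul {x : K} (h : DegTwo x) {c : ℂ} (hc : algebraMap ℂ K c * x = x) :
    c = 1 := by
  apply FaithfulSMul.algebraMap_injective ℂ K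
  apply mul_right_cancel₀ h.ne_zero
  rw [hc, map_one, one_mul]

theorem fixes_of_mem_adjoin {x x' : K} (h : x ∈ IntermediateField.adjoin ℂ ({x'} : Set K))
    {g : K ≃ₐ[ℂ] K} (hg : g x' = x') : g x = x := by
  obtain ⟨r, s, rfl⟩ := (mem_adjoin_simple_iff ℂ x).1 h
  rw [map_div₀, ← aeval_algHom_apply, ← aeval_algHom_apply]
  change aeval (g x') r / aeval (g x') s = _
  rw [hg]

/-- A translation x ↦ x + B cannot have finite order unless B = 0; any other affine map has a finite
fixed point, which is moved to 0. -/
theorem DegTwo.exists_diagonal_of_affine {x : K} (h : DegTwo x) {σ : K ≃ₐ[ℂ] K} (hσ : σ ^ 4 = 1)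
    (hne : σ x ≠ x) {A B : ℂ} (hAB : σ x = algebraMap ℂ K A * x + algebraMap ℂ K B) :
    ∃ (x' : K) (ζ : ℂ), DegTwo x' ∧ σ x' = algebraMap ℂ K ζ * x' ∧
      x ∈ IntermediateField.adjoin ℂ ({x'} : Set K) ∧
      x' ∈ IntermediateField.adjoin ℂ ({x} : Set K) := by
  have hσ4 : σ (σ (σ (σ x))) = x := DFunLike.congr_fun hσ x
  by_cases hA : A = 1
  · subst hA
    exfalso
    simp only [hAB, map_add, map_one, one_mul, AlgEquiv.commutes] at hσ4
    have h4 : algebraMap ℂ K (4 * B) = 0 := by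
      rw [map_mul, map_ofNat]
      linear_combination hσ4
    rw [map_eq_zero, mul_eq_zero_iff_left (by norm_num)] at h4
    apply hne
    rw [hAB, h4, map_one, map_zero, one_mul, add_zero]
  · have hA' : A - 1 ≠ 0 := sub_ne_zero.2 hA
    obtain ⟨E, hE⟩ : ∃ E, E = B / (A - 1) := ⟨_, rfl⟩
    have hB : B = E * (A - 1) := by rw [hE]; field_simp
    have h1 : x + algebraMap ℂ K E ∈ IntermediateField.adjoin ℂ ({x} : Set K) :=
      add_mem (mem_adjoin_simple_self ℂ x) (IntermediateField.algebraMap_mem _ _)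
    have h2 : x ∈ IntermediateField.adjoin ℂ ({x + algebraMap ℂ K E} : Set K) := by
      have := sub_mem (mem_adjoin_simple_self ℂ (x + algebraMap ℂ K E))
        (IntermediateField.algebraMap_mem _ E)
      rwa [add_sub_cancel_right] at this
    refine ⟨x + algebraMap ℂ K E, A, h.congr h2 h1, ?_, h2, h1⟩
    rw [map_add, hAB, AlgEquiv.commutes, hB, map_mul, map_sub, map_one]
    ring

/-- An automorphism of finite order acts diagonally on a suitable hyperelliptic coordinate. -/
theorem DegTwo.exists_diagonal {x : K} (h : DegTwo x) (hg : genus K = 3) {σ : K ≃ₐ[ℂ] K}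
    (hσ : σ ^ 4 = 1) (hne : σ x ≠ x) :
    ∃ (x' : K) (ζ : ℂ), DegTwo x' ∧ σ x' = algebraMap ℂ K ζ * x' ∧
      x ∈ IntermediateField.adjoin ℂ ({x'} : Set K) ∧
      x' ∈ IntermediateField.adjoin ℂ ({x} : Set K) := by
  obtain ⟨a, b, c, d, hcd, hm⟩ := h.exists_moebius hg σ
  by_cases hc : c = 0
  · subst hc
    have hd : d ≠ 0 := by simpa using hcd
    have hd' : algebraMap ℂ K d ≠ 0 := by simpa using hd
    refine h.exists_diagonal_of_affine hσ hne (A := a / d) (B := b / d) ?_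
    rw [map_div₀, map_div₀]
    rw [map_zero, zero_mul, zero_add] at hm
    field_simp
    linear_combination hm
  -- A fixed point p of the Möbius transformation; the coordinate 1/(x - p) sends it to infinity and
  -- makes σ affine.
  obtain ⟨p, hp⟩ : ∃ p : ℂ, c * (p * p) + (d - a) * p + -b = 0 := by
    obtain ⟨s, hs⟩ := IsAlgClosed.exists_pow_nat_eq (discrim c (d - a) (-b)) (n := 2) (by norm_num)
    exact exists_quadratic_eq_zero hc ⟨s, by rw [← hs, sq]⟩
  have hb : b = c * (p * p) + (d - a) * p := by linear_combination -hp
  have hxp : x - algebraMap ℂ K p ≠ 0 := sub_ne_zero.2 (h.ne_algebraMap p)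
  have hcx : algebraMap ℂ K c * x + algebraMap ℂ K d ≠ 0 := by
    intro h0
    have hc' : algebraMap ℂ K c ≠ 0 := by simpa using hc
    apply h.ne_algebraMap (-d / c)
    rw [map_div₀, map_neg]
    field_simp
    linear_combination h0
  have hac : a - p * c ≠ 0 := by
    intro h0
    have ha : a = p * c := by linear_combination h0
    have h1 : σ x = algebraMap ℂ K p := by
      apply mul_left_cancel₀ hcx
      rw [hm, hb, ha]
      simp only [map_add, map_mul, map_sub]
      ring
    apply h.ne_algebraMap p
    apply σ.injective
    rw [h1, AlgEquiv.commutes]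
  have hac' : algebraMap ℂ K (a - p * c) ≠ 0 := (_root_.map_ne_zero _).2 hac
  have hσxp : σ x - algebraMap ℂ K p ≠ 0 := by
    have := (_root_.map_ne_zero σ).2 hxp
    rwa [map_sub, AlgEquiv.commutes] at this
  have hkey : (algebraMap ℂ K c * x + algebraMap ℂ K d) * (σ x - algebraMap ℂ K p)
      = algebraMap ℂ K (a - p * c) * (x - algebraMap ℂ K p) := by
    rw [hb] at hm
    simp only [map_add, map_mul, map_sub] at hm ⊢
    linear_combination hm
  have h1 : (x - algebraMap ℂ K p)⁻¹ ∈ IntermediateField.adjoin ℂ ({x} : Set K) :=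
    inv_mem (sub_mem (mem_adjoin_simple_self ℂ x) (IntermediateField.algebraMap_mem _ _))
  have h2 : x ∈ IntermediateField.adjoin ℂ ({(x - algebraMap ℂ K p)⁻¹} : Set K) := by
    have := add_mem (inv_mem (mem_adjoin_simple_self ℂ (x - algebraMap ℂ K p)⁻¹))
      (IntermediateField.algebraMap_mem _ p)
    rwa [inv_inv, sub_add_cancel] at this
  have hσx1 : σ (x - algebraMap ℂ K p)⁻¹ = algebraMap ℂ K ((c * p + d) / (a - p * c)) *
      (x - algebraMap ℂ K p)⁻¹ + algebraMap ℂ K (c / (a - p * c)) := by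
    generalize a - p * c = m at hac' hkey
    rw [map_inv₀, map_sub, AlgEquiv.commutes, map_div₀, map_div₀]
    field_simp
    rw [map_add, map_mul]
    linear_combination -hkey
  obtain ⟨x', ζ, h3, h4, h5, h6⟩ := (h.congr h2 h1).exists_diagonal_of_affine hσ
    (fun h0 => hne (fixes_of_mem_adjoin h2 h0)) hσx1
  refine ⟨x', ζ, h3, h4, ?_, ?_⟩
  · exact adjoin_simple_le_iff.2 h5 h2
  · exact adjoin_simple_le_iff.2 h1 h6

namespace Model

variable {f : ℂ[X]} {x y : K}

theorem eq_one (M : Model f x y) {g : K ≃ₐ[ℂ] K} (hx : g x = x) (hy : g y = y) : g = 1 := by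
  ext h
  obtain ⟨A, B, D, hD, h1⟩ := M.gen h
  have h2 := congrArg g h1
  have h3 : g (ev x y A B) = ev (g x) (g y) A B := map_ev g.toAlgHom A B
  have h4 : g (aeval x D) = aeval (g x) D := (aeval_algHom_apply g x D).symm
  rw [map_mul, h3, h4, hx, hy, ← h1] at h2
  exact mul_right_cancel₀ (aeval_ne_zero M.trans hD) h2

theorem map_y_eq_neg (M : Model f x y) {g : K ≃ₐ[ℂ] K} (hx : g x = x) (hg : g ≠ 1) :
    g y = -y := by
  have h1 := (M.map g).eq
  rw [hx, ← M.eq] at h1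
  exact (sq_eq_sq_iff_eq_or_eq_neg.1 h1).resolve_left fun hy => hg (M.eq_one hx hy)

/-- The hyperelliptic involution is the only nontrivial automorphism that fixes `x`. -/
theorem eq_of_fixes (M : Model f x y) {g g' : K ≃ₐ[ℂ] K} (hx : g x = x) (hg : g ≠ 1)
    (hx' : g' x = x) (hg' : g' ≠ 1) : g = g' := by
  have h1 : g⁻¹ * g' = 1 := by
    apply M.eq_one
    · change g.symm (g' x) = x
      rw [hx', AlgEquiv.symm_apply_eq, hx]
    · change g.symm (g' y) = y
      rw [M.map_y_eq_neg hx' hg', AlgEquiv.symm_apply_eq, M.map_y_eq_neg hx hg]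
  exact inv_mul_eq_one.1 h1

/-- The equation is determined up to a constant by `x`. -/
theorem exists_const_mul (M : Model f x y) {f' : ℂ[X]} {z : K} (M' : Model f' x z) :
    ∃ c : ℂ, f' = C c * f := by
  obtain ⟨A, B, D, hD, h1⟩ := M.gen z
  have h2 : ev x y (A ^ 2 + B ^ 2 * f - f' * D ^ 2) (2 * A * B) = 0 := by
    have h3 := congrArg (· ^ 2) h1
    simp only [mul_pow, M'.eq, ev] at h3
    simp only [ev, map_sub, map_add, map_mul, map_pow, map_ofNat]
    linear_combination -h3 - aeval x B ^ 2 * M.eq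
  obtain ⟨h3, h4⟩ := M.indep h2
  have hB : B ≠ 0 := by
    rintro rfl
    apply hD
    refine (M'.indep (A := -A) (B := D) ?_).2
    simp only [ev, map_zero, zero_mul, add_zero] at h1
    simp only [ev, map_neg]
    linear_combination h1
  have hA : A = 0 := by simpa [hB] using h4
  rw [hA] at h3
  obtain ⟨D', B', e, hrel, hD', hB'⟩ := UniqueFactorizationMonoid.exists_reduced_factors D hD B
  have he : e ≠ 0 := by
    rintro rfl
    exact hD (by rw [← hD', zero_mul])
  have h5 : D' ^ 2 * f' = B' ^ 2 * f := by
    apply mul_left_cancel₀ (pow_ne_zero 2 he)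
    rw [← hD', ← hB'] at h3
    linear_combination -h3
  -- From D'² f' = B'² f with coprime D', B', the square D'² divides f and B'² divides f', so both
  -- are constants.
  have hcop : IsCoprime (D' ^ 2) (B' ^ 2) := hrel.isCoprime.pow
  have hDu : IsUnit D' := M.sqf D' (by
    rw [← sq]
    exact hcop.dvd_of_dvd_mul_left ⟨f', h5.symm⟩)
  have hBu : IsUnit B' := M'.sqf B' (by
    rw [← sq]
    exact hcop.symm.dvd_of_dvd_mul_left ⟨f, h5⟩)
  obtain ⟨p, hp, rfl⟩ := Polynomial.isUnit_iff.1 hDu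
  obtain ⟨q, hq, rfl⟩ := Polynomial.isUnit_iff.1 hBu
  have hp0 : p ≠ 0 := hp.ne_zero
  refine ⟨q ^ 2 / p ^ 2, ?_⟩
  apply mul_left_cancel₀ (C_ne_zero.2 (pow_ne_zero 2 hp0))
  rw [← mul_assoc, ← C_mul, mul_div_cancel₀ _ (pow_ne_zero 2 hp0), C_pow, C_pow, h5]

end Model

end

/-! ### Classification of the curves with automorphism group ℤ₂ × D₈ -/

section

open IntermediateField

variable {K : Type u} [Field K] [Algebra ℂ K]

/-- An involution that commutes with `x ↦ -x` up to the hyperelliptic involution is of the form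
`x ↦ k / x`. -/
theorem DegTwo.mul_map_eq_const {x : K} (h : DegTwo x) (hg : genus K = 3) {σ g : K ≃ₐ[ℂ] K}
    (hσ : σ x = -x) (hσ2 : σ ^ 2 ≠ 1) (hσ4 : σ ^ 4 = 1) (hg2 : g ^ 2 = 1) (hg1 : g ≠ 1)
    (hgσ2 : g ≠ σ ^ 2) (hgσ : g ≠ σ) (hgσ3 : g ≠ σ ^ 3) (hcomm : σ (g x) = -g x) :
    ∃ k : ℂ, k ≠ 0 ∧ x * g x = algebraMap ℂ K k := by
  obtain ⟨f, y, M, -, -⟩ := h.exists_model_of_genus hg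
  have hσ2x : (σ ^ 2) x = x := by
    rw [sq]
    change σ (σ x) = x
    rw [hσ, map_neg, hσ, neg_neg]
  have hx0 := h.ne_zero
  obtain ⟨a, b, c, d, hcd, hm⟩ := h.exists_moebius hg g
  have hm' := congrArg σ hm
  simp only [map_add, map_mul, AlgEquiv.commutes, hσ, hcomm] at hm'
  have htwo : (2 : K) ≠ 0 := by
    intro h2
    have := algebraMap_half_mul_two K
    rw [h2, mul_zero] at this
    exact zero_ne_one this
  have h1 : algebraMap ℂ K c * (x * g x) = algebraMap ℂ K b := by
    apply mul_left_cancel₀ htwo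
    linear_combination hm + hm'
  have h2 : algebraMap ℂ K d * g x = algebraMap ℂ K a * x := by
    apply mul_left_cancel₀ htwo
    linear_combination hm - hm'
  by_cases hd : d = 0
  · have hc : c ≠ 0 := by simpa [hd] using hcd
    have hc' : algebraMap ℂ K c ≠ 0 := (_root_.map_ne_zero _).2 hc
    have h3 : x * g x = algebraMap ℂ K (b / c) := by
      rw [map_div₀]
      field_simp
      linear_combination h1
    refine ⟨b / c, ?_, h3⟩
    intro h0
    rw [h0, map_zero] at h3
    exact mul_ne_zero hx0 ((_root_.map_ne_zero g).2 hx0) h3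
  -- If d ≠ 0, then g² = 1 gives g(x) = ±x. So g or σg fixes x, and comparison with the
  -- hyperelliptic involution σ² places g among the powers of σ.
  · exfalso
    have hd' : algebraMap ℂ K d ≠ 0 := (_root_.map_ne_zero _).2 hd
    have h3 : g x = algebraMap ℂ K (a / d) * x := by
      rw [map_div₀]
      field_simp
      linear_combination h2
    have h4 : g (g x) = x := DFunLike.congr_fun (sq g ▸ hg2 : g * g = 1) x
    rw [h3, map_mul, AlgEquiv.commutes, h3, ← mul_assoc, ← map_mul] at h4
    have h5 := h.eq_one_of_mul h4
    rcases mul_self_eq_one_iff.1 h5 with h6 | h6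
    · rw [h6, map_one, one_mul] at h3
      exact hgσ2 (M.eq_of_fixes h3 hg1 hσ2x hσ2)
    · rw [h6, map_neg, map_one, neg_one_mul] at h3
      have h7 : (σ * g) x = x := by
        change σ (g x) = x
        rw [hcomm, h3, neg_neg]
      have hσg : σ * g = σ ^ 2 := by
        refine M.eq_of_fixes h7 ?_ hσ2x hσ2
        intro h8
        apply hgσ3
        calc g = σ ^ 4 * g := by rw [hσ4, one_mul]
          _ = σ ^ 3 * (σ * g) := by rw [pow_succ σ 3, mul_assoc]
          _ = σ ^ 3 := by rw [h8, mul_one]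
      apply hgσ
      rw [sq] at hσg
      exact mul_left_cancel hσg

namespace Model

variable {f : ℂ[X]} {x y : K}

theorem not_X_sq_dvd (M : Model f x y) (h0 : f.coeff 0 = 0) : f.coeff 1 ≠ 0 := by
  intro h1
  have h2 : X ^ 2 ∣ f := by
    rw [X_pow_dvd_iff]
    intro d hd
    interval_cases d <;> assumption
  exact not_isUnit_X (M.sqf X (by rwa [← sq]))

/-- A model with an automorphism `x ↦ ζ x`, `ζ` a primitive fourth root of unity, has
the form `y² = a x⁸ + b x⁴ + c`. -/
theorem eq_quadratic_of_diagonal (M : Model f x y) (h8 : f.natDegree ≤ 8) (h7 : 7 ≤ f.natDegree)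
    {σ : K ≃ₐ[ℂ] K} {ζ : ℂ} (hζ : ζ ^ 2 = -1) (hσ : σ x = algebraMap ℂ K ζ * x) :
    f = C (f.coeff 8) * X ^ 8 + C (f.coeff 4) * X ^ 4 + C (f.coeff 0) ∧ f.coeff 8 ≠ 0 ∧
      f.coeff 0 ≠ 0 := by
  have hζ0 : ζ ≠ 0 := by
    rintro rfl
    norm_num at hζ
  have hζ1 : ζ ≠ 1 := by
    rintro rfl
    norm_num at hζ
  have hζ2 : ζ ≠ -1 := by
    rintro rfl
    norm_num at hζ
  have hζ3 : ζ ^ 3 = -ζ := by linear_combination ζ * hζ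
  have hζ4 : ζ ^ 4 = 1 := by linear_combination (ζ ^ 2 - 1) * hζ
  have hζ5 : ζ ^ 5 = ζ := by linear_combination ζ * hζ4
  have hζ6 : ζ ^ 6 = -1 := by linear_combination ζ ^ 2 * hζ4 + hζ
  have hζ7 : ζ ^ 7 = -ζ := by linear_combination ζ ^ 3 * hζ4 + hζ3
  have hζ8 : ζ ^ 8 = 1 := by linear_combination (ζ ^ 4 + 1) * hζ4
  have M' : Model (f.comp (C ζ * X)) x (σ y) :=
    (M.map σ).rescale hζ0 one_ne_zero (by simp) hσ (by simp)
  obtain ⟨c, hc⟩ := M.exists_const_mul M'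
  have hcoeff : ∀ n, f.coeff n = 0 ∨ ζ ^ n = c := by
    intro n
    have := congrArg (coeff · n) hc
    simp only [comp_C_mul_X_coeff, coeff_C_mul] at this
    by_cases h0 : f.coeff n = 0
    · exact Or.inl h0
    · right
      apply mul_left_cancel₀ h0
      rw [this, mul_comm]
  have hlead : f.coeff f.natDegree ≠ 0 := by
    rw [coeff_natDegree, leadingCoeff_ne_zero]
    exact M.f_ne_zero
  have hneg : ζ ≠ -ζ := by
    intro h0
    apply hζ0
    linear_combination h0 / 2
  -- The relation f(ζX) = c f(X) leaves only coefficients with ζⁿ = c. In degree 7 one has c = -ζ,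
  -- so the coefficients of 1 and X vanish and X² divides f.
  have h8' : f.natDegree = 8 := by
    by_contra hne
    have h7' : f.natDegree = 7 := by omega
    rw [h7'] at hlead
    have hc7 := (hcoeff 7).resolve_left hlead
    have h0 := (hcoeff 0).resolve_right (by
      rw [← hc7, hζ7, pow_zero]
      intro h
      exact hζ2 (by linear_combination h))
    exact M.not_X_sq_dvd h0 ((hcoeff 1).resolve_right (by rwa [← hc7, hζ7, pow_one]))
  rw [h8'] at hlead
  have hc1 : c = 1 := by rw [← (hcoeff 8).resolve_left hlead, hζ8]
  subst hc1
  have hm1 : (-1 : ℂ) ≠ 1 := by norm_num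
  have hmζ : -ζ ≠ 1 := fun h => hζ2 (by linear_combination -h)
  have h1 := (hcoeff 1).resolve_right (by rwa [pow_one])
  have h2 := (hcoeff 2).resolve_right (by rwa [hζ])
  have h3 := (hcoeff 3).resolve_right (by rwa [hζ3])
  have h5 := (hcoeff 5).resolve_right (by rwa [hζ5])
  have h6 := (hcoeff 6).resolve_right (by rwa [hζ6])
  have h7 := (hcoeff 7).resolve_right (by rwa [hζ7])
  refine ⟨?_, hlead, fun h0 => M.not_X_sq_dvd h0 h1⟩
  conv_lhs => rw [f.as_sum_range_C_mul_X_pow, h8']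
  simp only [Finset.sum_range_succ, Finset.sum_range_zero, h1, h2, h3, h5, h6, h7, map_zero,
    zero_mul, add_zero, zero_add, pow_zero, mul_one]
  ring

/-- `y² = a x⁸ + c` has an automorphism of order at least eight. -/
theorem exists_pow_four_ne_one (M : Model f x y) {a c : ℂ} (hf : f = C a * X ^ 8 + C c) :
    ∃ e : K ≃ₐ[ℂ] K, e ^ 4 ≠ 1 := by
  -- As η⁸ = 1, scaling x by η⁻¹ preserves the equation; its fourth power sends x to -x.
  obtain ⟨η, hη⟩ := IsAlgClosed.exists_pow_nat_eq (-1 : ℂ) (n := 4) (by norm_num)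
  have hη0 : η ≠ 0 := by
    rintro rfl
    norm_num at hη
  have hη8 : η ^ 8 = 1 := by linear_combination (η ^ 4 - 1) * hη
  have hx : x = algebraMap ℂ K η * (algebraMap ℂ K η⁻¹ * x) := by
    rw [← mul_assoc, ← map_mul, mul_inv_cancel₀ hη0, map_one, one_mul]
  have M' : Model f (algebraMap ℂ K η⁻¹ * x) y := by
    refine M.rescale hη0 one_ne_zero ?_ hx (by simp)
    rw [hf]
    simp only [add_comp, mul_comp, pow_comp, C_comp, X_comp, one_pow, C_1, one_mul, mul_pow]
    rw [← C_pow, hη8, C_1, one_mul]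
  obtain ⟨e, he, -⟩ := M.exists_equiv M'
  refine ⟨e, fun h4 => ?_⟩
  have h5 : e (e (e (e x))) = x := DFunLike.congr_fun h4 x
  simp only [he, map_mul, AlgEquiv.commutes] at h5
  have hx0 := M.x_ne_zero
  have h6 : algebraMap ℂ K (η⁻¹ ^ 4) = 1 := by
    apply mul_right_cancel₀ hx0
    rw [map_pow]
    linear_combination h5
  rw [map_eq_one_iff _ (FaithfulSMul.algebraMap_injective ℂ K), inv_pow, hη] at h6
  norm_num at h6

theorem exists_param_equiv (M : Model f x y) {a b c : ℂ}
    (hf : f = C a * X ^ 8 + C b * X ^ 4 + C c) (ha : a ≠ 0) (hb : b ≠ 0) (hc : c ≠ 0) :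
    ∃ t : Param, Nonempty (K ≃ₐ[ℂ] CurveField t) := by
  obtain ⟨l, hl⟩ := IsAlgClosed.exists_pow_nat_eq (b / a) (n := 4) (by norm_num)
  obtain ⟨d, hd⟩ := IsAlgClosed.exists_pow_nat_eq c (n := 2) (by norm_num)
  have hl0 : l ≠ 0 := by
    rintro rfl
    rw [zero_pow (by norm_num)] at hl
    exact div_ne_zero hb ha hl.symm
  have hd0 : d ≠ 0 := by
    rintro rfl
    exact hc (by rw [← hd, zero_pow two_ne_zero])
  have hinv : ∀ {s : ℂ}, s ≠ 0 → ∀ z : K, z = algebraMap ℂ K s * (algebraMap ℂ K s⁻¹ * z) := by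
    intro s hs z
    rw [← mul_assoc, ← map_mul, mul_inv_cancel₀ hs, map_one, one_mul]
  have M' : Model (octic (b ^ 2 / (a * c))) (algebraMap ℂ K l⁻¹ * x) (algebraMap ℂ K d⁻¹ * y) := by
    refine M.rescale hl0 hd0 ?_ (hinv hl0 x) (hinv hd0 y)
    rw [hf, octic, hd]
    simp only [add_comp, mul_comp, pow_comp, C_comp, X_comp, mul_pow, ← C_pow]
    rw [show l ^ 8 = (b / a) ^ 2 by rw [← hl]; ring, hl, mul_add, mul_add, ← mul_assoc,
      ← mul_assoc, ← mul_assoc, ← mul_assoc, ← C_mul, ← C_mul, ← C_mul, mul_one]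
    congr 4 <;> field_simp
  -- For t = 4 the octic would be the square of 2X⁴ + 1.
  have ht : b ^ 2 / (a * c) ≠ 4 := by
    intro h4
    rw [h4] at M'
    have h1 : IsUnit (C (2 : ℂ) * X ^ 4 + 1 : ℂ[X]) := by
      apply M'.sqf
      refine ⟨1, ?_⟩
      rw [octic, show (C (4 : ℂ) : ℂ[X]) = C 2 * C 2 by rw [← C_mul]; norm_num]
      rw [show (C (2 : ℂ) : ℂ[X]) = 2 from map_ofNat C 2]
      ring
    have h2 := natDegree_eq_zero_of_isUnit h1
    have h3 : (C (2 : ℂ) * X ^ 4 + 1 : ℂ[X]).natDegree = 4 := by compute_degree!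
    omega
  obtain ⟨t, hteq⟩ : ∃ t : Param, t.1 = b ^ 2 / (a * c) :=
    ⟨⟨_, div_ne_zero (pow_ne_zero 2 hb) (mul_ne_zero ha hc), ht⟩, rfl⟩
  rw [← hteq] at M'
  obtain ⟨e, -, -⟩ := M'.exists_equiv (curveField_model t)
  exact ⟨t, ⟨e⟩⟩

end Model

/-- A hyperelliptic curve of genus three whose automorphism group is `ℤ₂ × D₈` is one of
the curves `C_t`. -/
theorem DegTwo.exists_param_equiv {x : K} (h : DegTwo x) (hg : genus K = 3)
    (φ : (K ≃ₐ[ℂ] K) ≃* (Multiplicative (ZMod 2) × DihedralGroup 4)) :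
    ∃ t : Param, Nonempty (K ≃ₐ[ℂ] CurveField t) := by
  have h4 : ∀ g : K ≃ₐ[ℂ] K, g ^ 4 = 1 := by
    intro g
    apply φ.injective
    rw [map_pow, map_one]
    generalize φ g = z
    revert z
    decide
  -- A rotation of order 4, a reflection, and the generator of the factor ℤ₂; none of τ, α, τα is a
  -- power of σ.
  obtain ⟨σ, τ, α, hσ2, hτ2, hα2, hστ, hσα, hτα, hτ, hα, hβ⟩ : ∃ σ τ α : K ≃ₐ[ℂ] K,
      σ ^ 2 ≠ 1 ∧ τ ^ 2 = 1 ∧ α ^ 2 = 1 ∧ σ * τ = τ * σ ^ 3 ∧ σ * α = α * σ ∧ τ * α = α * τ ∧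
      (τ ≠ 1 ∧ τ ≠ σ ^ 2 ∧ τ ≠ σ ∧ τ ≠ σ ^ 3) ∧ (α ≠ 1 ∧ α ≠ σ ^ 2 ∧ α ≠ σ ∧ α ≠ σ ^ 3) ∧
      (τ * α ≠ 1 ∧ τ * α ≠ σ ^ 2 ∧ τ * α ≠ σ ∧ τ * α ≠ σ ^ 3) := by
    refine ⟨φ.symm (1, .r 1), φ.symm (1, .sr 0), φ.symm (.ofAdd 1, 1), ?_⟩
    simp only [← map_pow, ← map_mul, ← map_one φ.symm, ne_eq, φ.symm.injective.eq_iff]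
    decide
  have hσ4 := h4 σ
  by_cases hσx : (σ ^ 2) x = x
  · exfalso
    obtain ⟨f, y, M, -, -⟩ := h.exists_model_of_genus hg
    have hσ1 : σ ≠ 1 := by
      rintro rfl
      exact hσ2 (one_pow 2)
    have hne : σ x ≠ x := by
      intro h0
      have h1 := M.eq_of_fixes h0 hσ1 hσx hσ2
      rw [sq] at h1
      exact hσ1 (left_eq_mul.1 h1)
    obtain ⟨x', ζ, h', hζ, hxx', hx'x⟩ := h.exists_diagonal hg hσ4 hne
    have hσx' : σ (σ x') = x' := by
      have := fixes_of_mem_adjoin hx'x hσx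
      rwa [sq] at this
    have hneg : σ x' = -x' := by
      have h1 := hσx'
      rw [hζ, map_mul, AlgEquiv.commutes, hζ, ← mul_assoc, ← map_mul] at h1
      rcases mul_self_eq_one_iff.1 (h'.eq_one_of_mul h1) with h2 | h2
      · exfalso
        apply hne
        apply fixes_of_mem_adjoin hxx'
        rw [hζ, h2, map_one, one_mul]
      · rw [hζ, h2, map_neg, map_one, neg_one_mul]
    have hσ3 : (σ ^ 3) x' = -x' := by
      change σ (σ (σ x')) = -x'
      rw [hσx', hneg]
    have hτσ : σ (τ x') = -τ x' := by
      have := DFunLike.congr_fun hστ x'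
      change σ (τ x') = τ ((σ ^ 3) x') at this
      rw [this, hσ3, map_neg]
    have hασ : σ (α x') = -α x' := by
      have := DFunLike.congr_fun hσα x'
      change σ (α x') = α (σ x') at this
      rw [this, hneg, map_neg]
    have hβ2 : (τ * α) ^ 2 = 1 := by
      rw [(show Commute τ α from hτα).mul_pow, hτ2, hα2, one_mul]
    have hβσ : σ ((τ * α) x') = -(τ * α) x' := by
      have := DFunLike.congr_fun (show σ * (τ * α) = τ * α * σ ^ 3 by
        rw [← mul_assoc, hστ, mul_assoc, mul_assoc,
          (show Commute σ α from hσα).pow_left 3]) x'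
      change σ ((τ * α) x') = (τ * α) ((σ ^ 3) x') at this
      rw [this, hσ3, map_neg]
    obtain ⟨k, hk, hk'⟩ := h'.mul_map_eq_const hg hneg hσ2 hσ4 hτ2 hτ.1 hτ.2.1 hτ.2.2.1
      hτ.2.2.2 hτσ
    obtain ⟨l, hl, hl'⟩ := h'.mul_map_eq_const hg hneg hσ2 hσ4 hα2 hα.1 hα.2.1 hα.2.2.1
      hα.2.2.2 hασ
    obtain ⟨m, -, hm'⟩ := h'.mul_map_eq_const hg hneg hσ2 hσ4 hβ2 hβ.1 hβ.2.1 hβ.2.2.1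
      hβ.2.2.2 hβσ
    -- With τx' = k/x', αx' = l/x' and (τα)x' = m/x', applying τ to x'·αx' = l gives km/x'² = l, so
    -- x'² would be constant.
    have h5 := congrArg τ hl'
    rw [map_mul, AlgEquiv.commutes] at h5
    change τ x' * (τ * α) x' = _ at h5
    apply h'.sq_ne_algebraMap (k * m / l)
    have hl0 : algebraMap ℂ K l ≠ 0 := (_root_.map_ne_zero _).2 hl
    rw [map_div₀, map_mul]
    field_simp
    rw [← h5, ← hk', ← hm']
    ring
  · have hne : σ x ≠ x := by
      intro h0
      apply hσx
      rw [sq]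
      change σ (σ x) = x
      rw [h0, h0]
    obtain ⟨x', ζ, h', hζ, hxx', hx'x⟩ := h.exists_diagonal hg hσ4 hne
    have hζ4 : (ζ * ζ) * (ζ * ζ) = 1 := by
      have h1 : σ (σ (σ (σ x'))) = x' := DFunLike.congr_fun hσ4 x'
      simp only [hζ, map_mul, AlgEquiv.commutes] at h1
      apply h'.eq_one_of_mul
      simp only [map_mul]
      linear_combination h1
    -- From σ⁴ = 1 one gets ζ⁴ = 1, and ζ² = 1 would make σ² fix x.
    have hζ2 : ζ ^ 2 = -1 := by
      rw [sq]
      refine (mul_self_eq_one_iff.1 hζ4).resolve_left fun h2 => hσx ?_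
      apply fixes_of_mem_adjoin hxx'
      rw [sq]
      change σ (σ x') = x'
      rw [hζ, map_mul, AlgEquiv.commutes, hζ, ← mul_assoc, ← map_mul, h2, map_one, one_mul]
    obtain ⟨f, y, M, h8, h7⟩ := h'.exists_model_of_genus hg
    obtain ⟨hf, ha, hc⟩ := M.eq_quadratic_of_diagonal h8 h7 hζ2 hζ
    refine M.exists_param_equiv hf ha (fun hb => ?_) hc
    rw [hb, C_0, zero_mul, add_zero] at hf
    obtain ⟨e, he⟩ := M.exists_pow_four_ne_one hf
    exact he (h4 e)

end

end CurveFF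

end

theorem mainTheorem10 :
    -- every such curve is isomorphic to some `C_t`
    (∀ (K : Type*) [Field K] [Algebra ℂ K],
      CurveFF.IsHyperellipticGenusThree K →
      Nonempty ((K ≃ₐ[ℂ] K) ≃* (Multiplicative (ZMod 2) × DihedralGroup 4)) →
      ∃ t : CurveFF.Param, Nonempty (K ≃ₐ[ℂ] CurveFF.CurveField t)) ∧
    (∀ t : CurveFF.Param,
      -- the points `(0, 1)` and `(0, -1)` of `C_t` have 2-weight 3
      (∀ b : ℂ, (b = 1 ∨ b = -1) →
        ∃ P : CurveFF.Place (CurveFF.CurveField t),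
          (∀ Q, CurveFF.IsAffinePoint t Q 0 b ↔ Q = P) ∧ P.HasWeight 2 3) ∧
      -- the two points at infinity of `C_t` have 2-weight 3
      (Set.encard {P | CurveFF.IsAtInfinity t P} = 2 ∧
        ∀ P, CurveFF.IsAtInfinity t P → P.HasWeight 2 3) ∧
      -- the table, for every curve isomorphic to `C_t`
      (∀ (K : Type*) [Field K] [Algebra ℂ K], Nonempty (K ≃ₐ[ℂ] CurveFF.CurveField t) →
        ((t : ℂ) = 196 → CurveFF.numWeight K 1 = 24 ∧ CurveFF.numWeight K 2 = 0 ∧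
          CurveFF.numWeight K 3 = 12) ∧
        ((t : ℂ) = -196 / 15 → CurveFF.numWeight K 1 = 16 ∧ CurveFF.numWeight K 2 = 16 ∧
          CurveFF.numWeight K 3 = 4) ∧
        ((t : ℂ) ≠ 196 → (t : ℂ) ≠ -196 / 15 →
          CurveFF.numWeight K 1 = 48 ∧ CurveFF.numWeight K 2 = 0 ∧
          CurveFF.numWeight K 3 = 4))) := by
  refine ⟨?_, fun t => CurveFF.curveField_weights t⟩
  rintro K _ _ ⟨⟨x, hx⟩, hg⟩ ⟨φ⟩
  exact CurveFF.DegTwo.exists_param_equiv hx hg φ
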